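/- Let $\mathcal H$ be a separable complex Hilbert space, $\mathcal L(\mathcal H)$ the bounded operators, $\mathcal T(\mathcal H)$ the trace-class operators and $\mathcal S(\mathcal H)$ the states (positive operators of trace one). A POVM is a map $M$ from the Borel sets of a standard Borel space $\Omega_M$ to $\mathcal L(\mathcal H)$ such that $X\mapsto \mathrm{tr}[\rho M(X)]$ is a probability measure for every $\rho\in\mathcal S(\mathcal H)$; it is subnormalized if these are only measures of total mass at most $1$; it is a PVM if every $M(X)$ is an orthogonal projection. A quantum channel is a completely positive trace-preserving linear map $\Lambda:\mathcal T(\mathcal H)\to\mathcal T(\mathcal K)$, with Heisenberg dual $\Lambda^*:\mathcal L(\mathcal K)\to\mathcal L(\mathcal H)$, $\mathrm{tr}[\Lambda(T)A]=\mathrm{tr}[T\Lambda^*(A)]$. It is entanglement breaking if $(\mathrm{id}\otimes\Lambda)(\omega)$ is separable (in the trace-norm closure of the convex hull of the product states) for every state $\omega$ of $\mathcal K'\otimes\mathcal H$ and every separable Hilbert space $\mathcal K'$. Let $\mathcal M$ be a set of PVMs on $\mathcal H$. Then the following four conditions are equivalent. 1. ($\mathcal M$ is normal contextuality non-confirming.)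 There are a POVM $G$ on a standard Borel space $\Omega$ and a weakly measurable family of states $(\sigma_\lambda)_{\lambda\in\Omega}$ such that $\mathrm{tr}[\rho M(X)]=\int_\Omega \mathrm{tr}[M(X)\sigma_\lambda]\,d(\mathrm{tr}[\rho G(\lambda)])$ for all $M\in\mathcal M$, $\rho\in\mathcal S(\mathcal H)$ and measurable $X\subseteq\Omega_M$. 2. There is an entanglement-breaking channel $\Lambda:\mathcal T(\mathcal H)\to\mathcal T(\mathcal H)$ with $\Lambda^*(M(X))=M(X)$ for all $M\in\mathcal M$ and measurable $X$. 3. ($\mathcal M$ is broadcastable.) There is a channel $\Lambda:\mathcal T(\mathcal H)\to\mathcal T(\mathcal H\otimes\mathcal H)$ with $\mathrm{tr}[M(X)\,\mathrm{tr}_2\Lambda(\rho)]=\mathrm{tr}[M(X)\rho]=\mathrm{tr}[M(X)\,\mathrm{tr}_1\Lambda(\rho)]$ for all $M\in\mathcal M$, $\rho\in\mathcal S(\mathcal H)$ and measurable $X$. 4. (Normal/singular decomposition.) There are a channel $\Phi:\mathcal T(\mathcal H)\to\mathcal T(\mathcal H\otimes\mathcal H)$ that is symmetric, $\Phi^*(A\otimes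 B)=\Phi^*(B\otimes A)$, with marginal $\Phi_0^*=\Phi^*(\,\cdot\otimes I)$; a completely positive idempotent $\psi_0$ of $\mathcal L(\mathcal H)$ with $\psi_0\circ\Phi_0^*=\psi_0$ and range $\{A:\Phi_0^*(A)=A\}$, which is a point-ultraweak limit of a subnet of $\frac1n\sum_{k<n}(\Phi_0^*)^k$; and completely positive idempotents $\psi_n$ (normal, i.e. ultraweakly continuous) and $\psi_s$ (singular, i.e. vanishing on the compact operators) with $\psi_0=\psi_n+\psi_s$ and $\psi_n\psi_s=\psi_s\psi_n=0$; and a countable family $(G_i)$ of positive operators with $\sum_iG_i\le I$ for which there are states $\sigma_i$ with $\mathrm{tr}[\sigma_iG_j]=\delta_{ij}$ (a discrete, possibly subnormalized, eigenvalue-1 POVM), such that every $M\in\mathcal M$ decomposes as $M=M_n+M_s$ into subnormalized POVMs with $M_n(X)\in\psi_n(\mathcal L(\mathcal H))$, $M_s(X)\in\psi_s(\mathcal L(\mathcal H))$, both broadcastable by $\Phi$, i.e. $\Phi_0^*(M_n(X))=M_n(X)$ and $\Phi_0^*(M_s(X))=M_s(X)$, and $M_n$ is a post-processing of $(G_i)$: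 $M_n(X)=\sum_i p_M(X|i)\,G_i$ (ultraweakly) with probability measures $p_M(\cdot|i)$ on $\Omega_M$. Moreover, if $\mathcal M$ satisfies these conditions, then every $P\in\mathcal M$ is discrete, i.e. $P(\Omega_P\setminus S)=0$ for some countable $S\subseteq\Omega_P$, and the PVMs in $\mathcal M$ mutually commute: $P(X)Q(Y)=Q(Y)P(X)$ for all $P,Q\in\mathcal M$ and all measurable $X\subseteq\Omega_P$, $Y\subseteq\Omega_Q$. -/

import Mathlib

universe u v w

noncomputable section

namespace QMeas

open MeasureTheory Filter Topology
open scoped TensorProduct InnerProductSpace ENNReal CStarAlgebra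

section TraceClass

variable {H : Type u} [NormedAddCommGroup H] [InnerProductSpace ℂ H] [CompleteSpace H]

variable (H) in
/-- Index set of a fixed orthonormal (Hilbert) basis of `H`. -/
def BasisIndex : Set H := (exists_hilbertBasis ℂ H).choose

variable (H) in
/-- A fixed orthonormal (Hilbert) basis of `H`, used to compute traces. -/
def stdBasis : HilbertBasis (BasisIndex H) ℂ H := (exists_hilbertBasis ℂ H).choose_spec.choose

/-- The trace `tr T = ∑ᵢ ⟨bᵢ, T bᵢ⟩`. It is only ever applied to trace-class operators, for which
the sum converges absolutely and does not depend on the basis. -/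
def trace (T : H →L[ℂ] H) : ℂ := ∑' i, ⟪stdBasis H i, T (stdBasis H i)⟫_ℂ

/-- The trace norm `‖T‖₁ = tr |T| ∈ [0, ∞]`. -/
def traceNorm (T : H →L[ℂ] H) : ℝ≥0∞ :=
  ∑' i, ENNReal.ofReal (⟪stdBasis H i, CFC.abs T (stdBasis H i)⟫_ℂ).re

variable (H) in
/-- The space `𝒯(H)` of trace-class operators, as the linear span of the positive operators with
finite trace. -/
def TraceClass : Submodule ℂ (H →L[ℂ] H) :=
  Submodule.span ℂ
    {T | 0 ≤ T ∧ Summable fun i => ⟪stdBasis H i, T (stdBasis H i)⟫_ℂ}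

variable (H) in
/-- Quantum states: positive operators of trace one. -/
structure State where
  op : H →L[ℂ] H
  nonneg : 0 ≤ op
  hasSum_one : HasSum (fun i => ⟪stdBasis H i, op (stdBasis H i)⟫_ℂ) 1

/-- A state as a trace-class operator. -/
def State.toTraceClass (ρ : State H) : TraceClass H :=
  ⟨ρ.op, Submodule.subset_span ⟨ρ.nonneg, ρ.hasSum_one.summable⟩⟩

variable (H) in
/-- The ultraweak topology on `L(H)`: the coarsest topology for which all maps `A ↦ tr(T A)`,
`T` trace class, are continuous. -/
@[reducible] def ultraweakTopology : TopologicalSpace (H →L[ℂ] H) :=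
  TopologicalSpace.induced
    (fun (A : H →L[ℂ] H) (T : TraceClass H) => trace ((T : H →L[ℂ] H) ∘L A)) inferInstance

end TraceClass

section Tensor

variable {K : Type u} [NormedAddCommGroup K] [InnerProductSpace ℂ K]
variable {H : Type v} [NormedAddCommGroup H] [InnerProductSpace ℂ H]

variable (K H) in
/-- The Hilbert space tensor product: completion of the algebraic tensor product. -/
abbrev HTensor : Type (max u v) := UniformSpace.Completion (K ⊗[ℂ] H)

/-- The operator `A ⊗ B` on the Hilbert space tensor product. -/
def tensorOp (A : K →L[ℂ] K) (B : H →L[ℂ] H) : HTensor K H →L[ℂ] HTensor K H :=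
  (TensorProduct.mapL A B).completion

/-- The operator `x ↦ x ⊗ h` from `K` to `K ⊗ H`. -/
def tensorRight (h : H) : K →L[ℂ] HTensor K H :=
  LinearMap.mkContinuous
    ((UniformSpace.Completion.toComplL (𝕜 := ℂ) (E := K ⊗[ℂ] H)).toLinearMap ∘ₗ
      (TensorProduct.mk ℂ K H).flip h) ‖h‖ (fun x => by
        simp [TensorProduct.norm_tmul, mul_comm])

/-- The operator `x ↦ k ⊗ x` from `H` to `K ⊗ H`. -/
def tensorLeft (k : K) : H →L[ℂ] HTensor K H :=
  LinearMap.mkContinuous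
    ((UniformSpace.Completion.toComplL (𝕜 := ℂ) (E := K ⊗[ℂ] H)).toLinearMap ∘ₗ
      (TensorProduct.mk ℂ K H) k) ‖k‖ (fun x => by
        simp [TensorProduct.norm_tmul])

variable [CompleteSpace K] [CompleteSpace H]

/-- The partial trace `tr₂` over the second factor. The series converges in operator norm for every
trace-class `T`. -/
def partialTrace₂ (T : HTensor K H →L[ℂ] HTensor K H) : K →L[ℂ] K :=
  ∑' i, (tensorRight (K := K) (stdBasis H i)).adjoint ∘L T ∘L tensorRight (stdBasis H i)

/-- The partial trace `tr₁` over the first factor. The series converges in operator norm for every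
trace-class `T`. -/
def partialTrace₁ (T : HTensor K H →L[ℂ] HTensor K H) : H →L[ℂ] H :=
  ∑' i, (tensorLeft (H := H) (stdBasis K i)).adjoint ∘L T ∘L tensorLeft (stdBasis K i)

/-- A state of `K ⊗ H` is separable if it lies in the trace-norm closure of the convex hull of the
product states. -/
def State.IsSeparable (τ : State (HTensor K H)) : Prop :=
  ∀ ε : ℝ≥0∞, 0 < ε →
    ∃ S ∈ convexHull ℝ (Set.range fun p : State K × State H => tensorOp p.1.op p.2.op),
      traceNorm (τ.op - S) < ε

end Tensor

section Channels

variable {H : Type u} [NormedAddCommGroup H] [InnerProductSpace ℂ H] [CompleteSpace H]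
variable {K : Type v} [NormedAddCommGroup K] [InnerProductSpace ℂ K] [CompleteSpace K]

variable (H K) in
/-- Quantum channels `𝒯(H) → 𝒯(K)` (Schrödinger picture): completely positive, trace-preserving
linear maps. -/
structure QuantumChannel extends TraceClass H →ₗ[ℂ] TraceClass K where
  completelyPositive : ∀ (n : ℕ) (T : Fin n → Fin n → TraceClass H),
    0 ≤ CStarMatrix.ofMatrix (Matrix.of fun i j => (T i j : H →L[ℂ] H)) →
    0 ≤ CStarMatrix.ofMatrix (Matrix.of fun i j => (toLinearMap (T i j) : K →L[ℂ] K))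
  tracePreserving : ∀ T : TraceClass H,
    trace (toLinearMap T : K →L[ℂ] K) = trace (T : H →L[ℂ] H)

/-- `Λs : L(K) → L(H)` is the Heisenberg dual `Λ*` of the channel `Λ : 𝒯(H) → 𝒯(K)`:
`tr(Λ(T) A) = tr(T Λ*(A))`. This determines `Λ*` uniquely. -/
def QuantumChannel.IsHeisenbergDual (Λ : QuantumChannel H K)
    (Λs : (K →L[ℂ] K) →ₗ[ℂ] (H →L[ℂ] H)) : Prop :=
  ∀ (T : TraceClass H) (A : K →L[ℂ] K),
    trace ((Λ.toLinearMap T : K →L[ℂ] K) ∘L A) = trace ((T : H →L[ℂ] H) ∘L Λs A)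

/-- Entanglement-breaking channels: for every Hilbert space `K` and every state `ω` of `K ⊗ H` the
output state `τ = (id ⊗ Λ)(ω)`, i.e. the state with `tr(τ (A ⊗ B)) = tr(ω (A ⊗ Λ*(B)))` for all
`A`, `B`, is separable. -/
def QuantumChannel.IsEntanglementBreaking (Λ : QuantumChannel H H) : Prop :=
  ∃ Λs : (H →L[ℂ] H) →ₗ[ℂ] (H →L[ℂ] H), Λ.IsHeisenbergDual Λs ∧
    ∀ (K : Type u) [NormedAddCommGroup K] [InnerProductSpace ℂ K] [CompleteSpace K]
      [TopologicalSpace.SeparableSpace K] (ω : State (HTensor K H)),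
      ∃ τ : State (HTensor K H), τ.IsSeparable ∧
        ∀ (A : K →L[ℂ] K) (B : H →L[ℂ] H),
          trace (τ.op ∘L tensorOp A B) = trace (ω.op ∘L tensorOp A (Λs B))

end Channels

section Measurements

variable {H : Type u} [NormedAddCommGroup H] [InnerProductSpace ℂ H] [CompleteSpace H]

variable (H) in
/-- POVMs on standard Borel outcome spaces: maps `M` from the measurable sets to `L(H)` such that
`X ↦ tr(ρ M(X))` is a probability measure for every state `ρ`. The values of `eff` on nonmeasurable
sets are irrelevant. -/
structure POVM where
  Ω : Type w
  [mΩ : MeasurableSpace Ω]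
  [borel : StandardBorelSpace Ω]
  eff : Set Ω → H →L[ℂ] H
  born : ∀ ρ : State H, ∃ μ : Measure Ω, IsProbabilityMeasure μ ∧
    ∀ X, MeasurableSet X → trace (ρ.op ∘L eff X) = (μ.real X : ℂ)

attribute [instance] POVM.mΩ POVM.borel

/-- The outcome distribution `X ↦ tr(ρ M(X))` of `M` in the state `ρ`. -/
def POVM.distribution (M : POVM.{u, w} H) (ρ : State H) : Measure M.Ω := (M.born ρ).choose

/-- Projection-valued measures (sharp measurements). -/
def POVM.IsPVM (M : POVM.{u, w} H) : Prop := ∀ X, MeasurableSet X → IsStarProjection (M.eff X)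

/-- A discrete POVM: it is concentrated on a countable set of outcomes. -/
def POVM.IsDiscrete (M : POVM.{u, w} H) : Prop := ∃ S : Set M.Ω, S.Countable ∧ M.eff Sᶜ = 0

/-- The set `E(𝓜)` of effects of a set of POVMs. -/
def effects (𝓜 : Set (POVM.{u, w} H)) : Set (H →L[ℂ] H) :=
  {E | ∃ M ∈ 𝓜, ∃ X, MeasurableSet X ∧ E = M.eff X}

/-- Condition 1: `𝓜` is (normal) contextuality non-confirming. -/
def IsContextualityNonConfirming (𝓜 : Set (POVM.{u, w} H)) : Prop :=
  ∃ (G : POVM.{u, 0} H) (σ : G.Ω → State H),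
    (∀ A : H →L[ℂ] H, Measurable fun l => trace (A ∘L (σ l).op)) ∧
    ∀ M ∈ 𝓜, ∀ (ρ : State H) (X : Set M.Ω), MeasurableSet X →
      trace (ρ.op ∘L M.eff X) = ∫ l, trace (M.eff X ∘L (σ l).op) ∂(G.distribution ρ)

/-- Condition 2: `E(𝓜) ⊆ Fix(Λ*)` for some entanglement-breaking channel `Λ`. -/
def IsFixedByEBChannel (𝓜 : Set (POVM.{u, w} H)) : Prop :=
  ∃ (Λ : QuantumChannel H H) (Λs : (H →L[ℂ] H) →ₗ[ℂ] (H →L[ℂ] H)),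
    Λ.IsEntanglementBreaking ∧ Λ.IsHeisenbergDual Λs ∧ ∀ E ∈ effects 𝓜, Λs E = E

/-- Condition 3: `𝓜` is broadcastable. -/
def IsBroadcastable (𝓜 : Set (POVM.{u, w} H)) : Prop :=
  ∃ Λ : QuantumChannel H (HTensor H H),
    ∀ (ρ : State H), ∀ M ∈ 𝓜, ∀ X : Set M.Ω, MeasurableSet X →
      trace (M.eff X ∘L
          partialTrace₂ (Λ.toLinearMap ρ.toTraceClass : HTensor H H →L[ℂ] HTensor H H)) =
        trace (M.eff X ∘L ρ.op) ∧
      trace (M.eff X ∘L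
          partialTrace₁ (Λ.toLinearMap ρ.toTraceClass : HTensor H H →L[ℂ] HTensor H H)) =
        trace (M.eff X ∘L ρ.op)

/-! ### Normal and singular parts -/

/-- A subnormalized POVM on `Ω`: `X ↦ tr(ρ N(X))` is a measure of total mass at most one for every
state `ρ`. -/
def IsSubPOVM {Ω : Type w} [MeasurableSpace Ω] (N : Set Ω → H →L[ℂ] H) : Prop :=
  ∀ ρ : State H, ∃ μ : Measure Ω, μ Set.univ ≤ 1 ∧
    ∀ X, MeasurableSet X → trace (ρ.op ∘L N X) = (μ.real X : ℂ)

/-- The Cesàro means `(1/n) ∑_{k<n} Φ^k`. -/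
def cesaro (Φ : Module.End ℂ (H →L[ℂ] H)) (n : ℕ) : Module.End ℂ (H →L[ℂ] H) :=
  (n : ℂ)⁻¹ • ∑ k ∈ Finset.range n, Φ ^ k

/-- `ψ₀` is a completely positive idempotent with `ψ₀ ∘ Φ = ψ₀` and range `Fix(Φ)`, obtained as the
limit of a point-ultraweakly convergent subnet of the Cesàro means of `Φ`. -/
structure IsFixedPointProjection (Φ : Module.End ℂ (H →L[ℂ] H))
    (ψ₀ : (H →L[ℂ] H) →CP (H →L[ℂ] H)) : Prop where
  idempotent : ∀ A, ψ₀ (ψ₀ A) = ψ₀ A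
  comp_eq : ∀ A, ψ₀ (Φ A) = ψ₀ A
  range_eq : Set.range ψ₀ = {A | Φ A = A}
  limit : ∃ F : Filter ℕ, F.NeBot ∧ F ≤ atTop ∧ ∀ (A : H →L[ℂ] H) (T : TraceClass H),
    Tendsto (fun n => trace ((T : H →L[ℂ] H) ∘L cesaro Φ n A)) F
      (𝓝 (trace ((T : H →L[ℂ] H) ∘L ψ₀ A)))

/-- `ψ₀ = ψₙ ⊕ ψₛ` with `ψₙ` normal (ultraweakly continuous), `ψₛ` singular (vanishing on compact
operators), both completely positive and idempotent, and orthogonal to each other. -/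
structure IsNormalSingularSplitting (ψ₀ ψn ψs : (H →L[ℂ] H) →CP (H →L[ℂ] H)) : Prop where
  sum_eq : ∀ A, ψ₀ A = ψn A + ψs A
  idempotent_n : ∀ A, ψn (ψn A) = ψn A
  idempotent_s : ∀ A, ψs (ψs A) = ψs A
  orthogonal_ns : ∀ A, ψn (ψs A) = 0
  orthogonal_sn : ∀ A, ψs (ψn A) = 0
  normal : @Continuous _ _ (ultraweakTopology H) (ultraweakTopology H) ψn
  singular : ∀ A : H →L[ℂ] H, IsCompactOperator A → ψs A = 0

/-- A discrete (subnormalized) eigenvalue-1 POVM `(Gᵢ)`: positive operators with `∑ᵢ Gᵢ ≤ 1` for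
which there are states `σᵢ` with `tr(σᵢ Gⱼ) = δᵢⱼ`. -/
def IsEigenvalueOnePOVM {ι : Type} (G : ι → H →L[ℂ] H) : Prop :=
  (∀ i, 0 ≤ G i) ∧ (∀ s : Finset ι, ∑ i ∈ s, G i ≤ 1) ∧
    ∃ σ : ι → State H, (∀ i, trace ((σ i).op ∘L G i) = 1) ∧
      ∀ i j, i ≠ j → trace ((σ i).op ∘L G j) = 0

/-- `N` is a post-processing of the discrete POVM `G`: `N(X) = ∑ᵢ p(X|i) Gᵢ` (ultraweakly) for a
Markov kernel `p`. -/
def IsPostProcessing {Ω : Type w} [MeasurableSpace Ω] {ι : Type} (N : Set Ω → H →L[ℂ] H)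
    (G : ι → H →L[ℂ] H) : Prop :=
  ∃ p : ι → Measure Ω, (∀ i, IsProbabilityMeasure (p i)) ∧
    ∀ X, MeasurableSet X → ∀ ρ : State H,
      HasSum (fun i => ((p i).real X : ℂ) * trace (ρ.op ∘L G i)) (trace (ρ.op ∘L N X))

/-- Condition 4: all `M ∈ 𝓜` decompose as `M = Mₙ ⊕ Mₛ` into broadcastable normal and singular
subnormalized POVMs, and all the `Mₙ` are post-processings of a single discrete eigenvalue-1 POVM.
Here `Φ` is the (symmetric) broadcasting channel, `Φ₀ = Φ*(· ⊗ 1) = Φ*(1 ⊗ ·)` its marginal,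
and `ψ₀ = ψₙ ⊕ ψₛ` projects onto the fixed points of `Φ₀`. -/
def HasNormalSingularDecomposition (𝓜 : Set (POVM.{u, w} H)) : Prop :=
  ∃ (Φ : QuantumChannel H (HTensor H H))
    (Φs : (HTensor H H →L[ℂ] HTensor H H) →ₗ[ℂ] (H →L[ℂ] H))
    (Φ₀ : Module.End ℂ (H →L[ℂ] H))
    (ψ₀ ψn ψs : (H →L[ℂ] H) →CP (H →L[ℂ] H)),
    Φ.IsHeisenbergDual Φs ∧
    (∀ A B, Φs (tensorOp A B) = Φs (tensorOp B A)) ∧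
    (∀ A, Φ₀ A = Φs (tensorOp A 1)) ∧
    IsFixedPointProjection Φ₀ ψ₀ ∧
    IsNormalSingularSplitting ψ₀ ψn ψs ∧
    ∃ (ι : Type) (G : ι → H →L[ℂ] H), Countable ι ∧ IsEigenvalueOnePOVM G ∧
      ∀ M ∈ 𝓜, ∃ Mn Ms : Set M.Ω → H →L[ℂ] H,
        IsSubPOVM Mn ∧ IsSubPOVM Ms ∧
        (∀ X, MeasurableSet X →
          M.eff X = Mn X + Ms X ∧
          Φ₀ (Mn X) = Mn X ∧ Φ₀ (Ms X) = Ms X ∧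
          Mn X ∈ Set.range ψn ∧ Ms X ∈ Set.range ψs) ∧
        IsPostProcessing Mn G

end Measurements

end QMeas

end

/-!
All four conditions are equivalent to one more: some countable orthonormal basis of `H` consists of
joint eigenvectors of all effects of `𝓜`. Given such a basis `b` everything is explicit. The sharp
measurement of `b` followed by the preparation of `|bᵢ⟩⟨bᵢ|` is a noncontextual model. The pinching
`A ↦ ∑ᵢ ⟨bᵢ, A bᵢ⟩ |bᵢ⟩⟨bᵢ|` fixes all effects, and it is entanglement breaking because it turns a
state of `K ⊗ H` into a mixture of the mutually orthogonal states `αᵢ ⊗ |bᵢ⟩⟨bᵢ|`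
(`pinchChannel_isEntanglementBreaking`). The copying map `bᵢ ↦ bᵢ ⊗ bᵢ` after the pinching
broadcasts, and the pinching itself is a normal projection onto its fixed points, so the singular
part of the decomposition vanishes. Discreteness and commutativity can be read off from the basis: in
the state `bᵢ` a sharp measurement has `{0, 1}`-valued outcome distribution, hence a Dirac measure.

For the converse each of the first three conditions yields a Boolean algebra `R` of commuting
projections containing the effects.

* If `Λ` broadcasts `Q`, then `(Q ⊗ 1) Λ(|x⟩⟨y|) = Λ(|Qx⟩⟨y|) = (1 ⊗ Q) Λ(|x⟩⟨y|)`
  (`QuantumChannel.comp_block`), so two broadcast projections commute because `Q ⊗ 1` and `1 ⊗ P` do.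
* If an entanglement-breaking `Λ` fixes `Q`, the partial transposition criterion
  (`State.IsSeparable.sum_inner_nonneg`) allows `Q` to be moved from one side of `Λ(|x⟩⟨y|)` to the
  other.
* If `(G, σ)` is a noncontextual model of `Q`, then `tr(σ_λ Q)` is almost surely `0` or `1`, and `Q`
  is the effect of `G` for the event `tr(σ_λ Q) = 1` (`mem_deterministicProjections`).

In each case a unit vector `x` gives a state `S` (the marginal of `Λ(|x⟩⟨x|)`, `Λ(|x⟩⟨x|)` itself, or
the mean of the `σ_λ`) which commutes with `R` and satisfies `⟨v, S v⟩ ≤ ⟨x, Q x⟩` for unit vectors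
`v` in the range of `Q ∈ R`. This suffices (`IsCompactlyModelled.exists_hilbertBasis`). As `S` is
compact and nonzero, it has a finite-dimensional eigenspace, which contains a joint eigenvector `v` of
`R` with `⟨v, S v⟩ > 0`. So `⟨x, Q x⟩` is bounded below over all `Q ∈ R` that fix `v`, and the limit
`y` of the decreasing net `Q x` is nonzero and is not orthogonal to `x`; it is a joint eigenvector of
`R` with the same eigenvalues as `v`. Hence no unit vector is orthogonal to all joint eigenvectors,
and a maximal orthonormal family of them is a basis.
-/

noncomputable section

namespace QMeas

open MeasureTheory Filter Topology
open scoped TensorProduct InnerProductSpace ENNReal CStarAlgebra ComplexOrder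

set_option linter.unusedSectionVars false

/-! ### Hilbert–Schmidt sums and the trace -/

section HilbertSchmidt

variable {H : Type u} [NormedAddCommGroup H] [InnerProductSpace ℂ H] [CompleteSpace H]
variable {K : Type v} [NormedAddCommGroup K] [InnerProductSpace ℂ K] [CompleteSpace K]
variable {ι ι' κ : Type*}

theorem hasSum_norm_inner_sq (b : HilbertBasis ι ℂ H) (x : H) :
    HasSum (fun i => ‖⟪b i, x⟫_ℂ‖ ^ 2) (‖x‖ ^ 2) := by
  have h := b.hasSum_inner_mul_inner x x
  rw [inner_self_eq_norm_sq_to_K] at h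
  have h2 : (fun i => ⟪x, b i⟫_ℂ * ⟪b i, x⟫_ℂ) = fun i => ((‖⟪b i, x⟫_ℂ‖ ^ 2 : ℝ) : ℂ) := by
    funext i
    rw [← inner_conj_symm x (b i), ← Complex.normSq_eq_conj_mul_self, Complex.normSq_eq_norm_sq]
  rw [h2] at h
  exact Complex.hasSum_ofReal.1 (by simpa using h)

theorem summable_norm_inner_sq_prod (b : HilbertBasis ι ℂ H) (c : HilbertBasis κ ℂ K)
    {S : H →L[ℂ] K} (hS : Summable fun i => ‖S (b i)‖ ^ 2) :
    Summable fun p : ι × κ => ‖⟪c p.2, S (b p.1)⟫_ℂ‖ ^ 2 := by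
  rw [summable_prod_of_nonneg (fun p => by positivity)]
  refine ⟨fun i => (hasSum_norm_inner_sq c (S (b i))).summable, ?_⟩
  simpa only [(hasSum_norm_inner_sq c _).tsum_eq] using hS

/-- The Hilbert–Schmidt property passes to the adjoint and does not depend on the basis. -/
theorem summable_norm_adjoint_sq (b : HilbertBasis ι ℂ H) (c : HilbertBasis κ ℂ K)
    {S : H →L[ℂ] K} (hS : Summable fun i => ‖S (b i)‖ ^ 2) :
    Summable fun j => ‖S.adjoint (c j)‖ ^ 2 := by
  have h := (summable_norm_inner_sq_prod b c hS).comp_injective (Equiv.prodComm κ ι).injective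
  rw [summable_prod_of_nonneg (fun p => by simp only [Function.comp]; positivity)] at h
  refine h.2.congr fun j => ?_
  rw [← (hasSum_norm_inner_sq b _).tsum_eq]
  refine tsum_congr fun i => ?_
  rw [ContinuousLinearMap.adjoint_inner_right, norm_inner_symm]
  rfl

/-- For Hilbert–Schmidt operators `S` and `T`, the traces of `S†T` and of `TS†` agree. -/
theorem exists_hasSum_inner (b : HilbertBasis ι ℂ H) (c : HilbertBasis κ ℂ K)
    {S T : H →L[ℂ] K} (hS : Summable fun i => ‖S (b i)‖ ^ 2)
    (hT : Summable fun i => ‖T (b i)‖ ^ 2) :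
    ∃ t : ℂ, HasSum (fun i => ⟪S (b i), T (b i)⟫_ℂ) t ∧
      HasSum (fun j => ⟪T.adjoint (c j), S.adjoint (c j)⟫_ℂ) t := by
  have hf : Summable fun p : ι × κ => ⟪S (b p.1), c p.2⟫_ℂ * ⟪c p.2, T (b p.1)⟫_ℂ := by
    refine Summable.of_norm_bounded
      ((summable_norm_inner_sq_prod b c hS).add (summable_norm_inner_sq_prod b c hT)) fun p => ?_
    rw [norm_mul, norm_inner_symm]
    have h := two_mul_le_add_sq ‖⟪c p.2, S (b p.1)⟫_ℂ‖ ‖⟪c p.2, T (b p.1)⟫_ℂ‖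
    have h' := mul_nonneg (norm_nonneg ⟪c p.2, S (b p.1)⟫_ℂ) (norm_nonneg ⟪c p.2, T (b p.1)⟫_ℂ)
    linarith
  have h1 : HasSum (fun i => ⟪S (b i), T (b i)⟫_ℂ) (∑' p : ι × κ, _) :=
    HasSum.prod_fiberwise hf.hasSum fun i => c.hasSum_inner_mul_inner (S (b i)) (T (b i))
  have h2 := (Equiv.prodComm κ ι).hasSum_iff.2 hf.hasSum
  have h3 : ∀ j, HasSum (fun i => ⟪S (b i), c j⟫_ℂ * ⟪c j, T (b i)⟫_ℂ)
      ⟪T.adjoint (c j), S.adjoint (c j)⟫_ℂ := fun j => by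
    have h := b.hasSum_inner_mul_inner (T.adjoint (c j)) (S.adjoint (c j))
    simp only [ContinuousLinearMap.adjoint_inner_left, ContinuousLinearMap.adjoint_inner_right] at h ⊢
    exact h.congr_fun fun i => mul_comm _ _
  exact ⟨_, h1, HasSum.prod_fiberwise h2 h3⟩

theorem exists_selfAdjoint_sqrt {T : H →L[ℂ] H} (hT : 0 ≤ T) :
    ∃ S : H →L[ℂ] H, S.adjoint = S ∧ (∀ x, T x = S (S x)) ∧ ∀ x y, ⟪S x, y⟫_ℂ = ⟪x, S y⟫_ℂ := by
  have hS : (CFC.sqrt T).adjoint = CFC.sqrt T :=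
    (IsSelfAdjoint.of_nonneg (CFC.sqrt_nonneg T)).adjoint_eq
  refine ⟨CFC.sqrt T, hS, fun x => ?_, fun x y => ?_⟩
  · exact (DFunLike.congr_fun (CFC.sqrt_mul_sqrt_self T hT) x).symm
  · rw [← ContinuousLinearMap.adjoint_inner_left, hS]

/-- The basic fact behind the trace: for a positive operator `T` of finite trace, both diagonal sums
below converge to the same value, in whatever bases they are computed. -/
theorem exists_hasSum_inner_of_nonneg {T : H →L[ℂ] H} (hT : 0 ≤ T)
    (a : HilbertBasis ι' ℂ H) (hs : Summable fun i => ⟪a i, T (a i)⟫_ℂ)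
    (b : HilbertBasis ι ℂ H) (c : HilbertBasis κ ℂ K) (B : H →L[ℂ] K) (C : K →L[ℂ] H) :
    ∃ t : ℂ, HasSum (fun i => ⟪b i, T (C (B (b i)))⟫_ℂ) t ∧
      HasSum (fun j => ⟪c j, B (T (C (c j)))⟫_ℂ) t := by
  obtain ⟨S, hSsa, happ, hsym⟩ := exists_selfAdjoint_sqrt hT
  have hS0 : Summable fun i => ‖S (a i)‖ ^ 2 := by
    have h := (Complex.hasSum_re hs.hasSum).summable
    refine h.congr fun i => ?_
    rw [happ, ← hsym, inner_self_eq_norm_sq_to_K]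
    norm_cast
  have hS : Summable fun i => ‖S (b i)‖ ^ 2 := by
    simpa only [hSsa] using summable_norm_adjoint_sq a b hS0
  have hcomp : ∀ (L : Type v) [NormedAddCommGroup L] [InnerProductSpace ℂ L] (A : H →L[ℂ] L),
      Summable fun i => ‖(A ∘L S) (b i)‖ ^ 2 := fun L _ _ A => by
    refine Summable.of_nonneg_of_le (fun i => by positivity) (fun i => ?_) (hS.mul_left (‖A‖ ^ 2))
    rw [← mul_pow]
    exact pow_le_pow_left₀ (norm_nonneg _) (A.le_opNorm _) 2
  have h1 : Summable fun j => ‖(S ∘L B.adjoint) (c j)‖ ^ 2 := by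
    simpa only [ContinuousLinearMap.adjoint_comp, hSsa] using
      summable_norm_adjoint_sq b c (hcomp K B)
  have h2 : Summable fun j => ‖(S ∘L C) (c j)‖ ^ 2 := by
    simpa only [ContinuousLinearMap.adjoint_comp, hSsa, ContinuousLinearMap.adjoint_adjoint] using
      summable_norm_adjoint_sq b c (hcomp K C.adjoint)
  have h3 : Summable fun i => ‖(S ∘L (C ∘L B)) (b i)‖ ^ 2 := by
    have h : Summable fun i => ‖((C ∘L B).adjoint ∘L S) (b i)‖ ^ 2 := by
      refine Summable.of_nonneg_of_le (fun i => by positivity) (fun i => ?_)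
        (hS.mul_left (‖(C ∘L B).adjoint‖ ^ 2))
      rw [← mul_pow]
      exact pow_le_pow_left₀ (norm_nonneg _) ((C ∘L B).adjoint.le_opNorm _) 2
    simpa only [ContinuousLinearMap.adjoint_comp, hSsa, ContinuousLinearMap.adjoint_adjoint] using
      summable_norm_adjoint_sq b b h
  obtain ⟨t, ht1, ht2⟩ := exists_hasSum_inner c b h1 h2
  obtain ⟨t', ht1', ht2'⟩ := exists_hasSum_inner b b hS h3
  have hts : t = t' := by
    refine ht2.unique ?_
    convert ht2' using 2 with i
    simp only [ContinuousLinearMap.adjoint_comp, hSsa, ContinuousLinearMap.adjoint_adjoint,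
      ContinuousLinearMap.comp_apply, ContinuousLinearMap.adjoint_inner_left]
  refine ⟨t, ?_, ?_⟩
  · rw [hts]
    convert ht1' using 2 with i
    simp only [happ, hsym, ContinuousLinearMap.comp_apply]
  · convert ht1 using 2 with j
    simp only [happ, hsym, ContinuousLinearMap.comp_apply, ContinuousLinearMap.adjoint_inner_left]

/-- The trace of `T C B`, for trace-class `T`, is the diagonal sum of `B T C` in any basis. This
contains basis independence, cyclicity and convergence of the trace. -/
theorem hasSum_trace {T : H →L[ℂ] H} (hT : T ∈ TraceClass H) (c : HilbertBasis κ ℂ K)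
    (B : H →L[ℂ] K) (C : K →L[ℂ] H) :
    HasSum (fun j => ⟪c j, B (T (C (c j)))⟫_ℂ) (trace (T ∘L C ∘L B)) := by
  have key : ∃ t : ℂ, HasSum (fun i => ⟪stdBasis H i, T (C (B (stdBasis H i)))⟫_ℂ) t ∧
      HasSum (fun j => ⟪c j, B (T (C (c j)))⟫_ℂ) t := by
    induction hT using Submodule.span_induction with
    | mem T hT => exact exists_hasSum_inner_of_nonneg hT.1 _ hT.2 _ c B C
    | zero => exact ⟨0, by simp [hasSum_zero], by simp [hasSum_zero]⟩
    | add S T _ _ hS hT =>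
      obtain ⟨s, hs1, hs2⟩ := hS
      obtain ⟨t, ht1, ht2⟩ := hT
      exact ⟨s + t, by simpa [inner_add_right] using hs1.add ht1,
        by simpa [inner_add_right] using hs2.add ht2⟩
    | smul a T _ hT =>
      obtain ⟨t, ht1, ht2⟩ := hT
      exact ⟨a * t, by simpa [inner_smul_right] using ht1.mul_left a,
        by simpa [inner_smul_right] using ht2.mul_left a⟩
  obtain ⟨t, ht1, ht2⟩ := key
  convert ht2
  exact ht1.tsum_eq

end HilbertSchmidt
section TraceAPI

open InnerProductSpace

variable {H : Type u} [NormedAddCommGroup H] [InnerProductSpace ℂ H] [CompleteSpace H]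
variable {ι : Type*}

theorem nonneg_iff_forall_inner {T : H →L[ℂ] H} : 0 ≤ T ↔ ∀ x, 0 ≤ ⟪x, T x⟫_ℂ := by
  rw [ContinuousLinearMap.nonneg_iff_isPositive]
  refine ⟨fun h x => h.inner_nonneg_right x, fun h => ?_⟩
  rw [ContinuousLinearMap.isPositive_iff_complex]
  intro x
  have hx := Complex.nonneg_iff.1 (h x)
  have hc := inner_conj_symm (𝕜 := ℂ) (T x) x
  have hc1 := congrArg Complex.re hc
  have hc2 := congrArg Complex.im hc
  rw [Complex.conj_re] at hc1
  rw [Complex.conj_im] at hc2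
  refine ⟨Complex.ext rfl ?_, ?_⟩
  · simp only [Complex.ofReal_im]
    rw [← hc2, ← hx.2, neg_zero]
  · exact hx.1.trans_eq hc1

theorem hasSum_trace_comp {T : H →L[ℂ] H} (hT : T ∈ TraceClass H) (b : HilbertBasis ι ℂ H)
    (A : H →L[ℂ] H) : HasSum (fun i => ⟪b i, T (A (b i))⟫_ℂ) (trace (T ∘L A)) :=
  hasSum_trace hT b (ContinuousLinearMap.id ℂ H) A

theorem hasSum_trace_comp' {T : H →L[ℂ] H} (hT : T ∈ TraceClass H) (b : HilbertBasis ι ℂ H)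
    (A : H →L[ℂ] H) : HasSum (fun i => ⟪b i, A (T (b i))⟫_ℂ) (trace (T ∘L A)) :=
  hasSum_trace hT b A (ContinuousLinearMap.id ℂ H)

theorem hasSum_trace_self {T : H →L[ℂ] H} (hT : T ∈ TraceClass H) (b : HilbertBasis ι ℂ H) :
    HasSum (fun i => ⟪b i, T (b i)⟫_ℂ) (trace T) :=
  hasSum_trace_comp hT b (ContinuousLinearMap.id ℂ H)

theorem trace_comp_comm {T : H →L[ℂ] H} (hT : T ∈ TraceClass H) (A : H →L[ℂ] H) :
    trace (A ∘L T) = trace (T ∘L A) :=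
  (hasSum_trace_comp' hT (stdBasis H) A).tsum_eq

theorem trace_comp_add {T : H →L[ℂ] H} (hT : T ∈ TraceClass H) (A B : H →L[ℂ] H) :
    trace (T ∘L (A + B)) = trace (T ∘L A) + trace (T ∘L B) := by
  refine HasSum.tsum_eq ?_
  simpa [inner_add_right] using
    (hasSum_trace_comp hT (stdBasis H) A).add (hasSum_trace_comp hT (stdBasis H) B)

theorem trace_comp_smul (T : H →L[ℂ] H) (a : ℂ) (A : H →L[ℂ] H) :
    trace (T ∘L (a • A)) = a * trace (T ∘L A) := by
  simp [trace, tsum_mul_left]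

theorem trace_comp_sub {T : H →L[ℂ] H} (hT : T ∈ TraceClass H) (A B : H →L[ℂ] H) :
    trace (T ∘L (A - B)) = trace (T ∘L A) - trace (T ∘L B) := by
  rw [eq_sub_iff_add_eq, ← trace_comp_add hT, sub_add_cancel]

theorem trace_add_comp {S T : H →L[ℂ] H} (hS : S ∈ TraceClass H) (hT : T ∈ TraceClass H)
    (A : H →L[ℂ] H) : trace ((S + T) ∘L A) = trace (S ∘L A) + trace (T ∘L A) := by
  refine HasSum.tsum_eq ?_
  simpa [inner_add_right] using
    (hasSum_trace_comp hS (stdBasis H) A).add (hasSum_trace_comp hT (stdBasis H) A)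

theorem trace_smul_comp (a : ℂ) (T A : H →L[ℂ] H) :
    trace ((a • T) ∘L A) = a * trace (T ∘L A) := by
  simp [trace, tsum_mul_left]

theorem trace_smul (a : ℂ) (T : H →L[ℂ] H) : trace (a • T) = a * trace T := by
  simp [trace, tsum_mul_left]

theorem mem_traceClass_of_nonneg {T : H →L[ℂ] H} (hT : 0 ≤ T) (b : HilbertBasis ι ℂ H)
    (hs : Summable fun i => ⟪b i, T (b i)⟫_ℂ) : T ∈ TraceClass H := by
  obtain ⟨t, -, ht⟩ := exists_hasSum_inner_of_nonneg hT b hs (stdBasis H) (stdBasis H)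
    (ContinuousLinearMap.id ℂ H) (ContinuousLinearMap.id ℂ H)
  exact Submodule.subset_span ⟨hT, ht.summable⟩

theorem trace_rankOne_comp (x y : H) (A : H →L[ℂ] H) :
    trace (rankOne ℂ x y ∘L A) = ⟪y, A x⟫_ℂ := by
  refine HasSum.tsum_eq ?_
  rw [← ContinuousLinearMap.adjoint_inner_left]
  refine ((stdBasis H).hasSum_inner_mul_inner (A.adjoint y) x).congr_fun fun i => ?_
  simp [ContinuousLinearMap.adjoint_inner_left]

theorem trace_comp_rankOne (x y : H) (A : H →L[ℂ] H) :
    trace (A ∘L rankOne ℂ x y) = ⟪y, A x⟫_ℂ := by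
  refine HasSum.tsum_eq ?_
  refine ((stdBasis H).hasSum_inner_mul_inner y (A x)).congr_fun fun i => ?_
  simp

theorem rankOne_self_nonneg (x : H) : 0 ≤ rankOne ℂ x x :=
  (ContinuousLinearMap.nonneg_iff_isPositive _).2 (isPositive_rankOne_self x)

theorem rankOne_self_mem_traceClass (x : H) : rankOne ℂ x x ∈ TraceClass H := by
  refine Submodule.subset_span ⟨rankOne_self_nonneg x, ?_⟩
  refine ((stdBasis H).hasSum_inner_mul_inner x x).summable.congr fun i => ?_
  simp

theorem rankOne_mem_traceClass (x y : H) : rankOne ℂ x y ∈ TraceClass H := by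
  have h : rankOne ℂ x y = (1 / 4 : ℂ) • (rankOne ℂ (x + y) (x + y) - rankOne ℂ (x - y) (x - y)
      + Complex.I • rankOne ℂ (x + Complex.I • y) (x + Complex.I • y)
      - Complex.I • rankOne ℂ (x - Complex.I • y) (x - Complex.I • y)) := by
    -- polarization
    ext z
    simp only [rankOne_apply, smul_apply, add_apply,
      sub_apply, inner_add_left, inner_sub_left, inner_smul_left,
      Complex.conj_I]
    match_scalars
    · ring_nf; simp; ring
    · ring_nf; simp
  rw [h]
  have := @rankOne_self_mem_traceClass H _ _ _
  exact Submodule.smul_mem _ _ (Submodule.sub_mem _ (Submodule.add_mem _ (Submodule.sub_mem _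
    (this _) (this _)) (Submodule.smul_mem _ _ (this _))) (Submodule.smul_mem _ _ (this _)))

theorem trace_comp_nonneg {T A : H →L[ℂ] H} (hT : T ∈ TraceClass H) (hT0 : 0 ≤ T) (hA : 0 ≤ A) :
    0 ≤ trace (T ∘L A) := by
  obtain ⟨S, -, hSS, hsym⟩ := exists_selfAdjoint_sqrt hA
  have hA' : A = S ∘L S := by ext x; exact hSS x
  rw [hA']
  refine (hasSum_trace hT (stdBasis H) S S).nonneg fun i => ?_
  rw [← hsym]
  exact nonneg_iff_forall_inner.1 hT0 _

theorem trace_comp_mono {T A B : H →L[ℂ] H} (hT : T ∈ TraceClass H) (hT0 : 0 ≤ T) (h : A ≤ B) :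
    trace (T ∘L A) ≤ trace (T ∘L B) := by
  rw [← sub_nonneg, ← trace_comp_sub hT]
  exact trace_comp_nonneg hT hT0 (sub_nonneg.2 h)

theorem apply_eq_zero_of_inner_eq_zero {T : H →L[ℂ] H} (hT : 0 ≤ T) {x : H}
    (h : ⟪x, T x⟫_ℂ = 0) : T x = 0 := by
  obtain ⟨S, -, hSS, hsym⟩ := exists_selfAdjoint_sqrt hT
  rw [hSS, ← hsym, inner_self_eq_zero] at h
  rw [hSS, h, map_zero]

theorem clm_ext_basis {K : Type*} [NormedAddCommGroup K] [InnerProductSpace ℂ K]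
    (b : HilbertBasis ι ℂ H) {A B : H →L[ℂ] K} (h : ∀ i, A (b i) = B (b i)) : A = B := by
  refine ContinuousLinearMap.ext_on (s := Set.range b) ?_ ?_
  · rw [Submodule.dense_iff_topologicalClosure_eq_top]
    exact b.dense_span
  · rintro _ ⟨i, rfl⟩
    exact h i

/-- If `tr(T E) = 0` for a positive `T` and a projection `E`, then `E T E` has zero diagonal, and so
`T` vanishes on the range of `E`. -/
theorem comp_eq_zero_of_trace_eq_zero {T E : H →L[ℂ] H} (hT : T ∈ TraceClass H) (hT0 : 0 ≤ T)
    (hE : IsStarProjection E) (h : trace (T ∘L E) = 0) : T ∘L E = 0 := by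
  have hsym : ∀ x y, ⟪E x, y⟫_ℂ = ⟪x, E y⟫_ℂ := fun x y => by
    rw [← ContinuousLinearMap.adjoint_inner_left, hE.isSelfAdjoint.adjoint_eq]
  have hEE : E ∘L E = E := hE.isIdempotentElem
  have hs := hasSum_trace hT (stdBasis H) E E
  rw [hEE, h] at hs
  have h0 : ∀ i, 0 ≤ ⟪stdBasis H i, E (T (E (stdBasis H i)))⟫_ℂ := fun i => by
    rw [← hsym]
    exact nonneg_iff_forall_inner.1 hT0 _
  have h1 := (hasSum_zero_iff_of_nonneg h0).1 hs
  refine clm_ext_basis (stdBasis H) fun i => ?_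
  refine apply_eq_zero_of_inner_eq_zero hT0 ?_
  exact (hsym _ _).trans (congr_fun h1 i)

/-! ### States -/

theorem State.mem (ρ : State H) : ρ.op ∈ TraceClass H := ρ.toTraceClass.2

theorem State.trace_eq (ρ : State H) : trace ρ.op = 1 := ρ.hasSum_one.tsum_eq

theorem State.inner_nonneg (ρ : State H) (x : H) : 0 ≤ ⟪x, ρ.op x⟫_ℂ :=
  nonneg_iff_forall_inner.1 ρ.nonneg x

/-- A positive trace-class operator of trace one, as a state. -/
def State.ofTrace (T : H →L[ℂ] H) (hT : 0 ≤ T) (hT' : T ∈ TraceClass H) (h : trace T = 1) :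
    State H where
  op := T
  nonneg := hT
  hasSum_one := h ▸ hasSum_trace_self hT' _

/-- The pure state `|x⟩⟨x|` of a unit vector `x`. -/
def State.pure (x : H) (hx : ‖x‖ = 1) : State H :=
  .ofTrace (rankOne ℂ x x) (rankOne_self_nonneg x) (rankOne_self_mem_traceClass x) (by
    have h := trace_rankOne_comp x x (ContinuousLinearMap.id ℂ H)
    rw [ContinuousLinearMap.comp_id] at h
    simp [h, inner_self_eq_norm_sq_to_K, hx])

@[simp] theorem State.pure_op (x : H) (hx : ‖x‖ = 1) : (State.pure x hx).op = rankOne ℂ x x := rfl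

/-- Every positive trace-class operator is a nonnegative multiple of a state. -/
theorem exists_state_smul [Nonempty (State H)] {T : H →L[ℂ] H} (hT : 0 ≤ T)
    (hT' : T ∈ TraceClass H) : ∃ α : State H, T = trace T • α.op := by
  by_cases h : trace T = 0
  · obtain ⟨α⟩ := ‹Nonempty (State H)›
    refine ⟨α, ?_⟩
    have h1 := comp_eq_zero_of_trace_eq_zero hT' hT (IsStarProjection.one (R := H →L[ℂ] H)) h
    rw [h, zero_smul]
    exact h1
  · refine ⟨.ofTrace ((trace T)⁻¹ • T) ?_ (Submodule.smul_mem _ _ hT') ?_, ?_⟩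
    · have h0 : 0 ≤ trace T := trace_comp_nonneg hT' hT (A := 1) zero_le_one
      refine nonneg_iff_forall_inner.2 fun x => ?_
      rw [smul_apply, inner_smul_right]
      exact mul_nonneg (inv_nonneg.2 h0) (nonneg_iff_forall_inner.1 hT x)
    · rw [trace_smul, inv_mul_cancel₀ h]
    · simp [State.ofTrace, smul_smul, h]

theorem State.nonempty_of_nontrivial [Nontrivial H] : Nonempty (State H) := by
  obtain ⟨x, hx⟩ := exists_norm_eq H zero_le_one
  exact ⟨.pure x hx⟩

/-- If the unit vector `x` lies in the range of the projection `Q`, then `|x⟩⟨x| ≤ Q`. -/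
theorem inner_le_trace {T : H →L[ℂ] H} (hT : T ∈ TraceClass H) (hT0 : 0 ≤ T) {Q : H →L[ℂ] H}
    (hQ : IsStarProjection Q) {x : H} (hx : ‖x‖ = 1) (hQx : Q x = x) :
    ⟪x, T x⟫_ℂ ≤ trace (T ∘L Q) := by
  rw [← trace_comp_rankOne]
  refine trace_comp_mono hT hT0 ?_
  have hsym : ∀ y z, ⟪Q y, z⟫_ℂ = ⟪y, Q z⟫_ℂ := fun y z => by
    rw [← ContinuousLinearMap.adjoint_inner_left, hQ.isSelfAdjoint.adjoint_eq]
  have hp := isStarProjection_rankOne_self (𝕜 := ℂ) hx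
  refine (IsStarProjection.le_iff_mul_eq_right hp hQ).2 ?_
  ext z
  simp [hQx]

/-! ### Compactness of trace-class operators -/

/-- The operator norm is dominated by the Hilbert–Schmidt norm. -/
theorem norm_apply_sq_le (b : HilbertBasis ι ℂ H) {A : H →L[ℂ] H}
    (hA : Summable fun i => ‖A (b i)‖ ^ 2) : ‖A‖ ^ 2 ≤ ∑' i, ‖A (b i)‖ ^ 2 := by
  have h0 : 0 ≤ ∑' i, ‖A (b i)‖ ^ 2 := tsum_nonneg fun i => by positivity
  rw [← Real.le_sqrt (norm_nonneg _) h0, ← LinearIsometryEquiv.norm_map ContinuousLinearMap.adjoint A]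
  refine ContinuousLinearMap.opNorm_le_bound _ (Real.sqrt_nonneg _) fun y => ?_
  refine (sq_le_sq₀ (norm_nonneg _) (by positivity)).1 ?_
  rw [mul_pow, Real.sq_sqrt h0, ← (hasSum_norm_inner_sq b _).tsum_eq, ← tsum_mul_right]
  refine Summable.tsum_le_tsum (fun i => ?_) (hasSum_norm_inner_sq b _).summable (hA.mul_right _)
  rw [ContinuousLinearMap.adjoint_inner_right, ← mul_pow]
  exact pow_le_pow_left₀ (norm_nonneg _) (norm_inner_le_norm _ _) 2

theorem isCompactOperator_rankOne (x y : H) : IsCompactOperator (rankOne ℂ x y) := by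
  have : rankOne ℂ x y = (ContinuousLinearMap.toSpanSingleton ℂ x) ∘L (innerSL ℂ y) := rfl
  rw [this]
  have hid : IsCompactOperator (id : ℂ → ℂ) :=
    (isCompactOperator_id_iff_finiteDimensional (𝕜 := ℂ)).2 inferInstance
  exact (hid.comp_clm (innerSL ℂ y)).clm_comp (ContinuousLinearMap.toSpanSingleton ℂ x)

/-- Hilbert–Schmidt operators are norm limits of their finite-rank truncations, hence compact. -/
theorem isCompactOperator_of_summable (b : HilbertBasis ι ℂ H) {A : H →L[ℂ] H}
    (hA : Summable fun i => ‖A (b i)‖ ^ 2) : IsCompactOperator A := by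
  classical
  let S : Finset ι → H →L[ℂ] H := fun s => ∑ i ∈ s, rankOne ℂ (A (b i)) (b i)
  have hSb : ∀ s i, (A - S s) (b i) = if i ∈ s then 0 else A (b i) := fun s i => by
    have : ∀ j, ⟪b j, b i⟫_ℂ = if j = i then 1 else 0 := fun j => by
      simpa using orthonormal_iff_ite.1 b.orthonormal j i
    simp only [S, sub_apply, _root_.sum_apply, rankOne_apply, this, ite_smul, one_smul, zero_smul,
      Finset.sum_ite_eq']
    split_ifs <;> simp
  have hn : ∀ s i, ‖(A - S s) (b i)‖ ^ 2 = {j | j ∉ s}.indicator (fun i => ‖A (b i)‖ ^ 2) i :=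
    fun s i => by
      rw [hSb]
      by_cases h : i ∈ s <;> simp [h]
  have hS : Tendsto S atTop (𝓝 A) := by
    rw [tendsto_iff_norm_sub_tendsto_zero]
    have h1 := tendsto_tsum_compl_atTop_zero fun i => ‖A (b i)‖ ^ 2
    have h2 : Tendsto (fun s => ‖S s - A‖ ^ 2) atTop (𝓝 0) := by
      refine squeeze_zero (fun s => by positivity) (fun s => ?_) h1
      rw [norm_sub_rev]
      refine (norm_apply_sq_le b ?_).trans_eq ?_
      · simp only [hn]
        exact hA.indicator _
      · simp only [hn]
        exact (tsum_subtype {j | j ∉ s} fun i => ‖A (b i)‖ ^ 2).symm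
    simpa using h2.sqrt
  refine isCompactOperator_of_tendsto hS (Eventually.of_forall fun s => ?_)
  exact (compactOperator (RingHom.id ℂ) H H).sum_mem fun i _ => isCompactOperator_rankOne _ _

/-- A positive trace-class operator is compact because its square root is Hilbert–Schmidt. -/
theorem isCompactOperator_of_nonneg {T : H →L[ℂ] H} (hT : 0 ≤ T) (hT' : T ∈ TraceClass H) :
    IsCompactOperator T := by
  obtain ⟨S, -, hSS, hsym⟩ := exists_selfAdjoint_sqrt hT
  have h : IsCompactOperator S := by
    refine isCompactOperator_of_summable (stdBasis H) ?_
    refine (Complex.hasSum_re (hasSum_trace_self hT' (stdBasis H))).summable.congr fun i => ?_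
    rw [hSS, ← hsym, inner_self_eq_norm_sq_to_K]
    norm_cast
  have : T = S ∘L S := by ext x; exact hSS x
  rw [this]
  exact h.comp_clm S

end TraceAPI
/-! ### Positivity of operator matrices -/

section OperatorMatrix

variable {H : Type u} [NormedAddCommGroup H] [InnerProductSpace ℂ H] [CompleteSpace H]

/-- Positivity in the C⋆-algebra of operator matrices implies positivity of the quadratic form on
`Hⁿ`. -/
theorem sum_inner_nonneg_of_ofMatrix_nonneg {n : ℕ} {T : Fin n → Fin n → H →L[ℂ] H}
    (h : 0 ≤ CStarMatrix.ofMatrix (Matrix.of fun i j => T i j)) (x : Fin n → H) :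
    0 ≤ ∑ i, ∑ j, ⟪x i, T i j (x j)⟫_ℂ := by
  suffices key : ∀ M : CStarMatrix (Fin n) (Fin n) (H →L[ℂ] H), 0 ≤ M →
      0 ≤ ∑ i, ∑ j, ⟪x i, M i j (x j)⟫_ℂ from key _ h
  intro M hM
  rw [StarOrderedRing.nonneg_iff] at hM
  induction hM using AddSubmonoid.closure_induction with
  | mem M hM =>
    obtain ⟨S, rfl⟩ := hM
    have hT : ∀ i j, (star S * S) i j = ∑ k, (S k i).adjoint ∘L S k j := fun i j => rfl
    have : ∑ i, ∑ j, ⟪x i, (star S * S) i j (x j)⟫_ℂ =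
        ∑ k, ⟪∑ i, S k i (x i), ∑ j, S k j (x j)⟫_ℂ := by
      simp only [hT, _root_.sum_apply, inner_sum, sum_inner, ContinuousLinearMap.comp_apply,
        ContinuousLinearMap.adjoint_inner_right]
      rw [Finset.sum_comm_cycle]
      exact Finset.sum_congr rfl fun k _ => Finset.sum_comm
    rw [this]
    refine Finset.sum_nonneg fun k _ => ?_
    rw [inner_self_eq_norm_sq_to_K]
    positivity
  | zero => simp
  | add M N _ _ hM hN =>
    simpa [inner_add_right, Finset.sum_add_distrib] using add_nonneg hM hN

/-- Conversely, if the quadratic form on `Hⁿ` is nonnegative, the operator matrix acts as a positive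
operator on `Hⁿ`, and the entries of the square root of that operator exhibit the matrix as
`star R * R`. -/
theorem ofMatrix_nonneg_of_sum_inner_nonneg {n : ℕ} {T : Fin n → Fin n → H →L[ℂ] H}
    (h : ∀ x : Fin n → H, 0 ≤ ∑ i, ∑ j, ⟪x i, T i j (x j)⟫_ℂ) :
    0 ≤ CStarMatrix.ofMatrix (Matrix.of fun i j => T i j) := by
  -- `ι i` and `π i` are the inclusion and the projection of the `i`-th summand of `Hⁿ`
  let E := PiLp 2 (fun _ : Fin n => H)
  let ι : Fin n → H →L[ℂ] E := fun i =>
    (PiLp.continuousLinearEquiv 2 ℂ (fun _ : Fin n => H)).symm.toContinuousLinearMap ∘L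
      ContinuousLinearMap.single ℂ (fun _ : Fin n => H) i
  let π : Fin n → E →L[ℂ] H := fun i => PiLp.proj 2 (fun _ : Fin n => H) i
  let C : E →L[ℂ] E := ∑ i, ∑ j, ι i ∘L T i j ∘L π j
  have hιa : ∀ i h k, ι i h k = if k = i then h else 0 := fun i h k => Pi.single_apply i h k
  have hι : ∀ (x : E) i h, ⟪x, ι i h⟫_ℂ = ⟪x i, h⟫_ℂ := fun x i h => by
    rw [PiLp.inner_apply]
    simp [hιa, apply_ite]
  have hCin : ∀ x y : E, ⟪x, C y⟫_ℂ = ∑ i, ∑ j, ⟪x i, T i j (y j)⟫_ℂ := fun x y => by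
    have hC : C y = ∑ i, ∑ j, ι i (T i j (y j)) := by
      simp only [C, _root_.sum_apply, ContinuousLinearMap.comp_apply]
      rfl
    rw [hC]
    exact (inner_sum _ _ _).trans (Finset.sum_congr rfl fun i _ =>
      (inner_sum _ _ _).trans (Finset.sum_congr rfl fun j _ => hι x i _))
  have hC : 0 ≤ C := nonneg_iff_forall_inner.2 fun x => by
    rw [hCin]
    exact h _
  obtain ⟨S, hS, hSS, hsym⟩ := exists_selfAdjoint_sqrt hC
  let R : CStarMatrix (Fin n) (Fin n) (H →L[ℂ] H) :=
    CStarMatrix.ofMatrix (Matrix.of fun i j => π i ∘L S ∘L ι j)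
  suffices hR : CStarMatrix.ofMatrix (Matrix.of fun i j => T i j) = star R * R by
    rw [hR]
    exact star_mul_self_nonneg R
  refine CStarMatrix.ext fun i j => ?_
  change T i j = ∑ k, (π k ∘L S ∘L ι i).adjoint ∘L (π k ∘L S ∘L ι j)
  ext x
  refine ext_inner_left ℂ fun y => ?_
  have h1 : ⟪y, T i j x⟫_ℂ = ⟪ι i y, C (ι j x)⟫_ℂ := by
    rw [hCin, Finset.sum_eq_single i, Finset.sum_eq_single j]
    · simp [hιa]
    · exact fun l _ hl => by simp [hιa, hl]
    · simp
    · exact fun k _ hk => by simp [hιa, hk]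
    · simp
  have h2 : ∀ u v : E, ⟪u, v⟫_ℂ = ∑ k, ⟪π k u, π k v⟫_ℂ := fun u v => PiLp.inner_apply u v
  rw [h1, hSS, ← hsym, h2]
  simp [inner_sum, ContinuousLinearMap.adjoint_inner_right, -ContinuousLinearMap.adjoint_comp]

end OperatorMatrix
/-! ### Joint eigenbases of commuting projections -/

section JointEigenbasis

variable {H : Type u} [NormedAddCommGroup H] [InnerProductSpace ℂ H]

/-- `v` is a joint eigenvector, with eigenvalues in `{0, 1}`, of all operators in `R`. The zero
vector is allowed. -/
def IsJointEigenvector (R : Set (H →L[ℂ] H)) (v : H) : Prop := ∀ Q ∈ R, Q v = v ∨ Q v = 0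

/-- A nonzero finite-dimensional subspace of minimal dimension, among those invariant under
commuting idempotents, consists of joint eigenvectors. -/
theorem exists_isJointEigenvector_of_finiteDimensional {R : Set (H →L[ℂ] H)}
    (hidem : ∀ Q ∈ R, ∀ x, Q (Q x) = Q x) (hcomm : ∀ Q ∈ R, ∀ P ∈ R, Commute Q P)
    (V : Submodule ℂ H) [FiniteDimensional ℂ V] (hV : V ≠ ⊥)
    (hinv : ∀ Q ∈ R, ∀ x ∈ V, Q x ∈ V) : ∃ v ∈ V, v ≠ 0 ∧ IsJointEigenvector R v := by
  induction hn : Module.finrank ℂ V using Nat.strong_induction_on generalizing V with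
  | _ n ih =>
    by_cases hall : ∀ Q ∈ R, (∀ x ∈ V, Q x = x) ∨ ∀ x ∈ V, Q x = 0
    · obtain ⟨v, hv, hv0⟩ := V.ne_bot_iff.1 hV
      exact ⟨v, hv, hv0, fun Q hQ => (hall Q hQ).imp (fun h => h v hv) fun h => h v hv⟩
    · push Not at hall
      obtain ⟨Q, hQ, ⟨x, hx, hQx⟩, y, hy, hQy⟩ := hall
      let W : Submodule ℂ H := V ⊓ LinearMap.ker ((Q - 1 : H →L[ℂ] H) : H →ₗ[ℂ] H)
      have hWmem : ∀ z, z ∈ W ↔ z ∈ V ∧ Q z = z := fun z => by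
        simp [W, sub_eq_zero]
      have hWV : W < V := lt_of_le_of_ne inf_le_left fun h => hQx ((hWmem x).1 (h ▸ hx)).2
      have : FiniteDimensional ℂ W := Submodule.finiteDimensional_of_le hWV.le
      obtain ⟨v, hv, hv0, hvR⟩ := ih _ (hn ▸ Submodule.finrank_lt_finrank_of_lt hWV) W
        ((Submodule.ne_bot_iff _).2 ⟨Q y, (hWmem _).2 ⟨hinv Q hQ y hy, hidem Q hQ y⟩, hQy⟩)
        (fun P hP z hz => by
          rw [hWmem] at hz ⊢
          refine ⟨hinv P hP z hz.1, ?_⟩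
          have h := DFunLike.congr_fun (hcomm Q hQ P hP) z
          simp only [mul_apply_eq_comp] at h
          rw [h, hz.2]) rfl
      exact ⟨v, hWV.le hv, hv0, hvR⟩

variable [CompleteSpace H]

/-- A nonzero positive compact operator commuting with `R` has an eigenvector, with positive
eigenvalue, which is a joint eigenvector of `R`. -/
theorem exists_isJointEigenvector_of_isCompactOperator {R : Set (H →L[ℂ] H)}
    (hidem : ∀ Q ∈ R, ∀ x, Q (Q x) = Q x) (hcomm : ∀ Q ∈ R, ∀ P ∈ R, Commute Q P)
    {S : H →L[ℂ] H} (hS : 0 ≤ S) (hSc : IsCompactOperator S) (hS0 : S ≠ 0)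
    (hRS : ∀ Q ∈ R, Commute Q S) :
    ∃ v : H, ‖v‖ = 1 ∧ IsJointEigenvector R v ∧ 0 < (⟪v, S v⟫_ℂ).re := by
  have hSp := (ContinuousLinearMap.nonneg_iff_isPositive S).1 hS
  have hne : ¬ ∀ μ, Module.End.HasEigenvalue (S : Module.End ℂ H) μ → μ = 0 := fun h =>
    hS0 ((ContinuousLinearMap.eq_zero_of_forall_hasEigenvalue_eq_zero hSc hSp.isSymmetric).1 h)
  push Not at hne
  obtain ⟨μ, hμ, hμ0⟩ := hne
  have := ContinuousLinearMap.finite_dimensional_eigenspace hSc μ hμ0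
  obtain ⟨v, hv, hv0, hvR⟩ := exists_isJointEigenvector_of_finiteDimensional hidem hcomm
    (Module.End.eigenspace (S : Module.End ℂ H) μ) hμ (fun Q hQ x hx => by
      rw [Module.End.mem_eigenspace_iff] at hx ⊢
      have h := DFunLike.congr_fun (hRS Q hQ) x
      simp only [mul_apply_eq_comp] at h
      change S x = _ at hx
      change S (Q x) = _
      rw [← h, hx, map_smul])
  rw [Module.End.mem_eigenspace_iff] at hv
  change S v = _ at hv
  have hnv : ‖v‖ ≠ 0 := norm_ne_zero_iff.2 hv0
  refine ⟨((‖v‖⁻¹ : ℝ) : ℂ) • v, ?_, fun Q hQ => ?_, ?_⟩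
  · rw [norm_smul, Complex.norm_real, norm_inv, norm_norm, inv_mul_cancel₀ hnv]
  · simp only [map_smul]
    exact (hvR Q hQ).imp (fun h => by rw [h]) fun h => by rw [h, smul_zero]
  · set w := ((‖v‖⁻¹ : ℝ) : ℂ) • v with hw
    have hw0 : w ≠ 0 := smul_ne_zero (by simpa using hv0) hv0
    have h0 := nonneg_iff_forall_inner.1 hS w
    refine lt_of_le_of_ne (Complex.nonneg_iff.1 h0).1 fun h => ?_
    have h1 : ⟪w, S w⟫_ℂ = 0 := Complex.ext h.symm (Complex.nonneg_iff.1 h0).2.symm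
    have h2 : S w = μ • w := by rw [hw, map_smul, hv, smul_comm]
    rw [h2, inner_smul_right] at h1
    exact (mul_ne_zero hμ0 (inner_self_ne_zero.2 hw0)) h1

/-- A Boolean algebra `R` of commuting projections such that for every unit vector `x` some nonzero
positive compact operator `S` commutes with `R` and satisfies `⟨v, S v⟩ ≤ ⟨x, Q x⟩` for all `Q ∈ R`
and all unit vectors `v` in the range of `Q`. -/
structure IsCompactlyModelled (R : Set (H →L[ℂ] H)) : Prop where
  proj : ∀ Q ∈ R, IsStarProjection Q
  comm : ∀ Q ∈ R, ∀ P ∈ R, Commute Q P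
  one_mem : 1 ∈ R
  compl_mem : ∀ Q ∈ R, 1 - Q ∈ R
  mul_mem : ∀ Q ∈ R, ∀ P ∈ R, Q * P ∈ R
  model : ∀ x : H, ‖x‖ = 1 → ∃ S : H →L[ℂ] H, 0 ≤ S ∧ IsCompactOperator S ∧ S ≠ 0 ∧
    (∀ Q ∈ R, Commute Q S) ∧
    ∀ Q ∈ R, ∀ v, ‖v‖ = 1 → Q v = v → (⟪v, S v⟫_ℂ).re ≤ (⟪x, Q x⟫_ℂ).re

variable {R : Set (H →L[ℂ] H)}

theorem IsCompactlyModelled.apply_apply (hR : IsCompactlyModelled R) {Q : H →L[ℂ] H} (hQ : Q ∈ R)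
    (x : H) : Q (Q x) = Q x :=
  DFunLike.congr_fun (hR.proj Q hQ).isIdempotentElem x

theorem IsCompactlyModelled.inner_apply (hR : IsCompactlyModelled R) {Q : H →L[ℂ] H} (hQ : Q ∈ R)
    (x y : H) : ⟪Q x, y⟫_ℂ = ⟪x, Q y⟫_ℂ := by
  rw [← ContinuousLinearMap.adjoint_inner_left, (hR.proj Q hQ).isSelfAdjoint.adjoint_eq]

/-- No unit vector `x` is orthogonal to all joint eigenvectors. Take a joint eigenvector `v` of `R`
with `⟨v, S v⟩ > 0`, where `S` is the operator belonging to `x`. The limit `y` of the decreasing net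
`Q x`, over all `Q ∈ R` fixing `v`, is a joint eigenvector with the same eigenvalues as `v`, and
`⟨x, y⟩ = lim ⟨x, Q x⟩ ≥ ⟨v, S v⟩`. -/
theorem IsCompactlyModelled.exists_inner_ne_zero (hR : IsCompactlyModelled R) {x : H}
    (hx : ‖x‖ = 1) : ∃ y, IsJointEigenvector R y ∧ ⟪x, y⟫_ℂ ≠ 0 := by
  obtain ⟨S, hS, hSc, hS0, hRS, hSx⟩ := hR.model x hx
  obtain ⟨v, hv1, hv, hpos⟩ := exists_isJointEigenvector_of_isCompactOperator
    (fun Q hQ => hR.apply_apply hQ) hR.comm hS hSc hS0 hRS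
  -- the kernels of the projections fixing `v`, directed by inclusion
  let ι := {V : Submodule ℂ H // ∃ Q ∈ R, Q v = v ∧ ∀ z, z ∈ V ↔ Q z = 0}
  let U : ι → Submodule ℂ H := Subtype.val
  have hU : Monotone U := fun _ _ h => h
  choose P hPR hPv hP using fun V : ι => V.2
  let mk : ∀ Q ∈ R, Q v = v → ι := fun Q hQ hQv =>
    ⟨LinearMap.ker (Q : H →ₗ[ℂ] H), Q, hQ, hQv, fun z => Iff.rfl⟩
  have hUproj : ∀ V : ι, (U V).HasOrthogonalProjection := fun V => by
    have hcl : IsClosed (U V : Set H) := by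
      have h : (U V : Set H) = P V ⁻¹' {0} := by
        ext z
        exact hP V z
      rw [h]
      exact isClosed_singleton.preimage (P V).continuous
    have : CompleteSpace (U V) := hcl.completeSpace_coe
    infer_instance
  have hUstar : ∀ (V : ι) z, (U V).starProjection z = z - P V z := fun V z => by
    refine Submodule.eq_starProjection_of_mem_of_inner_eq_zero ?_ fun w hw => ?_
    · refine (hP V _).2 ?_
      rw [map_sub, hR.apply_apply (hPR V), sub_self]
    · rw [sub_sub_cancel, hR.inner_apply (hPR V), (hP V w).1 hw, inner_zero_right]
  have : Nonempty ι := ⟨mk 1 hR.one_mem rfl⟩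
  have : IsDirectedOrder ι := ⟨fun V W => by
    refine ⟨mk (P V * P W) (hR.mul_mem _ (hPR V) _ (hPR W)) ?_, fun z hz => ?_, fun z hz => ?_⟩
    · rw [mul_apply_eq_comp, hPv, hPv]
    · have hz' := (hP V z).1 hz
      change P V (P W z) = 0
      have h := DFunLike.congr_fun (hR.comm _ (hPR V) _ (hPR W)) z
      simp only [mul_apply_eq_comp] at h
      rw [h, hz', map_zero]
    · have hz' := (hP W z).1 hz
      change P V (P W z) = 0
      rw [hz', map_zero]⟩
  have : CompleteSpace (⨆ i, U i).topologicalClosure :=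
    (Submodule.isClosed_topologicalClosure _).completeSpace_coe
  set L := (⨆ i, U i).topologicalClosure
  have hlim := Submodule.starProjection_tendsto_closure_iSup U hU x
  -- the limit of `P V x`, where `P V` is the projection with kernel `V`
  let y := x - L.starProjection x
  have hyL : y ∈ Lᗮ := Submodule.sub_starProjection_mem_orthogonal x
  have hy : ∀ Q ∈ R, Q v = v → Q y = y := fun Q hQ hQv => by
    have h1 : Q (y - Q y) = 0 := by rw [map_sub, hR.apply_apply hQ, sub_self]
    have h2 : y - Q y ∈ L := Submodule.le_topologicalClosure _ (le_iSup U (mk Q hQ hQv) h1)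
    have h3 : ⟪y - Q y, y - Q y⟫_ℂ = 0 := by
      rw [inner_sub_right, hyL _ h2, ← hR.inner_apply hQ, h1, inner_zero_left, sub_zero]
    exact (sub_eq_zero.1 (inner_self_eq_zero.1 h3)).symm
  refine ⟨y, fun Q hQ => ?_, fun h0 => ?_⟩
  · rcases hv Q hQ with h | h
    · exact Or.inl (hy Q hQ h)
    · refine Or.inr ?_
      have := hy (1 - Q) (hR.compl_mem Q hQ) (by simp [h])
      simpa using this
  · have hlim2 : Tendsto (fun V : ι => (⟪x, P V x⟫_ℂ).re) atTop (𝓝 (⟪x, y⟫_ℂ).re) := by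
      have h1 : ∀ V : ι, P V x = x - (U V).starProjection x := fun V => by rw [hUstar]; abel
      simp only [h1]
      exact (Complex.continuous_re.tendsto _).comp
        ((tendsto_const_nhds (x := x)).inner (tendsto_const_nhds.sub hlim))
    have hle := ge_of_tendsto' hlim2 fun V => hSx (P V) (hPR V) v hv1 (hPv V)
    rw [h0] at hle
    exact absurd hle (not_le.2 hpos)

theorem Orthonormal.countable_of_separable [TopologicalSpace.SeparableSpace H] {s : Set H}
    (hs : Orthonormal ℂ ((↑) : s → H)) : s.Countable := by
  -- distinct members of `s` are at distance `√2`
  have hdisj : s.PairwiseDisjoint fun v => Metric.ball v (1 / 2) := by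
    intro v hv w hw hvw
    refine Metric.ball_disjoint_ball ?_
    have h0 : ⟪v, w⟫_ℂ = 0 := hs.2 (i := ⟨v, hv⟩) (j := ⟨w, hw⟩) (by simpa using hvw)
    have h1 : ‖v - w‖ ^ 2 = 2 := by
      rw [norm_sub_sq (𝕜 := ℂ), h0, hs.1 ⟨v, hv⟩, hs.1 ⟨w, hw⟩]
      norm_num
    rw [dist_eq_norm]
    nlinarith [norm_nonneg (v - w)]
  exact hdisj.countable_of_isOpen (fun _ _ => Metric.isOpen_ball)
    fun v _ => ⟨v, Metric.mem_ball_self (by norm_num)⟩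

/-- A maximal orthonormal family of joint eigenvectors is complete: otherwise a joint eigenvector not
orthogonal to a given vector of the complement could be projected to the complement. -/
theorem IsCompactlyModelled.exists_orthonormal (hR : IsCompactlyModelled R) :
    ∃ s : Set H, Orthonormal ℂ ((↑) : s → H) ∧ (∀ v ∈ s, IsJointEigenvector R v) ∧
      (Submodule.span ℂ s)ᗮ = ⊥ := by
  obtain ⟨s, hs⟩ := zorn_subset
    {s : Set H | Orthonormal ℂ ((↑) : s → H) ∧ ∀ v ∈ s, IsJointEigenvector R v}
    (fun c hc hchain => ⟨⋃₀ c, ⟨orthonormal_sUnion_of_directed hchain.directedOn fun a ha => (hc ha).1,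
      fun v ⟨t, htc, hvt⟩ => (hc htc).2 v hvt⟩, fun t ht => Set.subset_sUnion_of_mem ht⟩)
  refine ⟨s, hs.prop.1, hs.prop.2, ?_⟩
  by_contra hne
  obtain ⟨x, hx, hx0⟩ := (Submodule.ne_bot_iff _).1 hne
  have : CompleteSpace (Submodule.span ℂ s)ᗮ :=
    (Submodule.isClosed_orthogonal _).completeSpace_coe
  set W := (Submodule.span ℂ s)ᗮ
  have hWmem : ∀ z, z ∈ W ↔ ∀ v ∈ s, ⟪v, z⟫_ℂ = 0 := fun z => by
    refine ⟨fun h v hv => h v (Submodule.subset_span hv), fun h => ?_⟩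
    rw [Submodule.mem_orthogonal]
    intro u hu
    induction hu using Submodule.span_induction with
    | mem v hv => exact h v hv
    | zero => simp
    | add a b _ _ ha hb => rw [inner_add_left, ha, hb, add_zero]
    | smul a b _ hb => rw [inner_smul_left, hb, mul_zero]
  obtain ⟨y, hyR, hy⟩ := hR.exists_inner_ne_zero (x := ((‖x‖⁻¹ : ℝ) : ℂ) • x) (by
    rw [norm_smul, Complex.norm_real, norm_inv, norm_norm,
      inv_mul_cancel₀ (norm_ne_zero_iff.2 hx0)])
  have hy' : ⟪x, y⟫_ℂ ≠ 0 := fun h => hy (by rw [inner_smul_left, h, mul_zero])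
  -- the projection to `W` commutes with `R`, so the component of `y` in `W` is a joint eigenvector
  let z := W.starProjection y
  have hzW : z ∈ W := Submodule.coe_mem _
  have hyz : y - z ∈ Wᗮ := Submodule.sub_starProjection_mem_orthogonal y
  have hxz : ⟪x, z⟫_ℂ = ⟪x, y⟫_ℂ := by
    have h := hyz x hx
    rw [inner_sub_right, sub_eq_zero] at h
    exact h.symm
  have hz0 : z ≠ 0 := fun h => hy' (by rw [← hxz, h, inner_zero_right])
  have hQW : ∀ Q ∈ R, ∀ u ∈ W, Q u ∈ W := fun Q hQ u hu => by
    rw [hWmem] at hu ⊢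
    intro v hv
    rw [← hR.inner_apply hQ]
    rcases hs.prop.2 v hv Q hQ with h | h <;> rw [h]
    · exact hu v hv
    · exact inner_zero_left _
  have hQW' : ∀ Q ∈ R, ∀ u ∈ Wᗮ, Q u ∈ Wᗮ := fun Q hQ u hu w hw => by
    rw [← hR.inner_apply hQ]
    exact hu _ (hQW Q hQ w hw)
  have hQz : ∀ Q ∈ R, Q z = W.starProjection (Q y) := fun Q hQ => by
    refine (Submodule.eq_starProjection_of_mem_orthogonal (hQW Q hQ z hzW) ?_).symm
    rw [← map_sub]
    exact hQW' Q hQ _ hyz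
  have hzR : IsJointEigenvector R z := fun Q hQ => by
    rw [hQz Q hQ]
    rcases hyR Q hQ with h | h <;> rw [h]
    · exact Or.inl rfl
    · exact Or.inr (map_zero _)
  let e := ((‖z‖⁻¹ : ℝ) : ℂ) • z
  have he1 : ‖e‖ = 1 := by
    simp only [e]
    rw [norm_smul, Complex.norm_real, norm_inv, norm_norm,
      inv_mul_cancel₀ (norm_ne_zero_iff.2 hz0)]
  have heW : e ∈ W := W.smul_mem _ hzW
  have heR : IsJointEigenvector R e := fun Q hQ => by
    simp only [e, map_smul]
    exact (hzR Q hQ).imp (fun h => by rw [h]) fun h => by rw [h, smul_zero]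
  have hes : e ∉ s := fun h => by
    have h1 := (hWmem e).1 heW e h
    rw [inner_self_eq_zero] at h1
    simp [h1] at he1
  have hins : insert e s ∈
      {s : Set H | Orthonormal ℂ ((↑) : s → H) ∧ ∀ v ∈ s, IsJointEigenvector R v} := by
    refine ⟨?_, fun v hv => hv.elim (fun h => h ▸ heR) (hs.prop.2 v)⟩
    classical
    have h0 := hs.prop.1
    rw [orthonormal_subtype_iff_ite] at h0 ⊢
    intro v hv w hw
    rw [Set.mem_insert_iff] at hv hw
    rcases hv with rfl | hv <;> rcases hw with rfl | hw
    · simp [inner_self_eq_norm_sq_to_K, he1]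
    · rw [if_neg (fun h => hes (by rw [h]; exact hw)), inner_eq_zero_symm]
      exact (hWmem _).1 heW w hw
    · rw [if_neg (fun h => hes (by rw [← h]; exact hv))]
      exact (hWmem _).1 heW v hv
    · exact h0 v hv w hw
  exact hes (hs.le_of_ge hins (Set.subset_insert e s) (Set.mem_insert e s))

/-- A compactly modelled family of projections is diagonal in some countable orthonormal basis. -/
theorem IsCompactlyModelled.exists_hilbertBasis [TopologicalSpace.SeparableSpace H]
    (hR : IsCompactlyModelled R) : ∃ (ι : Type) (_ : Countable ι) (b : HilbertBasis ι ℂ H),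
      ∀ i, IsJointEigenvector R (b i) := by
  obtain ⟨s, hs, hsR, hbot⟩ := hR.exists_orthonormal
  have : Countable s := (Orthonormal.countable_of_separable hs).to_subtype
  -- reindex by a set of natural numbers, to have an index type in the lowest universe
  obtain ⟨f, hf⟩ := exists_injective_nat s
  let e : s ≃ Set.range f := Equiv.ofInjective f hf
  have hv : Orthonormal ℂ fun i : Set.range f => (e.symm i : H) := hs.comp _ e.symm.injective
  have hr : Set.range (fun i : Set.range f => (e.symm i : H)) = s := by
    rw [show (fun i : Set.range f => (e.symm i : H)) = (↑) ∘ e.symm from rfl,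
      e.symm.surjective.range_comp, Subtype.range_coe]
  refine ⟨Set.range f, inferInstance, HilbertBasis.mkOfOrthogonalEqBot hv (by rw [hr, hbot]), ?_⟩
  intro i
  rw [HilbertBasis.coe_mkOfOrthogonalEqBot]
  exact hsR _ (e.symm i).2

end JointEigenbasis
/-! ### Hilbert space tensor products and partial traces -/

section Tensor

open InnerProductSpace

variable {K : Type u} [NormedAddCommGroup K] [InnerProductSpace ℂ K]
variable {H : Type v} [NormedAddCommGroup H] [InnerProductSpace ℂ H]
variable {ι κ : Type*}

/-- The pure tensor `x ⊗ y` in the Hilbert space tensor product. -/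
def htmul (x : K) (y : H) : HTensor K H := ((x ⊗ₜ[ℂ] y : K ⊗[ℂ] H) : HTensor K H)

theorem tensorRight_apply (x : K) (y : H) : tensorRight y x = htmul x y := rfl

theorem tensorLeft_apply (x : K) (y : H) : tensorLeft x y = htmul x y := rfl

theorem inner_htmul (x x' : K) (y y' : H) :
    ⟪htmul x y, htmul x' y'⟫_ℂ = ⟪x, x'⟫_ℂ * ⟪y, y'⟫_ℂ := by
  rw [htmul, htmul, UniformSpace.Completion.inner_coe, TensorProduct.inner_tmul]

theorem tensorOp_htmul (A : K →L[ℂ] K) (B : H →L[ℂ] H) (x : K) (y : H) :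
    tensorOp A B (htmul x y) = htmul (A x) (B y) := by
  rw [tensorOp, htmul, ContinuousLinearMap.completion_apply_coe, TensorProduct.mapL_tmul]
  rfl

theorem clm_ext_htmul {E : Type*} [NormedAddCommGroup E] [NormedSpace ℂ E]
    {A B : HTensor K H →L[ℂ] E} (h : ∀ x y, A (htmul x y) = B (htmul x y)) : A = B := by
  ext ξ
  induction ξ using UniformSpace.Completion.induction_on with
  | hp => exact isClosed_eq A.continuous B.continuous
  | ih z =>
    induction z using TensorProduct.induction_on with
    | zero => rw [UniformSpace.Completion.coe_zero, map_zero, map_zero]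
    | tmul x y => exact h x y
    | add a b ha hb => rw [UniformSpace.Completion.coe_add, map_add, map_add, ha, hb]

theorem eq_zero_of_inner_htmul {ξ : HTensor K H} (h : ∀ x y, ⟪ξ, htmul x y⟫_ℂ = 0) : ξ = 0 := by
  have h1 : innerSL ℂ ξ = 0 := clm_ext_htmul fun x y => by simpa using h x y
  have h2 : ⟪ξ, ξ⟫_ℂ = 0 := by
    rw [← innerSL_apply_apply, h1]
    rfl
  exact inner_self_eq_zero.1 h2

theorem tensorOp_comp (A C : K →L[ℂ] K) (B D : H →L[ℂ] H) :
    tensorOp A B ∘L tensorOp C D = tensorOp (A ∘L C) (B ∘L D) :=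
  clm_ext_htmul fun x y => by simp [tensorOp_htmul]

theorem tensorOp_one_one : tensorOp (1 : K →L[ℂ] K) (1 : H →L[ℂ] H) = 1 :=
  clm_ext_htmul fun x y => by simp [tensorOp_htmul]

theorem htmul_sub_left (x x' : K) (y : H) : htmul (x - x') y = htmul x y - htmul x' y :=
  map_sub (tensorRight y) x x'

theorem htmul_sub_right (x : K) (y y' : H) : htmul x (y - y') = htmul x y - htmul x y' :=
  map_sub (tensorLeft x) y y'

theorem htmul_smul_left (a : ℂ) (x : K) (y : H) : htmul (a • x) y = a • htmul x y :=
  map_smul (tensorRight y) a x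

theorem htmul_smul_right (a : ℂ) (x : K) (y : H) : htmul x (a • y) = a • htmul x y :=
  map_smul (tensorLeft x) a y

theorem norm_htmul (x : K) (y : H) : ‖htmul x y‖ = ‖x‖ * ‖y‖ := by
  rw [htmul, UniformSpace.Completion.norm_coe, TensorProduct.norm_tmul]

theorem tensorOp_one_sub_left (A : K →L[ℂ] K) :
    tensorOp (1 - A) (1 : H →L[ℂ] H) = 1 - tensorOp A 1 :=
  clm_ext_htmul fun x y => by simp [tensorOp_htmul, htmul_sub_left]

theorem tensorOp_one_sub_right (B : H →L[ℂ] H) :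
    tensorOp (1 : K →L[ℂ] K) (1 - B) = 1 - tensorOp 1 B :=
  clm_ext_htmul fun x y => by simp [tensorOp_htmul, htmul_sub_right]

theorem tensorOp_rankOne (x y : K) (z w : H) :
    tensorOp (rankOne ℂ x y) (rankOne ℂ z w) = rankOne ℂ (htmul x z) (htmul y w) :=
  clm_ext_htmul fun a b => by
    simp [tensorOp_htmul, inner_htmul, htmul_smul_left, htmul_smul_right, smul_smul, mul_comm]

variable [CompleteSpace K] [CompleteSpace H]

theorem adjoint_tensorOp (A : K →L[ℂ] K) (B : H →L[ℂ] H) :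
    (tensorOp A B).adjoint = tensorOp A.adjoint B.adjoint := by
  refine clm_ext_htmul fun x y => ?_
  refine sub_eq_zero.1 (eq_zero_of_inner_htmul fun x' y' => ?_)
  rw [inner_sub_left, ContinuousLinearMap.adjoint_inner_left, tensorOp_htmul, tensorOp_htmul,
    inner_htmul, inner_htmul, ContinuousLinearMap.adjoint_inner_left,
    ContinuousLinearMap.adjoint_inner_left, sub_self]

theorem isStarProjection_tensorOp {A : K →L[ℂ] K} {B : H →L[ℂ] H} (hA : IsStarProjection A)
    (hB : IsStarProjection B) : IsStarProjection (tensorOp A B) where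
  isIdempotentElem := by
    refine (tensorOp_comp A A B B).trans ?_
    rw [show A ∘L A = A from hA.isIdempotentElem, show B ∘L B = B from hB.isIdempotentElem]
  isSelfAdjoint := by
    rw [ContinuousLinearMap.isSelfAdjoint_iff', adjoint_tensorOp, hA.isSelfAdjoint.adjoint_eq,
      hB.isSelfAdjoint.adjoint_eq]

theorem tensorOp_nonneg {A : K →L[ℂ] K} {B : H →L[ℂ] H} (hA : 0 ≤ A) (hB : 0 ≤ B) :
    0 ≤ tensorOp A B := by
  obtain ⟨S, hS, hSS, -⟩ := exists_selfAdjoint_sqrt hA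
  obtain ⟨T, hT, hTT, -⟩ := exists_selfAdjoint_sqrt hB
  have h : tensorOp A B = (tensorOp S T).adjoint ∘L tensorOp S T := by
    rw [adjoint_tensorOp, tensorOp_comp, hS, hT]
    congr 1
    · ext x; exact hSS x
    · ext x; exact hTT x
  rw [h, ContinuousLinearMap.nonneg_iff_isPositive]
  exact ContinuousLinearMap.isPositive_adjoint_comp_self _

theorem orthonormal_htmul {a : ι → K} {b : κ → H} (ha : Orthonormal ℂ a) (hb : Orthonormal ℂ b) :
    Orthonormal ℂ fun p : ι × κ => htmul (a p.1) (b p.2) := by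
  classical
  rw [orthonormal_iff_ite] at ha hb ⊢
  intro p q
  rw [inner_htmul, ha, hb]
  by_cases h1 : p.1 = q.1 <;> by_cases h2 : p.2 = q.2 <;> simp [h1, h2, Prod.ext_iff]

/-- The product basis `aᵢ ⊗ bⱼ` of the tensor product. -/
def prodBasis (a : HilbertBasis ι ℂ K) (b : HilbertBasis κ ℂ H) :
    HilbertBasis (ι × κ) ℂ (HTensor K H) :=
  HilbertBasis.mkOfOrthogonalEqBot (orthonormal_htmul a.orthonormal b.orthonormal) (by
    rw [Submodule.eq_bot_iff]
    intro ξ hξ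
    have h1 : ∀ i j, ⟪ξ, htmul (a i) (b j)⟫_ℂ = 0 := fun i j => by
      rw [inner_eq_zero_symm]
      exact hξ _ (Submodule.subset_span ⟨(i, j), rfl⟩)
    have h2 : ∀ j, innerSL ℂ ξ ∘L tensorRight (b j) = 0 := fun j =>
      clm_ext_basis a fun i => h1 i j
    have h3 : ∀ x, innerSL ℂ ξ ∘L tensorLeft x = 0 := fun x =>
      clm_ext_basis b fun j => DFunLike.congr_fun (h2 j) x
    exact eq_zero_of_inner_htmul fun x y => DFunLike.congr_fun (h3 x) y)

theorem prodBasis_apply (a : HilbertBasis ι ℂ K) (b : HilbertBasis κ ℂ H) (p : ι × κ) :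
    prodBasis a b p = htmul (a p.1) (b p.2) := by
  rw [prodBasis, HilbertBasis.coe_mkOfOrthogonalEqBot]

/-- The trace dominates the norm of a positive operator `T`, because `|x⟩⟨x| ≤ ‖x‖²` gives
`⟨x, T x⟩ ≤ ‖x‖² tr T`. -/
theorem norm_le_re_trace {T : H →L[ℂ] H} (hT : T ∈ TraceClass H) (hT0 : 0 ≤ T) :
    ‖T‖ ≤ (trace T).re := by
  have h0 : 0 ≤ trace T := trace_comp_nonneg hT hT0 (A := 1) zero_le_one
  rw [CStarAlgebra.norm_le_iff_le_algebraMap T (Complex.nonneg_iff.1 h0).1 hT0, ← sub_nonneg,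
    nonneg_iff_forall_inner]
  intro x
  have hre : (((trace T).re : ℝ) : ℂ) = trace T := Complex.ext rfl (Complex.nonneg_iff.1 h0).2
  have hx : rankOne ℂ x x ≤ (((‖x‖ ^ 2 : ℝ) : ℂ)) • (1 : H →L[ℂ] H) := by
    rw [← sub_nonneg, nonneg_iff_forall_inner]
    intro z
    have h1 : ⟪z, (((‖x‖ ^ 2 : ℝ) : ℂ) • (1 : H →L[ℂ] H) - rankOne ℂ x x) z⟫_ℂ =
        ((‖x‖ ^ 2 * ‖z‖ ^ 2 - ‖⟪x, z⟫_ℂ‖ ^ 2 : ℝ) : ℂ) := by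
      simp only [sub_apply, smul_apply, one_apply_eq_self, rankOne_apply, inner_sub_right,
        inner_smul_right, inner_self_eq_norm_sq_to_K]
      rw [← inner_conj_symm z x, Complex.mul_conj, Complex.normSq_eq_norm_sq]
      push_cast
      rfl
    rw [h1, Complex.zero_le_real, sub_nonneg, ← mul_pow]
    exact pow_le_pow_left₀ (norm_nonneg _) (norm_inner_le_norm x z) 2
  have h2 := trace_comp_mono hT hT0 hx
  rw [trace_comp_rankOne, trace_comp_smul, ContinuousLinearMap.one_def,
    ContinuousLinearMap.comp_id] at h2
  have h3 : ⟪x, (algebraMap ℝ (H →L[ℂ] H) (trace T).re) x⟫_ℂ = ((‖x‖ ^ 2 : ℝ) : ℂ) * trace T := by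
    rw [Algebra.algebraMap_eq_smul_one]
    change ⟪x, (trace T).re • x⟫_ℂ = _
    rw [← Complex.coe_smul, inner_smul_right, hre, inner_self_eq_norm_sq_to_K, mul_comm]
    push_cast
    rfl
  rw [sub_apply, inner_sub_right, h3]
  exact sub_nonneg.2 h2

variable {T : HTensor K H →L[ℂ] HTensor K H}

theorem inner_tensorRight_adjoint_comp (T : HTensor K H →L[ℂ] HTensor K H) (h : H) (x y : K) :
    ⟪x, ((tensorRight (K := K) h).adjoint ∘L T ∘L tensorRight h) y⟫_ℂ =
      ⟪htmul x h, T (htmul y h)⟫_ℂ := by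
  simp only [ContinuousLinearMap.comp_apply, ContinuousLinearMap.adjoint_inner_right,
    tensorRight_apply]

theorem inner_tensorLeft_adjoint_comp (T : HTensor K H →L[ℂ] HTensor K H) (k : K) (x y : H) :
    ⟪x, ((tensorLeft (H := H) k).adjoint ∘L T ∘L tensorLeft k) y⟫_ℂ =
      ⟪htmul k x, T (htmul k y)⟫_ℂ := by
  simp only [ContinuousLinearMap.comp_apply, ContinuousLinearMap.adjoint_inner_right,
    tensorLeft_apply]

theorem tensorRight_adjoint_comp_nonneg (hT0 : 0 ≤ T) (h : H) :
    0 ≤ (tensorRight (K := K) h).adjoint ∘L T ∘L tensorRight h := by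
  rw [nonneg_iff_forall_inner]
  intro x
  rw [inner_tensorRight_adjoint_comp]
  exact nonneg_iff_forall_inner.1 hT0 _

theorem tensorLeft_adjoint_comp_nonneg (hT0 : 0 ≤ T) (k : K) :
    0 ≤ (tensorLeft (H := H) k).adjoint ∘L T ∘L tensorLeft k := by
  rw [nonneg_iff_forall_inner]
  intro x
  rw [inner_tensorLeft_adjoint_comp]
  exact nonneg_iff_forall_inner.1 hT0 _

theorem tensorRight_adjoint_comp_mem (hT : T ∈ TraceClass (HTensor K H)) (hT0 : 0 ≤ T) (h : H) :
    (tensorRight (K := K) h).adjoint ∘L T ∘L tensorRight h ∈ TraceClass K :=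
  mem_traceClass_of_nonneg (tensorRight_adjoint_comp_nonneg hT0 h) (stdBasis K)
    (hasSum_trace hT (stdBasis K) (tensorRight h).adjoint (tensorRight h)).summable

theorem tensorLeft_adjoint_comp_mem (hT : T ∈ TraceClass (HTensor K H)) (hT0 : 0 ≤ T) (k : K) :
    (tensorLeft (H := H) k).adjoint ∘L T ∘L tensorLeft k ∈ TraceClass H :=
  mem_traceClass_of_nonneg (tensorLeft_adjoint_comp_nonneg hT0 k) (stdBasis H)
    (hasSum_trace hT (stdBasis H) (tensorLeft k).adjoint (tensorLeft k)).summable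

/-- The traces of the diagonal blocks of a positive trace-class operator `T` add up to that of
`T`. -/
theorem hasSum_trace_tensorRight (hT : T ∈ TraceClass (HTensor K H)) (hT0 : 0 ≤ T)
    (b : HilbertBasis κ ℂ H) :
    HasSum (fun i => trace ((tensorRight (K := K) (b i)).adjoint ∘L T ∘L tensorRight (b i)))
      (trace T) := by
  have h1 := (Equiv.prodComm κ _).hasSum_iff.2 (hasSum_trace_self hT (prodBasis (stdBasis K) b))
  refine HasSum.prod_fiberwise h1 fun i => ?_
  refine (hasSum_trace_self (tensorRight_adjoint_comp_mem hT hT0 (b i)) (stdBasis K)).congr_fun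
    fun j => ?_
  rw [inner_tensorRight_adjoint_comp]
  simp [prodBasis_apply]

theorem hasSum_trace_tensorLeft (hT : T ∈ TraceClass (HTensor K H)) (hT0 : 0 ≤ T)
    (a : HilbertBasis ι ℂ K) :
    HasSum (fun i => trace ((tensorLeft (H := H) (a i)).adjoint ∘L T ∘L tensorLeft (a i)))
      (trace T) := by
  refine HasSum.prod_fiberwise (hasSum_trace_self hT (prodBasis a (stdBasis H))) fun i => ?_
  refine (hasSum_trace_self (tensorLeft_adjoint_comp_mem hT hT0 (a i)) (stdBasis H)).congr_fun
    fun j => ?_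
  rw [inner_tensorLeft_adjoint_comp]
  simp [prodBasis_apply]

theorem summable_norm_of_hasSum_trace {f : ι → H →L[ℂ] H} (hf : ∀ i, f i ∈ TraceClass H)
    (hf0 : ∀ i, 0 ≤ f i) {t : ℂ} (h : HasSum (fun i => trace (f i)) t) : Summable f :=
  Summable.of_norm_bounded (Complex.hasSum_re h).summable fun i => norm_le_re_trace (hf i) (hf0 i)

/-- The series of the partial trace converges in norm, since the traces of its positive terms are
summable. -/
theorem hasSum_partialTrace₂ (hT : T ∈ TraceClass (HTensor K H)) (hT0 : 0 ≤ T) :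
    HasSum (fun i => (tensorRight (K := K) (stdBasis H i)).adjoint ∘L T ∘L
      tensorRight (stdBasis H i)) (partialTrace₂ T) :=
  (summable_norm_of_hasSum_trace (fun _ => tensorRight_adjoint_comp_mem hT hT0 _)
    (fun _ => tensorRight_adjoint_comp_nonneg hT0 _)
    (hasSum_trace_tensorRight hT hT0 (stdBasis H))).hasSum

theorem hasSum_partialTrace₁ (hT : T ∈ TraceClass (HTensor K H)) (hT0 : 0 ≤ T) :
    HasSum (fun i => (tensorLeft (H := H) (stdBasis K i)).adjoint ∘L T ∘L
      tensorLeft (stdBasis K i)) (partialTrace₁ T) :=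
  (summable_norm_of_hasSum_trace (fun _ => tensorLeft_adjoint_comp_mem hT hT0 _)
    (fun _ => tensorLeft_adjoint_comp_nonneg hT0 _)
    (hasSum_trace_tensorLeft hT hT0 (stdBasis K))).hasSum

theorem hasSum_inner_comp {f : ι → H →L[ℂ] H} {S : H →L[ℂ] H} (h : HasSum f S) (A : H →L[ℂ] H)
    (x y : H) : HasSum (fun i => ⟪x, A (f i y)⟫_ℂ) ⟪x, A (S y)⟫_ℂ := by
  have h1 := h.mapL (innerSL ℂ x ∘L A ∘L ContinuousLinearMap.apply ℂ H y)
  simpa using h1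

theorem hasSum_trace_comp_partialTrace₂ (hT : T ∈ TraceClass (HTensor K H)) (hT0 : 0 ≤ T)
    (a : HilbertBasis ι ℂ K) (A : K →L[ℂ] K) :
    HasSum (fun j => ⟪a j, A (partialTrace₂ T (a j))⟫_ℂ) (trace (T ∘L tensorOp A 1)) := by
  refine HasSum.prod_fiberwise
    (hasSum_trace_comp' hT (prodBasis a (stdBasis H)) (tensorOp A 1)) fun j => ?_
  refine (hasSum_inner_comp (hasSum_partialTrace₂ hT hT0) A (a j) (a j)).congr_fun fun i => ?_
  have h1 : (1 : H →L[ℂ] H).adjoint = 1 := star_one _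
  rw [← ContinuousLinearMap.adjoint_inner_left A, inner_tensorRight_adjoint_comp, prodBasis_apply,
    ← ContinuousLinearMap.adjoint_inner_left (tensorOp A 1), adjoint_tensorOp, tensorOp_htmul, h1]
  rfl

theorem hasSum_trace_comp_partialTrace₁ (hT : T ∈ TraceClass (HTensor K H)) (hT0 : 0 ≤ T)
    (b : HilbertBasis κ ℂ H) (B : H →L[ℂ] H) :
    HasSum (fun j => ⟪b j, B (partialTrace₁ T (b j))⟫_ℂ) (trace (T ∘L tensorOp 1 B)) := by
  refine HasSum.prod_fiberwise ((Equiv.prodComm κ _).hasSum_iff.2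
    (hasSum_trace_comp' hT (prodBasis (stdBasis K) b) (tensorOp 1 B))) fun j => ?_
  refine (hasSum_inner_comp (hasSum_partialTrace₁ hT hT0) B (b j) (b j)).congr_fun fun i => ?_
  have h1 : (1 : K →L[ℂ] K).adjoint = 1 := star_one _
  rw [← ContinuousLinearMap.adjoint_inner_left B, inner_tensorLeft_adjoint_comp, Function.comp_apply,
    prodBasis_apply, ← ContinuousLinearMap.adjoint_inner_left (tensorOp 1 B), adjoint_tensorOp,
    tensorOp_htmul, h1]
  rfl

/-- The partial trace is dual to `A ↦ A ⊗ 1`. -/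
theorem trace_comp_partialTrace₂ (hT : T ∈ TraceClass (HTensor K H)) (hT0 : 0 ≤ T)
    (A : K →L[ℂ] K) : trace (A ∘L partialTrace₂ T) = trace (T ∘L tensorOp A 1) :=
  (hasSum_trace_comp_partialTrace₂ hT hT0 (stdBasis K) A).tsum_eq

theorem trace_comp_partialTrace₁ (hT : T ∈ TraceClass (HTensor K H)) (hT0 : 0 ≤ T)
    (B : H →L[ℂ] H) : trace (B ∘L partialTrace₁ T) = trace (T ∘L tensorOp 1 B) :=
  (hasSum_trace_comp_partialTrace₁ hT hT0 (stdBasis H) B).tsum_eq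

theorem partialTrace₂_nonneg (hT : T ∈ TraceClass (HTensor K H)) (hT0 : 0 ≤ T) :
    0 ≤ partialTrace₂ T := by
  rw [nonneg_iff_forall_inner]
  intro x
  exact (hasSum_inner_comp (hasSum_partialTrace₂ hT hT0) 1 x x).nonneg fun i =>
    nonneg_iff_forall_inner.1 (tensorRight_adjoint_comp_nonneg hT0 _) x

theorem partialTrace₂_mem (hT : T ∈ TraceClass (HTensor K H)) (hT0 : 0 ≤ T) :
    partialTrace₂ T ∈ TraceClass K :=
  mem_traceClass_of_nonneg (partialTrace₂_nonneg hT hT0) (stdBasis K)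
    (hasSum_trace_comp_partialTrace₂ hT hT0 (stdBasis K) 1).summable

theorem trace_partialTrace₂ (hT : T ∈ TraceClass (HTensor K H)) (hT0 : 0 ≤ T) :
    trace (partialTrace₂ T) = trace T := by
  have h := trace_comp_partialTrace₂ hT hT0 1
  rw [tensorOp_one_one] at h
  exact h

end Tensor
/-! ### The pinching channel and the broadcasting channel of an orthonormal basis -/

section Pinching

open InnerProductSpace

variable {H : Type u} [NormedAddCommGroup H] [InnerProductSpace ℂ H] [CompleteSpace H]
variable {ι : Type*}

theorem basis_inner [DecidableEq ι] (b : HilbertBasis ι ℂ H) (i j : ι) :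
    ⟪b i, b j⟫_ℂ = if i = j then 1 else 0 :=
  orthonormal_iff_ite.1 b.orthonormal i j

theorem basis_inner_self (b : HilbertBasis ι ℂ H) (i : ι) : ⟪b i, b i⟫_ℂ = 1 := by
  classical
  rw [basis_inner, if_pos rfl]

theorem norm_basis (b : HilbertBasis ι ℂ H) (i : ι) : ‖b i‖ = 1 := b.orthonormal.1 i

theorem orthonormal_copy (b : HilbertBasis ι ℂ H) :
    Orthonormal ℂ fun i => htmul (b i) (b i) :=
  (orthonormal_htmul b.orthonormal b.orthonormal).comp (fun i : ι => (i, i))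
    fun _ _ h => (Prod.ext_iff.1 h).1

/-- The isometry `bᵢ ↦ bᵢ ⊗ bᵢ`. -/
def copyIsometry (b : HilbertBasis ι ℂ H) : H →L[ℂ] HTensor H H :=
  ((orthonormal_copy b).orthogonalFamily.linearIsometry.comp
    b.repr.toLinearIsometry).toContinuousLinearMap

theorem copyIsometry_apply (b : HilbertBasis ι ℂ H) (i : ι) :
    copyIsometry b (b i) = htmul (b i) (b i) := by
  classical
  change (orthonormal_copy b).orthogonalFamily.linearIsometry (b.repr (b i)) = _
  rw [HilbertBasis.repr_self, OrthogonalFamily.linearIsometry_apply_single]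
  simp

theorem eq_of_forall_inner_basis (b : HilbertBasis ι ℂ H) {x y : H}
    (h : ∀ i, ⟪b i, x⟫_ℂ = ⟪b i, y⟫_ℂ) : x = y := by
  refine b.repr.injective (lp.ext (funext fun i => ?_))
  rw [b.repr_apply_apply, b.repr_apply_apply, h]

/-- The pinching `A ↦ ∑ᵢ ⟨bᵢ, A bᵢ⟩ |bᵢ⟩⟨bᵢ|`, which keeps the diagonal of `A` only, written as a
compression of `A ⊗ 1`. -/
def pinch (b : HilbertBasis ι ℂ H) (A : H →L[ℂ] H) : H →L[ℂ] H :=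
  (copyIsometry b).adjoint ∘L tensorOp A 1 ∘L copyIsometry b

theorem pinch_apply_basis (b : HilbertBasis ι ℂ H) (A : H →L[ℂ] H) (i : ι) :
    pinch b A (b i) = ⟪b i, A (b i)⟫_ℂ • b i := by
  classical
  refine eq_of_forall_inner_basis b fun j => ?_
  simp only [pinch, ContinuousLinearMap.comp_apply, ContinuousLinearMap.adjoint_inner_right,
    copyIsometry_apply, tensorOp_htmul, inner_htmul, inner_smul_right, one_apply_eq_self,
    basis_inner]
  split_ifs with h
  · rw [h]
  · simp

theorem inner_basis_pinch (b : HilbertBasis ι ℂ H) (A : H →L[ℂ] H) (i : ι) (y : H) :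
    ⟪b i, pinch b A y⟫_ℂ = ⟪b i, A (b i)⟫_ℂ * ⟪b i, y⟫_ℂ := by
  classical
  have h : innerSL ℂ (b i) ∘L pinch b A = ⟪b i, A (b i)⟫_ℂ • innerSL ℂ (b i) :=
    clm_ext_basis b fun j => by
      simp only [ContinuousLinearMap.comp_apply, innerSL_apply_apply, pinch_apply_basis,
        inner_smul_right, smul_apply, basis_inner, smul_eq_mul]
      split_ifs with h
      · rw [h]
      · simp
  exact DFunLike.congr_fun h y

theorem hasSum_inner_pinch (b : HilbertBasis ι ℂ H) (A : H →L[ℂ] H) (x y : H) :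
    HasSum (fun k => ⟪⟪b k, x⟫_ℂ • b k, A (⟪b k, y⟫_ℂ • b k)⟫_ℂ) ⟪x, pinch b A y⟫_ℂ := by
  refine (b.hasSum_inner_mul_inner x (pinch b A y)).congr_fun fun k => ?_
  rw [inner_basis_pinch, map_smul, inner_smul_left, inner_smul_right, inner_conj_symm]
  ring

/-- The pinching as a linear map. -/
def pinchₗ (b : HilbertBasis ι ℂ H) : Module.End ℂ (H →L[ℂ] H) where
  toFun := pinch b
  map_add' A B := clm_ext_basis b fun i => by
    simp [pinch_apply_basis, add_smul]
  map_smul' a A := clm_ext_basis b fun i => by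
    simp [pinch_apply_basis, mul_smul]

theorem pinchₗ_apply (b : HilbertBasis ι ℂ H) (A : H →L[ℂ] H) : pinchₗ b A = pinch b A := rfl

theorem pinch_pinch (b : HilbertBasis ι ℂ H) (A : H →L[ℂ] H) :
    pinch b (pinch b A) = pinch b A :=
  clm_ext_basis b fun i => by
    simp [pinch_apply_basis, norm_basis]

/-- The pinching is completely positive, being a sum of compressions `A ↦ |bₖ⟩⟨bₖ| A |bₖ⟩⟨bₖ|`. -/
theorem sum_inner_pinch_nonneg (b : HilbertBasis ι ℂ H) {n : ℕ} {T : Fin n → Fin n → H →L[ℂ] H}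
    (h : 0 ≤ CStarMatrix.ofMatrix (Matrix.of fun i j => T i j)) (x : Fin n → H) :
    0 ≤ ∑ i, ∑ j, ⟪x i, pinch b (T i j) (x j)⟫_ℂ :=
  (hasSum_sum fun i _ => hasSum_sum fun j _ => hasSum_inner_pinch b (T i j) (x i) (x j)).nonneg
    fun k => sum_inner_nonneg_of_ofMatrix_nonneg h fun i => ⟪b k, x i⟫_ℂ • b k

theorem pinch_nonneg (b : HilbertBasis ι ℂ H) {T : H →L[ℂ] H} (hT : 0 ≤ T) : 0 ≤ pinch b T := by
  rw [nonneg_iff_forall_inner]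
  exact fun x => (hasSum_inner_pinch b T x x).nonneg fun k => nonneg_iff_forall_inner.1 hT _

theorem pinch_mem_traceClass (b : HilbertBasis ι ℂ H) {T : H →L[ℂ] H} (hT : T ∈ TraceClass H) :
    pinch b T ∈ TraceClass H := by
  induction hT using Submodule.span_induction with
  | mem T hT =>
    refine mem_traceClass_of_nonneg (pinch_nonneg b hT.1) b ?_
    refine (hasSum_trace_self (Submodule.subset_span hT) b).summable.congr fun i => ?_
    rw [pinch_apply_basis, inner_smul_right, basis_inner_self, mul_one]
  | zero =>
    rw [← pinchₗ_apply, map_zero]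
    exact zero_mem _
  | add S T _ _ hS hT =>
    rw [← pinchₗ_apply, map_add]
    exact add_mem hS hT
  | smul a T _ hT =>
    rw [← pinchₗ_apply, map_smul]
    exact Submodule.smul_mem _ a hT

theorem trace_pinch_comp (b : HilbertBasis ι ℂ H) {T : H →L[ℂ] H} (hT : T ∈ TraceClass H)
    (A : H →L[ℂ] H) : trace (pinch b T ∘L A) = trace (T ∘L pinch b A) := by
  refine (hasSum_trace_comp' (pinch_mem_traceClass b hT) b A).unique ?_
  refine (hasSum_trace_comp hT b (pinch b A)).congr_fun fun i => ?_
  simp only [pinch_apply_basis, map_smul, inner_smul_right, mul_comm]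

/-- The pinching as a completely positive map. -/
def pinchCP (b : HilbertBasis ι ℂ H) : (H →L[ℂ] H) →CP (H →L[ℂ] H) where
  toLinearMap := pinchₗ b
  map_cstarMatrix_nonneg' _ _ hM :=
    ofMatrix_nonneg_of_sum_inner_nonneg fun x => sum_inner_pinch_nonneg b hM x

/-- The pinching as a quantum channel. -/
def pinchChannel (b : HilbertBasis ι ℂ H) : QuantumChannel H H where
  toLinearMap := ((pinchₗ b).comp (TraceClass H).subtype).codRestrict (TraceClass H)
    fun T => pinch_mem_traceClass b T.2
  completelyPositive _ _ hT :=
    ofMatrix_nonneg_of_sum_inner_nonneg fun x => sum_inner_pinch_nonneg b hT x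
  tracePreserving T := by
    have h := trace_pinch_comp b T.2 1
    have h1 : pinch b 1 = 1 := clm_ext_basis b fun i => by
      simp [pinch_apply_basis, norm_basis]
    rw [h1] at h
    exact h

theorem pinchChannel_isHeisenbergDual (b : HilbertBasis ι ℂ H) :
    (pinchChannel b).IsHeisenbergDual (pinchₗ b) :=
  fun T A => trace_pinch_comp b T.2 A

section Conjugation

variable {K : Type v} [NormedAddCommGroup K] [InnerProductSpace ℂ K] [CompleteSpace K]

theorem conj_mem_traceClass (V : H →L[ℂ] K) {T : H →L[ℂ] H} (hT : T ∈ TraceClass H) :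
    V ∘L T ∘L V.adjoint ∈ TraceClass K := by
  induction hT using Submodule.span_induction with
  | mem T hT =>
    refine mem_traceClass_of_nonneg ?_ (stdBasis K)
      (hasSum_trace (Submodule.subset_span hT) (stdBasis K) V V.adjoint).summable
    rw [nonneg_iff_forall_inner]
    intro x
    rw [ContinuousLinearMap.comp_apply, ← ContinuousLinearMap.adjoint_inner_left]
    exact nonneg_iff_forall_inner.1 hT.1 _
  | zero => simp
  | add S T _ _ hS hT => simpa using add_mem hS hT
  | smul a T _ hT => simpa using Submodule.smul_mem _ a hT

theorem trace_conj_comp (V : H →L[ℂ] K) {T : H →L[ℂ] H} (hT : T ∈ TraceClass H) (A : K →L[ℂ] K) :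
    trace ((V ∘L T ∘L V.adjoint) ∘L A) = trace (T ∘L (V.adjoint ∘L A ∘L V)) :=
  (hasSum_trace hT (stdBasis K) V (V.adjoint ∘L A)).tsum_eq

end Conjugation

/-- The channel `T ↦ ∑ᵢ ⟨bᵢ, T bᵢ⟩ |bᵢ ⊗ bᵢ⟩⟨bᵢ ⊗ bᵢ|`, which broadcasts the operators that are
diagonal in `b`. -/
def copyChannel (b : HilbertBasis ι ℂ H) : QuantumChannel H (HTensor H H) where
  toFun T := ⟨copyIsometry b ∘L pinch b T.1 ∘L (copyIsometry b).adjoint,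
    conj_mem_traceClass _ (pinch_mem_traceClass b T.2)⟩
  map_add' S T := Subtype.ext (by
    have h : pinch b (S.1 + T.1) = pinch b S.1 + pinch b T.1 := map_add (pinchₗ b) _ _
    simp [h])
  map_smul' a T := Subtype.ext (by
    have h : pinch b (a • T.1) = a • pinch b T.1 := map_smul (pinchₗ b) _ _
    simp [h])
  completelyPositive _ T hT := ofMatrix_nonneg_of_sum_inner_nonneg fun x => by
    have h := sum_inner_pinch_nonneg b hT fun i => (copyIsometry b).adjoint (x i)
    simp only [ContinuousLinearMap.adjoint_inner_left] at h
    exact h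
  tracePreserving T := by
    have h := trace_conj_comp (copyIsometry b) (pinch_mem_traceClass b T.2) 1
    rw [trace_pinch_comp b T.2] at h
    have h1 : pinch b ((copyIsometry b).adjoint ∘L (1 : HTensor H H →L[ℂ] HTensor H H) ∘L
        copyIsometry b) = 1 := clm_ext_basis b fun i => by
      simp [pinch_apply_basis, ContinuousLinearMap.adjoint_inner_right, copyIsometry_apply,
        norm_htmul, norm_basis]
    rw [h1] at h
    exact h

/-- The Heisenberg dual of the broadcasting channel. -/
def copyDual (b : HilbertBasis ι ℂ H) : (HTensor H H →L[ℂ] HTensor H H) →ₗ[ℂ] (H →L[ℂ] H) where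
  toFun B := pinch b ((copyIsometry b).adjoint ∘L B ∘L copyIsometry b)
  map_add' A B := by
    rw [← pinchₗ_apply, ← pinchₗ_apply, ← pinchₗ_apply, ← map_add]
    simp
  map_smul' a B := by
    rw [← pinchₗ_apply, ← pinchₗ_apply, RingHom.id_apply, ← map_smul]
    simp

theorem copyChannel_isHeisenbergDual (b : HilbertBasis ι ℂ H) :
    (copyChannel b).IsHeisenbergDual (copyDual b) := fun T A =>
  (trace_conj_comp (copyIsometry b) (pinch_mem_traceClass b T.2) A).trans
    (trace_pinch_comp b T.2 _)

theorem copyDual_tensorOp_apply (b : HilbertBasis ι ℂ H) (A B : H →L[ℂ] H) (i : ι) :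
    copyDual b (tensorOp A B) (b i) = (⟪b i, A (b i)⟫_ℂ * ⟪b i, B (b i)⟫_ℂ) • b i := by
  change pinch b _ (b i) = _
  rw [pinch_apply_basis]
  simp only [ContinuousLinearMap.comp_apply, ContinuousLinearMap.adjoint_inner_right,
    copyIsometry_apply, tensorOp_htmul, inner_htmul]

end Pinching
/-! ### Measurements that are diagonal in an orthonormal basis -/

section Diagonal

open InnerProductSpace

variable {H : Type u} [NormedAddCommGroup H] [InnerProductSpace ℂ H] [CompleteSpace H]

section Basis

variable {ι : Type*}

theorem apply_basis_eq_smul {R : Set (H →L[ℂ] H)} {b : HilbertBasis ι ℂ H}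
    (hb : ∀ i, IsJointEigenvector R (b i)) {E : H →L[ℂ] H} (hE : E ∈ R) (i : ι) :
    E (b i) = ⟪b i, E (b i)⟫_ℂ • b i := by
  rcases hb i E hE with h | h <;> simp [h, norm_basis]

/-- Operators that are diagonal in `b` are fixed by the pinching. -/
theorem pinch_eq_self {R : Set (H →L[ℂ] H)} {b : HilbertBasis ι ℂ H}
    (hb : ∀ i, IsJointEigenvector R (b i)) {E : H →L[ℂ] H} (hE : E ∈ R) : pinch b E = E :=
  clm_ext_basis b fun i => by rw [pinch_apply_basis, ← apply_basis_eq_smul hb hE]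

/-- The projection onto the closed span of the basis vectors with index in `X`. -/
def basisProj (b : HilbertBasis ι ℂ H) (X : Set ι) : H →L[ℂ] H :=
  have : CompleteSpace (Submodule.span ℂ (b '' X)).topologicalClosure :=
    (Submodule.isClosed_topologicalClosure _).completeSpace_coe
  (Submodule.span ℂ (b '' X)).topologicalClosure.starProjection

theorem basisProj_apply (b : HilbertBasis ι ℂ H) (X : Set ι) [DecidablePred (· ∈ X)] (i : ι) :
    basisProj b X (b i) = if i ∈ X then b i else 0 := by
  classical
  have : CompleteSpace (Submodule.span ℂ (b '' X)).topologicalClosure :=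
    (Submodule.isClosed_topologicalClosure _).completeSpace_coe
  split_ifs with h
  · exact Submodule.starProjection_eq_self_iff.2
      (Submodule.le_topologicalClosure _ (Submodule.subset_span ⟨i, h, rfl⟩))
  · refine Submodule.eq_starProjection_of_mem_orthogonal (zero_mem _) ?_
    rw [sub_zero, Submodule.orthogonal_closure, Submodule.mem_orthogonal]
    intro u hu
    induction hu using Submodule.span_induction with
    | mem v hv =>
      obtain ⟨j, hj, rfl⟩ := hv
      rw [basis_inner, if_neg fun hji => h (by rwa [← hji])]
    | zero => simp
    | add x y _ _ hx hy => rw [inner_add_left, hx, hy, add_zero]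
    | smul a x _ hx => rw [inner_smul_left, hx, mul_zero]

end Basis

variable {ι : Type}

/-- The outcome distribution of the sharp measurement of `b` has the weights `⟨bᵢ, ρ bᵢ⟩`. -/
theorem exists_measure_basisProj [Countable ι] [MeasurableSpace ι] [DiscreteMeasurableSpace ι]
    (b : HilbertBasis ι ℂ H) (ρ : State H) : ∃ μ : Measure ι, IsProbabilityMeasure μ ∧
      ∀ X, MeasurableSet X → trace (ρ.op ∘L basisProj b X) = (μ.real X : ℂ) := by
  classical
  let p : ι → ℝ := fun i => (⟪b i, ρ.op (b i)⟫_ℂ).re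
  have hp0 : ∀ i, 0 ≤ p i := fun i => (Complex.nonneg_iff.1 (ρ.inner_nonneg (b i))).1
  have hpc : ∀ i, ((p i : ℝ) : ℂ) = ⟪b i, ρ.op (b i)⟫_ℂ := fun i =>
    Complex.ext rfl (Complex.nonneg_iff.1 (ρ.inner_nonneg (b i))).2
  have hp1 : HasSum p 1 := by
    have h := Complex.hasSum_re (hasSum_trace_self ρ.mem b)
    rwa [ρ.trace_eq] at h
  let μ : Measure ι := Measure.sum fun i => ENNReal.ofReal (p i) • Measure.dirac i
  have hμ : ∀ X : Set ι, μ X = ENNReal.ofReal (∑' i, X.indicator p i) := fun X => by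
    rw [Measure.sum_apply _ (Set.Countable.measurableSet (Set.to_countable X)),
      ENNReal.ofReal_tsum_of_nonneg (fun i => Set.indicator_nonneg (fun i _ => hp0 i) i)
        (hp1.summable.indicator X)]
    refine tsum_congr fun i => ?_
    rw [Measure.smul_apply, Measure.dirac_apply, smul_eq_mul]
    by_cases h : i ∈ X <;> simp [h]
  refine ⟨μ, ⟨?_⟩, fun X _ => ?_⟩
  · rw [hμ, Set.indicator_univ, hp1.tsum_eq, ENNReal.ofReal_one]
  · rw [Measure.real, hμ, ENNReal.toReal_ofReal
      (tsum_nonneg fun i => Set.indicator_nonneg (fun i _ => hp0 i) i), Complex.ofReal_tsum]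
    refine (hasSum_trace_comp ρ.mem b (basisProj b X)).tsum_eq.symm.trans (tsum_congr fun i => ?_)
    rw [basisProj_apply]
    by_cases h : i ∈ X <;> simp [h, hpc]

variable {𝓜 : Set (POVM.{u, w} H)} {b : HilbertBasis ι ℂ H}

/-- The sharp measurement of the basis, as a POVM on the countable index set. -/
def basisPOVM [Countable ι] (b : HilbertBasis ι ℂ H) : POVM.{u, 0} H :=
  letI : MeasurableSpace ι := ⊤
  haveI : DiscreteMeasurableSpace ι := ⟨fun _ => trivial⟩
  { Ω := ι
    eff := basisProj b
    born := exists_measure_basisProj b }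

theorem POVM.distribution_prob (M : POVM.{u, w} H) (ρ : State H) :
    IsProbabilityMeasure (M.distribution ρ) := (M.born ρ).choose_spec.1

theorem POVM.trace_eff (M : POVM.{u, w} H) (ρ : State H) {X : Set M.Ω} (hX : MeasurableSet X) :
    trace (ρ.op ∘L M.eff X) = ((M.distribution ρ).real X : ℂ) := (M.born ρ).choose_spec.2 X hX

/-- The pure state of a basis vector. -/
def basisState (b : HilbertBasis ι ℂ H) (i : ι) : State H := .pure (b i) (norm_basis b i)

/-- Measure the basis, and prepare the basis vector that was found. -/
theorem isContextualityNonConfirming_of_diagonal [Countable ι]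
    (hb : ∀ i, IsJointEigenvector (effects 𝓜) (b i)) : IsContextualityNonConfirming 𝓜 := by
  classical
  refine ⟨basisPOVM b, basisState b, fun A => fun _ _ => trivial, fun M hM ρ X hX => ?_⟩
  let _ : MeasurableSpace ι := ⊤
  have : DiscreteMeasurableSpace ι := ⟨fun _ => trivial⟩
  have hE : M.eff X ∈ effects 𝓜 := ⟨M, hM, X, hX, rfl⟩
  set μ : Measure ι := (basisPOVM b).distribution ρ with hμ
  have : IsProbabilityMeasure μ := (basisPOVM b).distribution_prob ρ
  have hμr : ∀ i : ι, ((μ.real {i} : ℝ) : ℂ) = ⟪b i, ρ.op (b i)⟫_ℂ := fun i => by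
    refine ((basisPOVM b).trace_eff ρ (X := ({i} : Set ι)) trivial).symm.trans ?_
    have h := hasSum_trace_comp ρ.mem b (basisProj b {i})
    refine h.unique ?_
    convert hasSum_ite_eq i ⟪b i, ρ.op (b i)⟫_ℂ using 2 with j
    rw [basisProj_apply]
    by_cases hj : j = i <;> simp [hj]
  change _ = ∫ l : ι, trace (M.eff X ∘L rankOne ℂ (b l) (b l)) ∂μ
  simp only [trace_comp_rankOne]
  have hint : Integrable (fun l : ι => ⟪b l, M.eff X (b l)⟫_ℂ) μ := by
    refine Integrable.of_bound (C := 1) Measurable.of_discrete.aestronglyMeasurable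
      (Eventually.of_forall fun l => ?_)
    rcases hb l _ hE with h | h <;> simp [h, norm_basis]
  rw [integral_countable hint]
  refine (hasSum_trace_comp ρ.mem b (M.eff X)).tsum_eq.symm.trans (tsum_congr fun i => ?_)
  rw [apply_basis_eq_smul hb hE i, map_smul, inner_smul_right, inner_smul_right,
    basis_inner_self, mul_one, Complex.real_smul, hμr, mul_comm]

/-- The Cesàro means of an idempotent `Φ` converge to `Φ`, since `Φᵏ = Φ` for all `k ≥ 1`. -/
theorem tendsto_cesaro_of_idempotent {H : Type u} [NormedAddCommGroup H] [InnerProductSpace ℂ H]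
    [CompleteSpace H] {Φ : Module.End ℂ (H →L[ℂ] H)} (hΦ : ∀ A, Φ (Φ A) = Φ A) (A : H →L[ℂ] H)
    (T : TraceClass H) : Tendsto (fun n => trace ((T : H →L[ℂ] H) ∘L cesaro Φ n A)) atTop
      (𝓝 (trace ((T : H →L[ℂ] H) ∘L Φ A))) := by
  have hpow : ∀ k, (Φ ^ (k + 1)) A = Φ A := fun k => by
    induction k with
    | zero => simp
    | succ k ih => rw [pow_succ', Module.End.mul_apply, ih, hΦ]
  have hces : ∀ n : ℕ, cesaro Φ (n + 1) A = Φ A + ((n : ℂ) + 1)⁻¹ • (A - Φ A) := fun n => by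
    have hn : (n : ℂ) + 1 ≠ 0 := Nat.cast_add_one_ne_zero n
    rw [cesaro, Finset.sum_range_succ', LinearMap.smul_apply, LinearMap.add_apply,
      LinearMap.sum_apply]
    simp only [hpow, Finset.sum_const, Finset.card_range, pow_zero, Module.End.one_apply]
    rw [← Nat.cast_smul_eq_nsmul ℂ]
    match_scalars <;> field_simp
    simp
  rw [← tendsto_add_atTop_iff_nat 1]
  simp only [hces, trace_comp_add T.2, trace_comp_smul]
  have h : Tendsto (fun n : ℕ => ((n : ℂ) + 1)⁻¹) atTop (𝓝 0) := by
    simpa using tendsto_one_div_add_atTop_nhds_zero_nat (𝕜 := ℂ)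
  simpa using tendsto_const_nhds.add (h.mul_const (trace ((T : H →L[ℂ] H) ∘L (A - Φ A))))

/-- The zero map as a completely positive map. -/
def zeroCP : (H →L[ℂ] H) →CP (H →L[ℂ] H) where
  toLinearMap := 0
  map_cstarMatrix_nonneg' _ _ _ := ofMatrix_nonneg_of_sum_inner_nonneg fun x =>
    Finset.sum_nonneg fun i _ => Finset.sum_nonneg fun _ _ => (inner_zero_right (x i)).ge

theorem sum_rankOne_basis_le_one (b : HilbertBasis ι ℂ H) (s : Finset ι) :
    ∑ i ∈ s, rankOne ℂ (b i) (b i) ≤ 1 := by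
  rw [← sub_nonneg, nonneg_iff_forall_inner]
  intro x
  have h := sum_le_hasSum s (fun i _ => by positivity) (hasSum_norm_inner_sq b x)
  have h1 : ⟪x, ((1 : H →L[ℂ] H) - ∑ i ∈ s, rankOne ℂ (b i) (b i)) x⟫_ℂ =
      ((‖x‖ ^ 2 - ∑ i ∈ s, ‖⟪b i, x⟫_ℂ‖ ^ 2 : ℝ) : ℂ) := by
    simp only [sub_apply, _root_.sum_apply, rankOne_apply, inner_sub_right, inner_sum,
      inner_smul_right, one_apply_eq_self, Complex.ofReal_sub, Complex.ofReal_sum]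
    congr 1
    · simp
    · refine Finset.sum_congr rfl fun i _ => ?_
      rw [← inner_conj_symm x, Complex.mul_conj, Complex.normSq_eq_norm_sq]
  rw [h1]
  exact_mod_cast sub_nonneg.2 h

theorem POVM.isSubPOVM (M : POVM.{u, w} H) : IsSubPOVM M.eff := fun ρ =>
  have := M.distribution_prob ρ
  ⟨M.distribution ρ, prob_le_one, fun _ hX => M.trace_eff ρ hX⟩

theorem isSubPOVM_zero {Ω : Type w} [MeasurableSpace Ω] :
    IsSubPOVM fun _ : Set Ω => (0 : H →L[ℂ] H) :=
  fun _ => ⟨0, by simp, fun X _ => by simp [trace]⟩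

/-- The pinching is normal because it is its own predual. -/
theorem continuous_ultraweak_pinch (b : HilbertBasis ι ℂ H) :
    @Continuous _ _ (ultraweakTopology H) (ultraweakTopology H) (pinchCP b) := by
  let t : TopologicalSpace (H →L[ℂ] H) := ultraweakTopology H
  refine (@continuous_induced_rng _ _ _ _ _ _ t).2
    (@continuous_pi _ _ _ t _ _ fun T => ?_)
  have h : (fun A : H →L[ℂ] H => trace (T.1 ∘L pinchCP b A)) =
      fun A => trace (pinch b T.1 ∘L A) := funext fun A => (trace_pinch_comp b T.2 A).symm
  have hc : @Continuous _ _ t _ fun A : H →L[ℂ] H => trace (pinch b T.1 ∘L A) :=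
    @Continuous.comp _ _ _ t _ _ _ _
      (continuous_apply (⟨pinch b T.1, pinch_mem_traceClass b T.2⟩ : TraceClass H))
      (@continuous_induced_dom _ _ _ _)
  exact h.symm ▸ hc

/-- For measurements that are diagonal in `b`, the marginal of the copying channel is the pinching,
which is an idempotent and normal. So `ψ₀ = ψₙ` is the pinching, the singular part is zero, and the
post-processing kernels are the outcome distributions in the basis states. -/
theorem hasNormalSingularDecomposition_of_diagonal [Countable ι]
    (hb : ∀ i, IsJointEigenvector (effects 𝓜) (b i)) : HasNormalSingularDecomposition 𝓜 := by
  refine ⟨copyChannel b, copyDual b, pinchₗ b, pinchCP b, pinchCP b, zeroCP,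
    copyChannel_isHeisenbergDual b, fun A B => ?_, fun A => ?_, ⟨?_, ?_, ?_, ?_⟩,
    ⟨?_, ?_, ?_, ?_, ?_, ?_, ?_⟩, ι,
    fun i => rankOne ℂ (b i) (b i), inferInstance, ⟨?_, ?_, basisState b, ?_, ?_⟩, fun M hM => ?_⟩
  · exact clm_ext_basis b fun i => by simp only [copyDual_tensorOp_apply, mul_comm]
  · refine clm_ext_basis b fun i => ?_
    rw [copyDual_tensorOp_apply, pinchₗ_apply, pinch_apply_basis, one_apply_eq_self,
      basis_inner_self, mul_one]
  · exact pinch_pinch b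
  · exact pinch_pinch b
  · ext A
    exact ⟨fun ⟨B, hB⟩ => hB ▸ pinch_pinch b B, fun h => ⟨A, h⟩⟩
  · exact ⟨atTop, inferInstance, le_rfl, tendsto_cesaro_of_idempotent (pinch_pinch b)⟩
  · exact fun A => (add_zero _).symm
  · exact pinch_pinch b
  · exact fun A => rfl
  · exact fun A => map_zero (pinchₗ b)
  · exact fun A => rfl
  · exact continuous_ultraweak_pinch b
  · exact fun A _ => rfl
  · exact fun i => rankOne_self_nonneg _
  · exact sum_rankOne_basis_le_one b
  · intro i
    refine (trace_comp_rankOne _ _ _).trans ?_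
    simp [basisState, State.pure_op, norm_basis]
  · classical
    intro i j hij
    refine (trace_comp_rankOne _ _ _).trans ?_
    simp [basisState, State.pure_op, basis_inner, hij]
  · refine ⟨M.eff, fun _ => 0, M.isSubPOVM, isSubPOVM_zero, fun X hX => ?_,
      fun i => M.distribution (basisState b i), fun i => M.distribution_prob _,
      fun X hX ρ => ?_⟩
    · have h := pinch_eq_self hb ⟨M, hM, X, hX, rfl⟩
      exact ⟨(add_zero _).symm, h, map_zero _, ⟨_, h⟩, ⟨0, rfl⟩⟩
    · refine (hasSum_trace_comp ρ.mem b (M.eff X)).congr_fun fun i => ?_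
      rw [← M.trace_eff _ hX, trace_comp_rankOne, apply_basis_eq_smul hb
        ⟨M, hM, X, hX, rfl⟩ i, map_smul, inner_smul_right, basisState, State.pure_op,
        trace_rankOne_comp]

theorem exists_eq_smul_unit (x : H) : ∃ (c : ℂ) (y : H), (c = 0 ∨ ‖y‖ = 1) ∧ x = c • y := by
  by_cases hx : x = 0
  · exact ⟨0, 0, .inl rfl, by simp [hx]⟩
  · have hn : (‖x‖ : ℂ) ≠ 0 := by exact_mod_cast norm_ne_zero_iff.2 hx
    refine ⟨‖x‖, (‖x‖ : ℂ)⁻¹ • x, .inr ?_, by rw [smul_smul, mul_inv_cancel₀ hn, one_smul]⟩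
    rw [norm_smul, norm_inv, Complex.norm_real, norm_norm, inv_mul_cancel₀]
    exact norm_ne_zero_iff.2 hx

variable {K : Type v} [NormedAddCommGroup K] [InnerProductSpace ℂ K] [CompleteSpace K]

theorem QuantumChannel.sum_inner_nonneg (Λ : QuantumChannel H K) {n : ℕ}
    {T : Fin n → Fin n → TraceClass H}
    (h : ∀ x : Fin n → H, 0 ≤ ∑ i, ∑ j, ⟪x i, (T i j : H →L[ℂ] H) (x j)⟫_ℂ) (y : Fin n → K) :
    0 ≤ ∑ i, ∑ j, ⟪y i, (Λ.toLinearMap (T i j) : K →L[ℂ] K) (y j)⟫_ℂ :=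
  sum_inner_nonneg_of_ofMatrix_nonneg
    (Λ.completelyPositive n T (ofMatrix_nonneg_of_sum_inner_nonneg h)) y

theorem QuantumChannel.map_nonneg (Λ : QuantumChannel H K) {T : TraceClass H}
    (hT : 0 ≤ (T : H →L[ℂ] H)) : 0 ≤ (Λ.toLinearMap T : K →L[ℂ] K) := by
  rw [nonneg_iff_forall_inner]
  intro y
  have h := Λ.sum_inner_nonneg (n := 1) (T := fun _ _ => T)
    (fun x => by simpa using nonneg_iff_forall_inner.1 hT (x 0)) fun _ => y
  simpa using h

/-- The channel of the decomposition broadcasts: its marginal fixes both parts of every effect, and by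
symmetry the other marginal is the same. -/
theorem HasNormalSingularDecomposition.isBroadcastable (h : HasNormalSingularDecomposition 𝓜) :
    IsBroadcastable 𝓜 := by
  obtain ⟨Φ, Φs, Φ₀, _, _, _, hdual, hsymm, hΦ₀, _, _, ι, G, _, _, hM⟩ := h
  refine ⟨Φ, fun ρ M hM' X hX => ?_⟩
  obtain ⟨Mn, Ms, -, -, hdec, -⟩ := hM M hM'
  obtain ⟨hsum, hn, hs, -, -⟩ := hdec X hX
  have hfix : Φs (tensorOp (M.eff X) 1) = M.eff X := by rw [← hΦ₀, hsum, map_add, hn, hs]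
  have hT0 := Φ.map_nonneg (T := ρ.toTraceClass) ρ.nonneg
  have hT := (Φ.toLinearMap ρ.toTraceClass).2
  have hρ : trace (ρ.op ∘L M.eff X) = trace (M.eff X ∘L ρ.op) :=
    (trace_comp_comm ρ.mem _).symm
  constructor
  · rw [trace_comp_partialTrace₂ hT hT0, hdual, hfix]
    exact hρ
  · rw [trace_comp_partialTrace₁ hT hT0, hdual, hsymm, hfix]
    exact hρ

end Diagonal
section DiagonalConsequences

variable {H : Type u} [NormedAddCommGroup H] [InnerProductSpace ℂ H] [CompleteSpace H]
  {ι : Type} {𝓜 : Set (POVM.{u, w} H)} {b : HilbertBasis ι ℂ H}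

/-- In a joint eigenvector a sharp measurement has a deterministic outcome, because a
`{0, 1}`-valued probability measure on a standard Borel space is a Dirac measure. -/
theorem exists_distribution_basisState_eq_dirac
    (hb : ∀ i, IsJointEigenvector (effects 𝓜) (b i)) {P : POVM.{u, w} H} (hP : P ∈ 𝓜) (i : ι) :
    ∃ x : P.Ω, P.distribution (basisState b i) = Measure.dirac x := by
  have hprob := P.distribution_prob (basisState b i)
  have : IsZeroOneMeasure (P.distribution (basisState b i)) := ⟨fun X hX => by
    have h := P.trace_eff (basisState b i) hX
    rw [basisState, State.pure_op, trace_rankOne_comp] at h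
    have h01 : ((P.distribution (basisState b i)).real X : ℂ) = 0 ∨
        ((P.distribution (basisState b i)).real X : ℂ) = 1 := by
      rcases hb i _ ⟨P, hP, X, hX, rfl⟩ with h1 | h1
      · exact .inr (h.symm.trans (by rw [h1, basis_inner_self]))
      · exact .inl (h.symm.trans (by rw [h1, inner_zero_right]))
    refine h01.imp (fun h0 => ?_) fun h1 => ?_
    · exact (measureReal_eq_zero_iff).1 (by exact_mod_cast h0)
    · have h1' : (P.distribution (basisState b i)).real X = 1 := by exact_mod_cast h1
      rw [← ENNReal.ofReal_one, ← h1', ofReal_measureReal]⟩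
  exact IsZeroOneMeasure.exists_eq_dirac

/-- The measurement is concentrated on the countably many outcomes of the basis states. -/
theorem isDiscrete_of_diagonal [Countable ι] (hb : ∀ i, IsJointEigenvector (effects 𝓜) (b i))
    {P : POVM.{u, w} H} (hP : P ∈ 𝓜) : P.IsDiscrete := by
  choose x hx using exists_distribution_basisState_eq_dirac hb hP
  have hS : (Set.range x).Countable := Set.countable_range x
  refine ⟨Set.range x, hS, clm_ext_basis b fun i => ?_⟩
  have hm : MeasurableSet (Set.range x)ᶜ := hS.measurableSet.compl
  have h := P.trace_eff (basisState b i) hm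
  rw [hx i, basisState, State.pure_op, trace_rankOne_comp, measureReal_def,
    Measure.dirac_apply' _ hm, Set.indicator_of_notMem (fun hi : x i ∈ (Set.range x)ᶜ => hi ⟨i, rfl⟩)] at h
  rw [apply_basis_eq_smul hb ⟨P, hP, _, hm, rfl⟩ i, h]
  simp

theorem commute_of_diagonal {R : Set (H →L[ℂ] H)} (hb : ∀ i, IsJointEigenvector R (b i))
    {E F : H →L[ℂ] H} (hE : E ∈ R) (hF : F ∈ R) : Commute E F :=
  clm_ext_basis b fun i => by
    have h1 := apply_basis_eq_smul hb hE i
    have h2 := apply_basis_eq_smul hb hF i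
    generalize ⟪b i, E (b i)⟫_ℂ = e at h1
    generalize ⟪b i, F (b i)⟫_ℂ = f at h2
    simp only [mul_apply_eq_comp, h1, h2, map_smul, smul_comm e f]

end DiagonalConsequences
/-! ### Channels on rank-one operators -/

section Blocks

open InnerProductSpace

variable {H : Type u} [NormedAddCommGroup H] [InnerProductSpace ℂ H] [CompleteSpace H]
  {K : Type v} [NormedAddCommGroup K] [InnerProductSpace ℂ K] [CompleteSpace K]
  (Λ : QuantumChannel H K)

/-- The image `Λ(|x⟩⟨y|)` of a rank-one operator under a channel. -/
def QuantumChannel.block (x y : H) : K →L[ℂ] K :=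
  Λ.toLinearMap ⟨rankOne ℂ x y, rankOne_mem_traceClass x y⟩

theorem QuantumChannel.block_mem (x y : H) : Λ.block x y ∈ TraceClass K :=
  (Λ.toLinearMap ⟨rankOne ℂ x y, rankOne_mem_traceClass x y⟩).2

theorem QuantumChannel.block_nonneg (x : H) : 0 ≤ Λ.block x x :=
  Λ.map_nonneg (T := ⟨rankOne ℂ x x, _⟩) (rankOne_self_nonneg x)

theorem QuantumChannel.trace_block (x y : H) : trace (Λ.block x y) = ⟪y, x⟫_ℂ := by
  refine (Λ.tracePreserving _).trans ?_
  have h := trace_rankOne_comp x y (ContinuousLinearMap.id ℂ H)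
  rwa [ContinuousLinearMap.comp_id] at h

theorem QuantumChannel.block_add_left (x x' y : H) :
    Λ.block (x + x') y = Λ.block x y + Λ.block x' y := by
  have h : (⟨rankOne ℂ (x + x') y, rankOne_mem_traceClass _ _⟩ : TraceClass H) =
      ⟨rankOne ℂ x y, rankOne_mem_traceClass _ _⟩ + ⟨rankOne ℂ x' y, rankOne_mem_traceClass _ _⟩ :=
    Subtype.ext (by simp)
  rw [block, h, map_add]
  rfl

theorem QuantumChannel.block_add_right (x y y' : H) :
    Λ.block x (y + y') = Λ.block x y + Λ.block x y' := by
  have h : (⟨rankOne ℂ x (y + y'), rankOne_mem_traceClass _ _⟩ : TraceClass H) =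
      ⟨rankOne ℂ x y, rankOne_mem_traceClass _ _⟩ + ⟨rankOne ℂ x y', rankOne_mem_traceClass _ _⟩ :=
    Subtype.ext (by simp)
  rw [block, h, map_add]
  rfl

theorem QuantumChannel.block_smul_smul (a c : ℂ) (x y : H) :
    Λ.block (a • x) (c • y) = (a * starRingEnd ℂ c) • Λ.block x y := by
  have h : (⟨rankOne ℂ (a • x) (c • y), rankOne_mem_traceClass _ _⟩ : TraceClass H) =
      (a * starRingEnd ℂ c) • ⟨rankOne ℂ x y, rankOne_mem_traceClass _ _⟩ :=
    Subtype.ext (by simp [smul_smul])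
  rw [block, h, map_smul]
  rfl

theorem QuantumChannel.sum_inner_block_nonneg {n : ℕ} (x : Fin n → H) (a : Fin n → K) :
    0 ≤ ∑ i, ∑ j, ⟪a i, Λ.block (x i) (x j) (a j)⟫_ℂ := by
  refine Λ.sum_inner_nonneg
    (T := fun i j => ⟨rankOne ℂ (x i) (x j), rankOne_mem_traceClass _ _⟩) (fun u => ?_) a
  have h : ∑ i, ∑ j, ⟪u i, rankOne ℂ (x i) (x j) (u j)⟫_ℂ =
      starRingEnd ℂ (∑ j, ⟪x j, u j⟫_ℂ) * ∑ j, ⟪x j, u j⟫_ℂ := by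
    rw [map_sum, Finset.sum_mul_sum]
    refine Finset.sum_congr rfl fun i _ => Finset.sum_congr rfl fun j _ => ?_
    rw [rankOne_apply, inner_smul_right, inner_conj_symm, mul_comm]
  rw [h, mul_comm, Complex.mul_conj]
  exact_mod_cast Complex.normSq_nonneg _

theorem eq_zero_of_forall_real_mul_add_nonneg {z r : ℂ} (h : ∀ s : ℝ, 0 ≤ s * z + r) : z = 0 := by
  have h0 := Complex.nonneg_iff.1 (h 0)
  have him := Complex.nonneg_iff.1 (h 1)
  simp at h0 him
  refine Complex.ext ?_ (by simp; linarith)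
  by_contra hz
  have h1 := (Complex.nonneg_iff.1 (h (-(r.re + 1) / z.re))).1
  simp only [Complex.add_re, Complex.re_ofReal_mul, Complex.zero_re] at h1 hz
  rw [div_mul_cancel₀ _ hz] at h1
  linarith

/-- If `t̄ z + t w + r` is nonnegative for all complex `t`, then `z = w = 0`. -/
theorem eq_zero_of_forall_conj_mul_add_nonneg {z w r : ℂ}
    (h : ∀ t : ℂ, 0 ≤ starRingEnd ℂ t * z + t * w + r) : z = 0 ∧ w = 0 := by
  have h1 : z + w = 0 := eq_zero_of_forall_real_mul_add_nonneg (r := r) fun s => by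
    have := h s
    rw [Complex.conj_ofReal] at this
    convert this using 1
    ring
  have h2 : Complex.I * (w - z) = 0 := eq_zero_of_forall_real_mul_add_nonneg (r := r) fun s => by
    have := h (s * Complex.I)
    rw [map_mul, Complex.conj_ofReal, Complex.conj_I] at this
    convert this using 1
    ring
  have h3 : w - z = 0 := (mul_eq_zero.1 h2).resolve_left Complex.I_ne_zero
  constructor
  · linear_combination (h1 - h3) / 2
  · linear_combination (h1 + h3) / 2

/-- The operator matrix `(Λ(|xᵢ⟩⟨xⱼ|))` is positive, so a kernel vector of a diagonal block is
annihilated by the whole row and column of the block. -/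
theorem QuantumChannel.inner_block_eq_zero {x : H} {a : K} (h : Λ.block x x a = 0) (y : H) (c : K) :
    ⟪a, Λ.block x y c⟫_ℂ = 0 ∧ ⟪c, Λ.block y x a⟫_ℂ = 0 := by
  refine eq_zero_of_forall_conj_mul_add_nonneg (r := ⟪c, Λ.block y y c⟫_ℂ) fun t => ?_
  have h1 := Λ.sum_inner_block_nonneg ![x, y] ![t • a, c]
  simpa [Fin.sum_univ_two, h, inner_smul_left, inner_smul_right, add_assoc,
    mul_comm (starRingEnd ℂ t)] using h1

/-- If the channel maps the statistics of the projection `E` to those of the projection `Q`, then it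
intertwines left and right multiplication by `Q` and by `E`. -/
theorem QuantumChannel.comp_block {Q : H →L[ℂ] H} {E : K →L[ℂ] K} (hQ : IsStarProjection Q)
    (hE : IsStarProjection E) (h : ∀ x, trace (Λ.block x x ∘L E) = ⟪x, Q x⟫_ℂ) (x y : H) :
    E ∘L Λ.block x y = Λ.block (Q x) y ∧ Λ.block y x ∘L E = Λ.block y (Q x) := by
  have hEs : ∀ a c, ⟪E a, c⟫_ℂ = ⟪a, E c⟫_ℂ := fun a c => by
    rw [← ContinuousLinearMap.adjoint_inner_left, hE.isSelfAdjoint.adjoint_eq]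
  have hQQ : Q (Q x) = Q x := DFunLike.congr_fun hQ.isIdempotentElem x
  have key : ∀ F : K →L[ℂ] K, IsStarProjection F → ∀ z, trace (Λ.block z z ∘L F) = 0 →
      F ∘L Λ.block z y = 0 ∧ Λ.block y z ∘L F = 0 := fun F hF z hz => by
    have h1 := comp_eq_zero_of_trace_eq_zero (Λ.block_mem z z) (Λ.block_nonneg z) hF hz
    have h2 : ∀ a, Λ.block z z (F a) = 0 := fun a => DFunLike.congr_fun h1 a
    constructor
    · ext c
      refine ext_inner_left ℂ fun a => ?_
      rw [ContinuousLinearMap.comp_apply, ← ContinuousLinearMap.adjoint_inner_left,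
        hF.isSelfAdjoint.adjoint_eq, (Λ.inner_block_eq_zero (h2 a) y c).1]
      simp
    · ext c
      refine ext_inner_left ℂ fun a => ?_
      rw [ContinuousLinearMap.comp_apply, (Λ.inner_block_eq_zero (h2 c) y a).2]
      simp
  have h0 := key E hE (x - Q x) (by rw [h]; simp [hQQ])
  have h1 := key (1 - E) hE.one_sub (Q x) (by
    have h2 : trace (Λ.block (Q x) (Q x) ∘L 1) = ⟪Q x, Q x⟫_ℂ := Λ.trace_block _ _
    rw [trace_comp_sub (Λ.block_mem _ _), h, h2, hQQ, sub_self])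
  have hx : x = (x - Q x) + Q x := (sub_add_cancel _ _).symm
  constructor
  · conv_lhs => rw [hx, Λ.block_add_left, ContinuousLinearMap.comp_add, h0.1, zero_add]
    refine (sub_eq_zero.1 ?_).symm
    rw [← h1.1, ContinuousLinearMap.sub_comp]
    rfl
  · conv_lhs => rw [hx, Λ.block_add_right, ContinuousLinearMap.add_comp, h0.2, zero_add]
    refine (sub_eq_zero.1 ?_).symm
    rw [← h1.2, ContinuousLinearMap.comp_sub]
    rfl

end Blocks
/-! ### Broadcastable measurements have a joint eigenbasis -/

section Broadcasting

open InnerProductSpace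

variable {H : Type u} [NormedAddCommGroup H] [InnerProductSpace ℂ H] [CompleteSpace H]

/-- The projections broadcast by `Λ`. -/
def broadcastProjections (Λ : QuantumChannel H (HTensor H H)) : Set (H →L[ℂ] H) :=
  {Q | IsStarProjection Q ∧ (∀ x, trace (Λ.block x x ∘L tensorOp Q 1) = ⟪x, Q x⟫_ℂ) ∧
    ∀ x, trace (Λ.block x x ∘L tensorOp 1 Q) = ⟪x, Q x⟫_ℂ}

variable {Λ : QuantumChannel H (HTensor H H)} {Q P : H →L[ℂ] H}

theorem comp_block_of_broadcast (hQ : Q ∈ broadcastProjections Λ) (x y : H) :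
    tensorOp Q 1 ∘L Λ.block x y = Λ.block (Q x) y ∧
      tensorOp 1 Q ∘L Λ.block x y = Λ.block (Q x) y ∧
      Λ.block y x ∘L tensorOp Q 1 = Λ.block y (Q x) ∧
      Λ.block y x ∘L tensorOp 1 Q = Λ.block y (Q x) := by
  have h1 := Λ.comp_block hQ.1 (isStarProjection_tensorOp hQ.1 (.one _)) hQ.2.1 x y
  have h2 := Λ.comp_block hQ.1 (isStarProjection_tensorOp (.one _) hQ.1) hQ.2.2 x y
  exact ⟨h1.1, h2.1, h1.2, h2.2⟩

/-- Broadcast projections commute, because `Q ⊗ 1` and `1 ⊗ P` do. -/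
theorem commute_of_broadcast (hQ : Q ∈ broadcastProjections Λ) (hP : P ∈ broadcastProjections Λ) :
    Commute Q P := by
  ext x
  refine ext_inner_left ℂ fun y => ?_
  simp only [mul_apply_eq_comp]
  rw [← Λ.trace_block, ← Λ.trace_block, ← (comp_block_of_broadcast hQ (P x) y).1,
    ← (comp_block_of_broadcast hP x y).2.1, ← (comp_block_of_broadcast hP (Q x) y).2.1,
    ← (comp_block_of_broadcast hQ x y).1, ← ContinuousLinearMap.comp_assoc,
    ← ContinuousLinearMap.comp_assoc, tensorOp_comp, tensorOp_comp]
  rfl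

theorem mul_mem_broadcastProjections (hQ : Q ∈ broadcastProjections Λ)
    (hP : P ∈ broadcastProjections Λ) : Q * P ∈ broadcastProjections Λ := by
  refine ⟨hQ.1.mul hP.1 (commute_of_broadcast hQ hP), fun x => ?_, fun x => ?_⟩
  · have h : tensorOp (Q * P) (1 : H →L[ℂ] H) = tensorOp Q 1 ∘L tensorOp P 1 :=
      (tensorOp_comp Q P 1 1).symm
    rw [← trace_comp_comm (Λ.block_mem x x), h, ContinuousLinearMap.comp_assoc,
      (comp_block_of_broadcast hP x x).1, (comp_block_of_broadcast hQ (P x) x).1, Λ.trace_block]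
    rfl
  · have h : tensorOp (1 : H →L[ℂ] H) (Q * P) = tensorOp 1 Q ∘L tensorOp 1 P :=
      (tensorOp_comp 1 1 Q P).symm
    rw [← trace_comp_comm (Λ.block_mem x x), h, ContinuousLinearMap.comp_assoc,
      (comp_block_of_broadcast hP x x).2.1, (comp_block_of_broadcast hQ (P x) x).2.1,
      Λ.trace_block]
    rfl

theorem one_mem_broadcastProjections : 1 ∈ broadcastProjections Λ := by
  refine ⟨.one _, fun x => ?_, fun x => ?_⟩ <;>
  · rw [tensorOp_one_one]
    exact Λ.trace_block x x

theorem one_sub_mem_broadcastProjections (hQ : Q ∈ broadcastProjections Λ) :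
    1 - Q ∈ broadcastProjections Λ := by
  have h1 : ∀ x, trace (Λ.block x x ∘L 1) = ⟪x, x⟫_ℂ := fun x => Λ.trace_block x x
  refine ⟨hQ.1.one_sub, fun x => ?_, fun x => ?_⟩
  · rw [tensorOp_one_sub_left, trace_comp_sub (Λ.block_mem x x), hQ.2.1, h1, sub_apply,
      inner_sub_right, one_apply_eq_self]
  · rw [tensorOp_one_sub_right, trace_comp_sub (Λ.block_mem x x), hQ.2.2, h1, sub_apply,
      inner_sub_right, one_apply_eq_self]

/-- The reduced states of a broadcasting channel commute with the broadcast projections: on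
`Λ(|x⟩⟨x|)` the projection `Q ⊗ 1` may be replaced by `1 ⊗ Q`, which can be moved cyclically. -/
theorem commute_partialTrace₂_of_broadcast (hQ : Q ∈ broadcastProjections Λ) (x : H) :
    Commute Q (partialTrace₂ (Λ.block x x)) := by
  have hT := Λ.block_mem x x
  have hT0 := Λ.block_nonneg x
  obtain ⟨h1, h2, h3, h4⟩ := comp_block_of_broadcast hQ x x
  have hS := partialTrace₂_mem hT hT0
  have key : ∀ A : H →L[ℂ] H, trace ((A ∘L Q) ∘L partialTrace₂ (Λ.block x x)) =
      trace ((Q ∘L A) ∘L partialTrace₂ (Λ.block x x)) := fun A => by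
    have e1 : tensorOp (A ∘L Q) (1 : H →L[ℂ] H) = tensorOp A 1 ∘L tensorOp Q 1 :=
      (tensorOp_comp A Q 1 1).symm
    have e2 : tensorOp (Q ∘L A) (1 : H →L[ℂ] H) = tensorOp Q 1 ∘L tensorOp A 1 :=
      (tensorOp_comp Q A 1 1).symm
    have e3 : tensorOp A (1 : H →L[ℂ] H) ∘L tensorOp 1 Q = tensorOp 1 Q ∘L tensorOp A 1 := by
      rw [tensorOp_comp, tensorOp_comp]
      rfl
    rw [trace_comp_partialTrace₂ hT hT0, trace_comp_partialTrace₂ hT hT0, e1, e2,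
      ← ContinuousLinearMap.comp_assoc _ (tensorOp Q 1), h3, ← h4, ContinuousLinearMap.comp_assoc,
      ← e3, ← trace_comp_comm hT, ContinuousLinearMap.comp_assoc, h1, ← h2,
      ← ContinuousLinearMap.comp_assoc, trace_comp_comm hT]
  ext y
  refine ext_inner_left ℂ fun z => ?_
  have h := key (rankOne ℂ y z)
  rw [ContinuousLinearMap.comp_assoc, trace_rankOne_comp, trace_comp_comm hS,
    ← ContinuousLinearMap.comp_assoc, trace_comp_rankOne] at h
  exact h

theorem isCompactlyModelled_broadcastProjections (Λ : QuantumChannel H (HTensor H H)) :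
    IsCompactlyModelled (broadcastProjections Λ) where
  proj _ hQ := hQ.1
  comm _ hQ _ hP := commute_of_broadcast hQ hP
  one_mem := one_mem_broadcastProjections
  compl_mem _ hQ := one_sub_mem_broadcastProjections hQ
  mul_mem _ hQ _ hP := mul_mem_broadcastProjections hQ hP
  model x hx := by
    have hT := Λ.block_mem x x
    have hT0 := Λ.block_nonneg x
    have hS := partialTrace₂_mem hT hT0
    have hS0 := partialTrace₂_nonneg hT hT0
    refine ⟨partialTrace₂ (Λ.block x x), hS0, isCompactOperator_of_nonneg hS0 hS, fun h => ?_,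
      fun Q hQ => commute_partialTrace₂_of_broadcast hQ x, fun Q hQ v hv hQv => ?_⟩
    · have h1 := trace_partialTrace₂ hT hT0
      rw [h, Λ.trace_block, inner_self_eq_norm_sq_to_K, hx] at h1
      simp [trace] at h1
    · have h1 := inner_le_trace hS hS0 hQ.1 hv hQv
      rw [← trace_comp_comm hS, trace_comp_partialTrace₂ hT hT0, hQ.2.1] at h1
      exact (Complex.le_def.1 h1).1

theorem trace_block_of_unit {K : Type v} [NormedAddCommGroup K] [InnerProductSpace ℂ K]
    [CompleteSpace K] {Λ : QuantumChannel H K} {E : K →L[ℂ] K} {Q : H →L[ℂ] H}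
    (h : ∀ x, ‖x‖ = 1 → trace (Λ.block x x ∘L E) = ⟪x, Q x⟫_ℂ) (x : H) :
    trace (Λ.block x x ∘L E) = ⟪x, Q x⟫_ℂ := by
  obtain ⟨c, y, hy, rfl⟩ := exists_eq_smul_unit x
  rw [Λ.block_smul_smul, trace_smul_comp, map_smul, inner_smul_left, inner_smul_right]
  rcases hy with rfl | hy
  · simp
  · rw [h y hy]
    ring

theorem IsBroadcastable.exists_hilbertBasis [TopologicalSpace.SeparableSpace H]
    {𝓜 : Set (POVM.{u, w} H)} (h𝓜 : ∀ P ∈ 𝓜, P.IsPVM) (h : IsBroadcastable 𝓜) :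
    ∃ (ι : Type) (_ : Countable ι) (b : HilbertBasis ι ℂ H),
      ∀ i, IsJointEigenvector (effects 𝓜) (b i) := by
  obtain ⟨Λ, hΛ⟩ := h
  obtain ⟨ι, hι, b, hb⟩ := (isCompactlyModelled_broadcastProjections Λ).exists_hilbertBasis
  refine ⟨ι, hι, b, fun i E hE => hb i E ?_⟩
  obtain ⟨M, hM, X, hX, rfl⟩ := hE
  refine ⟨h𝓜 M hM X hX, trace_block_of_unit fun x hx => ?_, trace_block_of_unit fun x hx => ?_⟩
  · have h := (hΛ (.pure x hx) M hM X hX).1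
    have hT := Λ.block_mem x x
    have hT0 := Λ.block_nonneg x
    rw [State.pure_op, trace_comp_rankOne] at h
    rw [← h, ← trace_comp_partialTrace₂ hT hT0]
    rfl
  · have h := (hΛ (.pure x hx) M hM X hX).2
    have hT := Λ.block_mem x x
    have hT0 := Λ.block_nonneg x
    rw [State.pure_op, trace_comp_rankOne] at h
    rw [← h, ← trace_comp_partialTrace₁ hT hT0]
    rfl

end Broadcasting
/-! ### Fixed projections of entanglement-breaking channels have a joint eigenbasis -/

section EntanglementBreaking

open InnerProductSpace

variable {H : Type u} [NormedAddCommGroup H] [InnerProductSpace ℂ H] [CompleteSpace H]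
  {K : Type v} [NormedAddCommGroup K] [InnerProductSpace ℂ K] [CompleteSpace K]

/-- The trace norm dominates the operator norm; when it is infinite there is nothing to prove. -/
theorem ofReal_norm_le_traceNorm (T : H →L[ℂ] H) : ENNReal.ofReal ‖T‖ ≤ traceNorm T := by
  by_cases htop : traceNorm T = ⊤
  · exact htop ▸ le_top
  have h0 : 0 ≤ CFC.abs T := CFC.abs_nonneg T
  have hi := fun i => nonneg_iff_forall_inner.1 h0 (stdBasis H i)
  have hre : ∀ i, ((⟪stdBasis H i, CFC.abs T (stdBasis H i)⟫_ℂ).re : ℂ) =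
      ⟪stdBasis H i, CFC.abs T (stdBasis H i)⟫_ℂ := fun i =>
    Complex.ext rfl (Complex.nonneg_iff.1 (hi i)).2
  have hs : Summable fun i => (⟪stdBasis H i, CFC.abs T (stdBasis H i)⟫_ℂ).re :=
    (ENNReal.summable_toReal htop).congr fun i =>
      ENNReal.toReal_ofReal (Complex.nonneg_iff.1 (hi i)).1
  have hm : CFC.abs T ∈ TraceClass H := mem_traceClass_of_nonneg h0 (stdBasis H)
    ((Complex.hasSum_ofReal.2 hs.hasSum).summable.congr hre)
  have h1 := norm_le_re_trace hm h0
  rw [CFC.norm_abs] at h1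
  refine (ENNReal.ofReal_le_ofReal h1).trans (le_of_eq ?_)
  rw [trace, Complex.re_tsum (hasSum_trace_self hm (stdBasis H)).summable, traceNorm,
    ENNReal.ofReal_tsum_of_nonneg (fun i => (Complex.nonneg_iff.1 (hi i)).1) hs]

/-- Partial transposition preserves positivity of product states. -/
theorem sum_inner_mul_inner_nonneg {n : ℕ} {α : K →L[ℂ] K} {β : H →L[ℂ] H} (hα : 0 ≤ α)
    (hβ : 0 ≤ β) (f : Fin n → K) (a : Fin n → H) :
    0 ≤ ∑ i, ∑ j, ⟪f j, α (f i)⟫_ℂ * ⟪a i, β (a j)⟫_ℂ := by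
  obtain ⟨S, -, hSS, hsym⟩ := exists_selfAdjoint_sqrt hβ
  have h : ∀ i j, HasSum (fun k => ⟪f j, α (f i)⟫_ℂ *
      (⟪S (a i), stdBasis H k⟫_ℂ * ⟪stdBasis H k, S (a j)⟫_ℂ))
      (⟪f j, α (f i)⟫_ℂ * ⟪a i, β (a j)⟫_ℂ) := fun i j => by
    rw [hSS, ← hsym]
    exact ((stdBasis H).hasSum_inner_mul_inner _ _).mul_left _
  refine (hasSum_sum fun i _ => hasSum_sum fun j _ => h i j).nonneg fun k => ?_
  have h1 := nonneg_iff_forall_inner.1 hα (∑ i, ⟪S (a i), stdBasis H k⟫_ℂ • f i)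
  simp only [map_sum, inner_sum, sum_inner, map_smul, inner_smul_left, inner_smul_right,
    inner_conj_symm, Finset.mul_sum] at h1
  refine h1.trans_eq (Finset.sum_congr rfl fun i _ => Finset.sum_congr rfl fun j _ => ?_)
  ring

/-- The partial transposition criterion: a separable state remains positive under partial
transposition. -/
theorem State.IsSeparable.sum_inner_nonneg {τ : State (HTensor K H)} (hτ : τ.IsSeparable) {n : ℕ}
    (f : Fin n → K) (a : Fin n → H) :
    0 ≤ ∑ i, ∑ j, ⟪htmul (f j) (a i), τ.op (htmul (f i) (a j))⟫_ℂ := by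
  let F : (HTensor K H →L[ℂ] HTensor K H) →L[ℂ] ℂ := ∑ i, ∑ j,
    innerSL ℂ (htmul (f j) (a i)) ∘L ContinuousLinearMap.apply ℂ _ (htmul (f i) (a j))
  have hF : ∀ T, F T = ∑ i, ∑ j, ⟪htmul (f j) (a i), T (htmul (f i) (a j))⟫_ℂ := fun T => by
    simp [F, _root_.sum_apply]
  have hconv : Convex ℝ {T | 0 ≤ F T} := by
    intro S hS T hT s t hs ht _
    have h : F (s • S + t • T) = s * F S + t * F T := by
      rw [map_add, ← Complex.coe_smul, ← Complex.coe_smul, map_smul, map_smul]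
      rfl
    change 0 ≤ F _
    rw [h]
    exact add_nonneg (mul_nonneg (by exact_mod_cast hs) hS) (mul_nonneg (by exact_mod_cast ht) hT)
  have hhull : convexHull ℝ (Set.range fun p : State K × State H => tensorOp p.1.op p.2.op) ⊆
      {T | 0 ≤ F T} := by
    refine convexHull_min ?_ hconv
    rintro _ ⟨⟨α, β⟩, rfl⟩
    change 0 ≤ F _
    rw [hF]
    simp only [tensorOp_htmul, inner_htmul]
    exact sum_inner_mul_inner_nonneg α.nonneg β.nonneg f a
  have hcl : τ.op ∈ closure {T | 0 ≤ F T} := by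
    refine Metric.mem_closure_iff.2 fun ε hε => ?_
    obtain ⟨S, hS, hSε⟩ := hτ (ENNReal.ofReal ε) (ENNReal.ofReal_pos.2 hε)
    refine ⟨S, hhull hS, ?_⟩
    rw [dist_eq_norm]
    exact (ENNReal.ofReal_lt_ofReal_iff hε).1 ((ofReal_norm_le_traceNorm _).trans_lt hSε)
  have hclosed : IsClosed {T | 0 ≤ F T} := isClosed_Ici.preimage F.continuous
  rw [← hF]
  rwa [hclosed.closure_eq] at hcl

/-- The two-by-two blocks of an entanglement-breaking channel are positive also after
transposition. -/
theorem QuantumChannel.IsEntanglementBreaking.sum_inner_block_nonneg {Λ : QuantumChannel H H}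
    (hΛ : Λ.IsEntanglementBreaking) (x a : Fin 2 → H) :
    0 ≤ ∑ i, ∑ j, ⟪a i, Λ.block (x j) (x i) (a j)⟫_ℂ := by
  obtain ⟨Λs, hdual, hsep⟩ := hΛ
  let K := EuclideanSpace ℂ (ULift.{u} (Fin 2))
  let f : Fin 2 → K := fun i => EuclideanSpace.basisFun (ULift.{u} (Fin 2)) ℂ (ULift.up i)
  have hf : ∀ i j, ⟪f i, f j⟫_ℂ = if i = j then 1 else 0 := fun i j => by
    have h := orthonormal_iff_ite.1 (EuclideanSpace.basisFun (ULift.{u} (Fin 2)) ℂ).orthonormal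
      (ULift.up i) (ULift.up j)
    simpa only [ULift.up.injEq] using h
  let Ω : HTensor K H := ∑ i, htmul (f i) (x i)
  by_cases hΩ : Ω = 0
  · have hx : ∀ i, x i = 0 := fun i => by
      have h : ⟪Ω, htmul (f i) (x i)⟫_ℂ = 0 := by rw [hΩ, inner_zero_left]
      rw [sum_inner] at h
      simpa [inner_htmul, hf] using h
    have h0 : Λ.block 0 0 = 0 := by
      simpa using Λ.block_smul_smul 0 0 (0 : H) 0
    simp [hx, h0]
  have hc : (‖Ω‖ : ℂ) ≠ 0 := by exact_mod_cast norm_ne_zero_iff.2 hΩ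
  have hunit : ‖(‖Ω‖ : ℂ)⁻¹ • Ω‖ = 1 := by
    rw [norm_smul, norm_inv, Complex.norm_real, norm_norm, inv_mul_cancel₀]
    exact norm_ne_zero_iff.2 hΩ
  obtain ⟨τ, hτ, hτω⟩ := hsep K (.pure _ hunit)
  have key : ∀ i j, ⟪htmul (f j) (a i), τ.op (htmul (f i) (a j))⟫_ℂ =
      ((‖Ω‖ ^ 2 : ℝ) : ℂ)⁻¹ * ⟪a i, Λ.block (x j) (x i) (a j)⟫_ℂ := fun i j => by
    have h1 := hτω (rankOne ℂ (f i) (f j)) (rankOne ℂ (a j) (a i))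
    have h2 := hdual ⟨rankOne ℂ (x j) (x i), rankOne_mem_traceClass _ _⟩ (rankOne ℂ (a j) (a i))
    rw [trace_rankOne_comp] at h2
    rw [tensorOp_rankOne, trace_comp_rankOne, State.pure_op, trace_rankOne_comp] at h1
    rw [h1, map_smul, inner_smul_left, inner_smul_right]
    have h3 : ⟪Ω, tensorOp (rankOne ℂ (f i) (f j)) (Λs (rankOne ℂ (a j) (a i))) Ω⟫_ℂ =
        ⟪x i, Λs (rankOne ℂ (a j) (a i)) (x j)⟫_ℂ := by
      simp only [Ω, map_sum, tensorOp_htmul, rankOne_apply, inner_sum, sum_inner, inner_htmul,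
        inner_smul_right, hf]
      simp
    rw [h3, ← h2]
    have h4 : trace ((Λ.toLinearMap ⟨rankOne ℂ (x j) (x i), rankOne_mem_traceClass _ _⟩ :
        H →L[ℂ] H) ∘L rankOne ℂ (a j) (a i)) = ⟪a i, Λ.block (x j) (x i) (a j)⟫_ℂ :=
      trace_comp_rankOne _ _ _
    rw [h4]
    simp [pow_two]
    ring
  have h := hτ.sum_inner_nonneg f a
  simp only [key, ← Finset.mul_sum] at h
  have hpos : (0 : ℂ) < ((‖Ω‖ ^ 2 : ℝ) : ℂ) := by
    exact_mod_cast pow_pos (norm_pos_iff.2 hΩ) 2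
  have h5 := mul_nonneg hpos.le h
  rwa [mul_inv_cancel_left₀ hpos.ne'] at h5

theorem QuantumChannel.IsEntanglementBreaking.inner_block_eq_zero {Λ : QuantumChannel H H}
    (hΛ : Λ.IsEntanglementBreaking) {x a : H} (h : Λ.block x x a = 0) (y c : H) :
    ⟪a, Λ.block y x c⟫_ℂ = 0 := by
  refine (eq_zero_of_forall_conj_mul_add_nonneg (w := ⟪c, Λ.block x y a⟫_ℂ)
    (r := ⟪c, Λ.block y y c⟫_ℂ) fun t => ?_).1
  have h1 := hΛ.sum_inner_block_nonneg ![x, y] ![t • a, c]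
  simpa [Fin.sum_univ_two, h, inner_smul_left, inner_smul_right, add_assoc,
    mul_comm (starRingEnd ℂ t)] using h1

/-- The projections fixed by the dual of `Λ`. -/
def fixedProjections (Λ : QuantumChannel H H) : Set (H →L[ℂ] H) :=
  {Q | IsStarProjection Q ∧ ∀ x, trace (Λ.block x x ∘L Q) = ⟪x, Q x⟫_ℂ}

theorem one_mem_fixedProjections {Λ : QuantumChannel H H} : 1 ∈ fixedProjections Λ :=
  ⟨.one _, fun x => Λ.trace_block x x⟩

theorem one_sub_mem_fixedProjections {Λ : QuantumChannel H H} {Q : H →L[ℂ] H}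
    (hQ : Q ∈ fixedProjections Λ) : 1 - Q ∈ fixedProjections Λ := by
  have h1 : ∀ x, trace (Λ.block x x ∘L 1) = ⟪x, x⟫_ℂ := fun x => Λ.trace_block x x
  refine ⟨hQ.1.one_sub, fun x => ?_⟩
  rw [trace_comp_sub (Λ.block_mem x x), hQ.2, h1, sub_apply, inner_sub_right, one_apply_eq_self]

variable {Λ : QuantumChannel H H} {Q P : H →L[ℂ] H}

/-- By the partial transposition criterion a fixed projection can be moved through all four slots of
`⟨a, Λ(|x⟩⟨y|) c⟩`. -/
theorem comp_block_of_fixed (hΛ : Λ.IsEntanglementBreaking) (hQ : Q ∈ fixedProjections Λ)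
    (x y : H) : Q ∘L Λ.block x y = Λ.block (Q x) y ∧ Λ.block x y ∘L Q = Λ.block x (Q y) ∧
      Q ∘L Λ.block x y = Λ.block x (Q y) := by
  refine ⟨(Λ.comp_block hQ.1 hQ.1 hQ.2 x y).1, (Λ.comp_block hQ.1 hQ.1 hQ.2 y x).2, ?_⟩
  have key : ∀ F ∈ fixedProjections Λ, ∀ z, F z = 0 → F ∘L Λ.block x z = 0 := fun F hF z hz => by
    have h1 := comp_eq_zero_of_trace_eq_zero (Λ.block_mem z z) (Λ.block_nonneg z) hF.1
      (by rw [hF.2, hz, inner_zero_right])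
    ext c
    refine ext_inner_left ℂ fun a => ?_
    have h2 : Λ.block z z (F a) = 0 := DFunLike.congr_fun h1 a
    rw [ContinuousLinearMap.comp_apply, ← ContinuousLinearMap.adjoint_inner_left,
      hF.1.isSelfAdjoint.adjoint_eq, hΛ.inner_block_eq_zero h2 x c]
    simp
  have hQQ : Q (Q y) = Q y := DFunLike.congr_fun hQ.1.isIdempotentElem y
  have h0 := key Q hQ (y - Q y) (by rw [map_sub, hQQ, sub_self])
  have h1 := key (1 - Q) (one_sub_mem_fixedProjections hQ) (Q y)
    (by rw [sub_apply, one_apply_eq_self, hQQ, sub_self])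
  have hy : y = (y - Q y) + Q y := (sub_add_cancel _ _).symm
  conv_lhs => rw [hy, Λ.block_add_right, ContinuousLinearMap.comp_add, h0, zero_add]
  refine (sub_eq_zero.1 ?_).symm
  rw [← h1, ContinuousLinearMap.sub_comp]
  rfl

theorem commute_block_of_fixed (hΛ : Λ.IsEntanglementBreaking) (hQ : Q ∈ fixedProjections Λ)
    (x y : H) : Q ∘L Λ.block x y = Λ.block x y ∘L Q := by
  obtain ⟨-, h2, h3⟩ := comp_block_of_fixed hΛ hQ x y
  rw [h2, h3]

theorem commute_of_fixed (hΛ : Λ.IsEntanglementBreaking) (hQ : Q ∈ fixedProjections Λ)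
    (hP : P ∈ fixedProjections Λ) : Commute Q P := by
  ext x
  refine ext_inner_left ℂ fun y => ?_
  simp only [mul_apply_eq_comp]
  rw [← Λ.trace_block, ← Λ.trace_block, ← (comp_block_of_fixed hΛ hQ (P x) y).1,
    commute_block_of_fixed hΛ hQ, ← (comp_block_of_fixed hΛ hP x y).1,
    ← (comp_block_of_fixed hΛ hP (Q x) y).1, ContinuousLinearMap.comp_assoc,
    ← commute_block_of_fixed hΛ hQ, (comp_block_of_fixed hΛ hQ x y).1]

theorem mul_mem_fixedProjections (hΛ : Λ.IsEntanglementBreaking) (hQ : Q ∈ fixedProjections Λ)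
    (hP : P ∈ fixedProjections Λ) : Q * P ∈ fixedProjections Λ := by
  refine ⟨hQ.1.mul hP.1 (commute_of_fixed hΛ hQ hP), fun x => ?_⟩
  have h : (Q * P) ∘L Λ.block x x = Q ∘L P ∘L Λ.block x x := rfl
  rw [← trace_comp_comm (Λ.block_mem x x), h, (comp_block_of_fixed hΛ hP x x).1,
    (comp_block_of_fixed hΛ hQ (P x) x).1, Λ.trace_block]
  rfl

theorem isCompactlyModelled_fixedProjections (hΛ : Λ.IsEntanglementBreaking) :
    IsCompactlyModelled (fixedProjections Λ) where
  proj _ hQ := hQ.1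
  comm _ hQ _ hP := commute_of_fixed hΛ hQ hP
  one_mem := one_mem_fixedProjections
  compl_mem _ hQ := one_sub_mem_fixedProjections hQ
  mul_mem _ hQ _ hP := mul_mem_fixedProjections hΛ hQ hP
  model x hx := by
    have hT := Λ.block_mem x x
    have hT0 := Λ.block_nonneg x
    refine ⟨Λ.block x x, hT0, isCompactOperator_of_nonneg hT0 hT, fun h => ?_,
      fun Q hQ => commute_block_of_fixed hΛ hQ x x, fun Q hQ v hv hQv => ?_⟩
    · have h1 := Λ.trace_block x x
      rw [h, inner_self_eq_norm_sq_to_K, hx] at h1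
      simp [trace] at h1
    · have h1 := inner_le_trace hT hT0 hQ.1 hv hQv
      rw [hQ.2] at h1
      exact (Complex.le_def.1 h1).1

theorem IsFixedByEBChannel.exists_hilbertBasis [TopologicalSpace.SeparableSpace H]
    {𝓜 : Set (POVM.{u, w} H)} (h𝓜 : ∀ P ∈ 𝓜, P.IsPVM) (h : IsFixedByEBChannel 𝓜) :
    ∃ (ι : Type) (_ : Countable ι) (b : HilbertBasis ι ℂ H),
      ∀ i, IsJointEigenvector (effects 𝓜) (b i) := by
  obtain ⟨Λ, Λs, hΛ, hdual, hfix⟩ := h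
  obtain ⟨ι, hι, b, hb⟩ := (isCompactlyModelled_fixedProjections hΛ).exists_hilbertBasis
  refine ⟨ι, hι, b, fun i E hE => hb i E ⟨?_, fun x => ?_⟩⟩
  · obtain ⟨M, hM, X, hX, rfl⟩ := hE
    exact h𝓜 M hM X hX
  · rw [← trace_rankOne_comp]
    conv_rhs => rw [← hfix E hE]
    exact hdual _ E

end EntanglementBreaking
/-! ### Noncontextual measurements have a joint eigenbasis -/

section Contextuality

open InnerProductSpace

variable {H : Type u} [NormedAddCommGroup H] [InnerProductSpace ℂ H] [CompleteSpace H]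

/-- An operator with nonnegative expectation in all states is positive. -/
theorem nonneg_of_forall_state {A : H →L[ℂ] H} (h : ∀ ρ : State H, 0 ≤ trace (ρ.op ∘L A)) :
    0 ≤ A := by
  rw [nonneg_iff_forall_inner]
  intro x
  obtain ⟨c, y, hy, rfl⟩ := exists_eq_smul_unit x
  rw [map_smul, inner_smul_left, inner_smul_right]
  rcases hy with rfl | hy
  · simp
  · have h1 := h (.pure y hy)
    rw [State.pure_op, trace_rankOne_comp] at h1
    rw [← mul_assoc, mul_comm (starRingEnd ℂ c), Complex.mul_conj]
    exact mul_nonneg (by exact_mod_cast Complex.normSq_nonneg c) h1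

theorem eq_of_forall_state {A B : H →L[ℂ] H}
    (h : ∀ ρ : State H, trace (ρ.op ∘L A) = trace (ρ.op ∘L B)) : A = B :=
  le_antisymm
    (sub_nonneg.1 (nonneg_of_forall_state fun ρ => by
      rw [trace_comp_sub ρ.mem, h, sub_self]))
    (sub_nonneg.1 (nonneg_of_forall_state fun ρ => by
      rw [trace_comp_sub ρ.mem, h, sub_self]))

section Effects

variable (M : POVM.{u, w} H) {X Y : Set M.Ω}

theorem POVM.eff_nonneg (hX : MeasurableSet X) : 0 ≤ M.eff X :=
  nonneg_of_forall_state fun ρ => by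
    rw [M.trace_eff ρ hX]
    exact_mod_cast measureReal_nonneg

theorem POVM.eff_union (hX : MeasurableSet X) (hY : MeasurableSet Y) (h : Disjoint X Y) :
    M.eff (X ∪ Y) = M.eff X + M.eff Y :=
  eq_of_forall_state fun ρ => by
    have := M.distribution_prob ρ
    rw [trace_comp_add ρ.mem, M.trace_eff ρ hX, M.trace_eff ρ hY, M.trace_eff ρ (hX.union hY),
      measureReal_union h hY, Complex.ofReal_add]

theorem POVM.eff_univ : M.eff Set.univ = 1 :=
  eq_of_forall_state fun ρ => by
    have := M.distribution_prob ρ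
    rw [M.trace_eff ρ .univ, probReal_univ]
    exact ρ.trace_eq.symm

theorem POVM.eff_compl (hX : MeasurableSet X) : M.eff Xᶜ = 1 - M.eff X := by
  rw [← M.eff_univ, ← Set.union_compl_self X, M.eff_union hX hX.compl disjoint_compl_right,
    add_sub_cancel_left]

variable {M}

/-- An effect of measure zero in all states fixed by the idempotent `F` vanishes on its range. -/
theorem POVM.eff_comp_eq_zero {F : H →L[ℂ] H} (hF : ∀ x, F (F x) = F x) (hX : MeasurableSet X)
    (h : ∀ (y : H) (hy : ‖y‖ = 1), F y = y → M.distribution (.pure y hy) X = 0) :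
    M.eff X ∘L F = 0 := by
  ext x
  obtain ⟨c, y, hy, hxy⟩ := exists_eq_smul_unit (F x)
  rw [ContinuousLinearMap.comp_apply, hxy, map_smul]
  by_cases hc : c = 0
  · simp [hc]
  have hy := hy.resolve_left hc
  have hFy : F y = y := by
    have h1 := hF x
    rw [hxy, map_smul] at h1
    exact smul_right_injective H hc h1
  have h1 := M.trace_eff (.pure y hy) hX
  rw [measureReal_def, h y hy hFy, State.pure_op, trace_rankOne_comp] at h1
  rw [apply_eq_zero_of_inner_eq_zero (M.eff_nonneg hX) (by simpa using h1)]
  simp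

theorem POVM.distribution_eq_zero (hX : MeasurableSet X) (h : M.eff X = 0) (ρ : State H) :
    M.distribution ρ X = 0 := by
  have := M.distribution_prob ρ
  have h1 := M.trace_eff ρ hX
  rw [h] at h1
  refine (measureReal_eq_zero_iff).1 ?_
  have h2 : trace (ρ.op ∘L (0 : H →L[ℂ] H)) = 0 := by simp [trace]
  exact_mod_cast h1.symm.trans h2

theorem POVM.eff_mono (hX : MeasurableSet X) (hY : MeasurableSet Y) (h : X ⊆ Y) :
    M.eff X ≤ M.eff Y := by
  rw [← Set.union_sdiff_cancel h, M.eff_union hX (hY.diff hX) Set.disjoint_sdiff_right]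
  exact le_add_of_nonneg_right (M.eff_nonneg (hY.diff hX))

/-- A positive operator vanishes wherever an operator that dominates it does. -/
theorem comp_eq_zero_of_le {A B F : H →L[ℂ] H} (hA : 0 ≤ A) (hAB : A ≤ B) (h : B ∘L F = 0) :
    A ∘L F = 0 := by
  ext x
  have h1 := nonneg_iff_forall_inner.1 (sub_nonneg.2 hAB) (F x)
  have h2 : B (F x) = 0 := DFunLike.congr_fun h x
  rw [sub_apply, h2, zero_sub, inner_neg_right] at h1
  exact apply_eq_zero_of_inner_eq_zero hA
    (le_antisymm (neg_nonneg.1 h1) (nonneg_iff_forall_inner.1 hA _))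

end Effects

/-- The projections `Q` that are effects `G(B)` of the model measurement, such that almost surely
the response state `σ_λ` is supported in `Q` if `λ ∈ B` and orthogonal to it otherwise. -/
def deterministicProjections (G : POVM.{u, w} H) (σ : G.Ω → State H) : Set (H →L[ℂ] H) :=
  {Q | IsStarProjection Q ∧ ∃ B, MeasurableSet B ∧ G.eff B = Q ∧
    ∀ ρ, ∀ᵐ l ∂(G.distribution ρ),
      (l ∈ B → (σ l).op ∘L Q = (σ l).op) ∧ (l ∉ B → (σ l).op ∘L Q = 0)}

variable {G : POVM.{u, w} H} {σ : G.Ω → State H} {Q P : H →L[ℂ] H}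

/-- A state that gives a projection probability one is supported in it. -/
theorem State.comp_eq_self (ρ : State H) (hQ : IsStarProjection Q) (h : trace (ρ.op ∘L Q) = 1) :
    ρ.op ∘L Q = ρ.op := by
  have h0 : trace (ρ.op ∘L (1 : H →L[ℂ] H)) = 1 := ρ.trace_eq
  have h1 := comp_eq_zero_of_trace_eq_zero ρ.mem ρ.nonneg hQ.one_sub (by
    rw [trace_comp_sub ρ.mem, h, h0, sub_self])
  rw [ContinuousLinearMap.comp_sub] at h1
  exact (sub_eq_zero.1 h1).symm

/-- If the statistics of a projection `Q` are reproduced by the model, then its response function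
`h(λ) = tr(σ_λ Q)` must be one in all states in the range of `Q` and zero in all states in the
kernel. So `h` is almost surely `0` or `1`, and `Q` is the effect of the event `h = 1`. -/
theorem mem_deterministicProjections (hσ : ∀ A : H →L[ℂ] H, Measurable fun l => trace (A ∘L (σ l).op))
    (hQ : IsStarProjection Q)
    (h : ∀ ρ : State H, trace (ρ.op ∘L Q) = ∫ l, trace (Q ∘L (σ l).op) ∂(G.distribution ρ)) :
    Q ∈ deterministicProjections G σ := by
  let r : G.Ω → ℝ := fun l => (trace (Q ∘L (σ l).op)).re
  have hr : Measurable r := Complex.measurable_re.comp (hσ Q)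
  have hQ0 : 0 ≤ Q := hQ.nonneg
  have hQ1 : 0 ≤ 1 - Q := hQ.one_sub.nonneg
  have ht : ∀ l, 0 ≤ trace (Q ∘L (σ l).op) := fun l => by
    rw [trace_comp_comm (σ l).mem]
    exact trace_comp_nonneg (σ l).mem (σ l).nonneg hQ0
  have htr : ∀ l, trace (Q ∘L (σ l).op) = r l := fun l =>
    Complex.ext rfl (Complex.nonneg_iff.1 (ht l)).2.symm
  have hr0 : ∀ l, 0 ≤ r l := fun l => (Complex.nonneg_iff.1 (ht l)).1
  have hr1 : ∀ l, 0 ≤ 1 - r l := fun l => by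
    have h1 := trace_comp_nonneg (σ l).mem (σ l).nonneg hQ1
    have h2 : trace ((σ l).op ∘L (1 : H →L[ℂ] H)) = 1 := (σ l).trace_eq
    rw [trace_comp_sub (σ l).mem, h2, ← trace_comp_comm (σ l).mem, htr] at h1
    exact_mod_cast h1
  have hint : ∀ ρ : State H, trace (ρ.op ∘L Q) = ((∫ l, r l ∂(G.distribution ρ) : ℝ) : ℂ) :=
    fun ρ => by
      rw [h ρ, ← integral_complex_ofReal]
      simp only [htr]
  have hri : ∀ ρ : State H, Integrable r (G.distribution ρ) := fun ρ => by
    have := G.distribution_prob ρ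
    refine Integrable.of_bound (C := 1) hr.aestronglyMeasurable (Eventually.of_forall fun l => ?_)
    rw [Real.norm_of_nonneg (hr0 l)]
    linarith [hr1 l]
  have hQQ : ∀ x, Q (Q x) = Q x := fun x => DFunLike.congr_fun hQ.isIdempotentElem x
  have hPP : ∀ x, (1 - Q) ((1 - Q) x) = (1 - Q) x := fun x =>
    DFunLike.congr_fun hQ.one_sub.isIdempotentElem x
  let B : Set G.Ω := {l | r l = 1}
  let C : Set G.Ω := {l | r l ≠ 0}
  have hB : MeasurableSet B := hr (measurableSet_singleton 1)
  have hC : MeasurableSet C := (hr (measurableSet_singleton 0)).compl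
  have hBQ : G.eff Bᶜ ∘L Q = 0 := POVM.eff_comp_eq_zero hQQ hB.compl fun y hy hQy => by
    have := G.distribution_prob (.pure y hy)
    have h1 := hint (.pure y hy)
    rw [State.pure_op, trace_rankOne_comp, hQy, inner_self_eq_norm_sq_to_K, hy] at h1
    have h2 : ∫ l, r l ∂(G.distribution (.pure y hy)) = 1 := by
      have : ((∫ l, r l ∂(G.distribution (.pure y hy)) : ℝ) : ℂ) = 1 := by rw [← h1]; simp
      exact_mod_cast this
    have h3 : ∫ l, (1 - r l) ∂(G.distribution (.pure y hy)) = 0 := by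
      rw [integral_sub (integrable_const _) (hri _), h2]
      simp
    rw [integral_eq_zero_iff_of_nonneg hr1 ((integrable_const _).sub (hri _))] at h3
    refine measure_mono_null (fun l hl => ?_) (ae_iff.1 h3)
    exact fun h4 => hl (sub_eq_zero.1 h4).symm
  have hCQ : G.eff C ∘L (1 - Q) = 0 := POVM.eff_comp_eq_zero hPP hC fun y hy hQy => by
    have h1 := hint (.pure y hy)
    have hQy' : Q y = 0 := by simpa using hQy
    rw [State.pure_op, trace_rankOne_comp, hQy', inner_zero_right] at h1
    have h2 : ∫ l, r l ∂(G.distribution (.pure y hy)) = 0 := by exact_mod_cast h1.symm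
    rw [integral_eq_zero_iff_of_nonneg hr0 (hri _)] at h2
    exact ae_iff.1 h2
  have hBC : B ⊆ C := fun l hl => by
    change r l ≠ 0
    rw [show r l = 1 from hl]
    exact one_ne_zero
  have hBQ' : G.eff B ∘L (1 - Q) = 0 :=
    comp_eq_zero_of_le (G.eff_nonneg hB) (POVM.eff_mono hB hC hBC) hCQ
  have hN : G.eff (C \ B) = 0 := by
    have hm := hC.diff hB
    have h1 := comp_eq_zero_of_le (G.eff_nonneg hm)
      (POVM.eff_mono hm hC Set.sdiff_subset) hCQ
    have h2 := comp_eq_zero_of_le (G.eff_nonneg hm)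
      (POVM.eff_mono hm hB.compl fun l hl => hl.2) hBQ
    rw [ContinuousLinearMap.comp_sub, h2, sub_zero] at h1
    exact h1
  refine ⟨hQ, B, hB, ?_, fun ρ => ?_⟩
  · rw [ContinuousLinearMap.comp_sub, sub_eq_zero] at hBQ'
    rw [G.eff_compl hB, ContinuousLinearMap.sub_comp, sub_eq_zero] at hBQ
    exact hBQ'.trans hBQ.symm
  · have h0 := POVM.distribution_eq_zero (hC.diff hB) hN ρ
    filter_upwards [measure_eq_zero_iff_ae_notMem.1 h0] with l hl
    refine ⟨fun hlB => (σ l).comp_eq_self hQ ?_, fun hlB =>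
      comp_eq_zero_of_trace_eq_zero (σ l).mem (σ l).nonneg hQ ?_⟩
    · rw [← trace_comp_comm (σ l).mem, htr, show r l = 1 from hlB, Complex.ofReal_one]
    · have h1 : r l = 0 := by
        by_contra h2
        exact hl ⟨h2, hlB⟩
      rw [← trace_comp_comm (σ l).mem, htr, h1, Complex.ofReal_zero]

theorem one_mem_deterministicProjections : 1 ∈ deterministicProjections G σ :=
  ⟨.one _, Set.univ, .univ, G.eff_univ, fun _ => Eventually.of_forall fun _ =>
    ⟨fun _ => rfl, fun hl => (hl trivial).elim⟩⟩

theorem one_sub_mem_deterministicProjections (hQ : Q ∈ deterministicProjections G σ) :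
    1 - Q ∈ deterministicProjections G σ := by
  obtain ⟨hQ, B, hB, hBQ, h⟩ := hQ
  refine ⟨hQ.one_sub, Bᶜ, hB.compl, by rw [G.eff_compl hB, hBQ], fun ρ => ?_⟩
  filter_upwards [h ρ] with l hl
  have h1 : (σ l).op ∘L (1 - Q) = (σ l).op - (σ l).op ∘L Q := ContinuousLinearMap.comp_sub _ _ _
  refine ⟨fun hlB => ?_, fun hlB => ?_⟩
  · rw [h1, hl.2 hlB, sub_zero]
  · rw [h1, hl.1 (not_not.1 hlB), sub_self]

/-- If `G(C)` is a projection, then `G(B ∩ C)` is the product `G(B) G(C)`. -/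
theorem POVM.eff_inter_of_isStarProjection {B C : Set G.Ω} (hB : MeasurableSet B)
    (hC : MeasurableSet C) (hPC : IsStarProjection (G.eff C)) :
    G.eff (B ∩ C) = G.eff B * G.eff C := by
  have h1 : G.eff (B ∩ C) + G.eff (B \ C) = G.eff B := by
    rw [← G.eff_union (hB.inter hC) (hB.diff hC)
      (Set.disjoint_sdiff_inter.symm), Set.inter_union_sdiff]
  have h2 : G.eff (B \ C) ∘L G.eff C = 0 :=
    comp_eq_zero_of_le (G.eff_nonneg (hB.diff hC))
      (POVM.eff_mono (hB.diff hC) hC.compl fun l hl => hl.2) (by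
        rw [G.eff_compl hC]
        exact hPC.one_sub_mul_self)
  have h3 : G.eff (B ∩ C) ∘L (1 - G.eff C) = 0 :=
    comp_eq_zero_of_le (G.eff_nonneg (hB.inter hC))
      (POVM.eff_mono (hB.inter hC) hC Set.inter_subset_right) hPC.mul_one_sub_self
  rw [ContinuousLinearMap.comp_sub, sub_eq_zero] at h3
  rw [← h1, add_mul]
  refine h3.trans ?_
  exact (add_zero _).symm.trans (congrArg₂ _ rfl h2.symm)

theorem commute_of_deterministic (hQ : Q ∈ deterministicProjections G σ)
    (hP : P ∈ deterministicProjections G σ) : Commute Q P := by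
  obtain ⟨hQ, B, hB, rfl, -⟩ := hQ
  obtain ⟨hP, C, hC, rfl, -⟩ := hP
  exact (POVM.eff_inter_of_isStarProjection hB hC hP).symm.trans
    (Set.inter_comm B C ▸ POVM.eff_inter_of_isStarProjection hC hB hQ)

theorem mul_mem_deterministicProjections (hQ : Q ∈ deterministicProjections G σ)
    (hP : P ∈ deterministicProjections G σ) : Q * P ∈ deterministicProjections G σ := by
  have hcomm := commute_of_deterministic hQ hP
  obtain ⟨hQ, B, hB, rfl, h1⟩ := hQ
  obtain ⟨hP, C, hC, rfl, h2⟩ := hP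
  refine ⟨hQ.mul hP hcomm, B ∩ C, hB.inter hC,
    POVM.eff_inter_of_isStarProjection hB hC hP, fun ρ => ?_⟩
  filter_upwards [h1 ρ, h2 ρ] with l hl1 hl2
  have h : (σ l).op ∘L (G.eff B * G.eff C) = ((σ l).op ∘L G.eff B) ∘L G.eff C := rfl
  refine ⟨fun hl => by rw [h, hl1.1 hl.1, hl2.1 hl.2], fun hl => ?_⟩
  by_cases hlB : l ∈ B
  · rw [h, hl1.1 hlB, hl2.2 fun hlC => hl ⟨hlB, hlC⟩]
  · rw [h, hl1.2 hlB, ContinuousLinearMap.zero_comp]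

/-- The weak integral of a bounded weakly measurable family of operators. -/
theorem exists_inner_eq_integral {Ω : Type*} [MeasurableSpace Ω] (μ : Measure Ω)
    [IsProbabilityMeasure μ] {T : Ω → H →L[ℂ] H} (hT : ∀ u v, Measurable fun l => ⟪u, T l v⟫_ℂ)
    (hb : ∀ l, ‖T l‖ ≤ 1) :
    ∃ S : H →L[ℂ] H, ∀ u v, ⟪u, S v⟫_ℂ = ∫ l, ⟪u, T l v⟫_ℂ ∂μ := by
  have hbd : ∀ u v l, ‖⟪u, T l v⟫_ℂ‖ ≤ ‖u‖ * ‖v‖ := fun u v l => by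
    refine (norm_inner_le_norm _ _).trans (mul_le_mul_of_nonneg_left ?_ (norm_nonneg _))
    exact ((T l).le_of_opNorm_le (hb l) v).trans_eq (one_mul _)
  have hi : ∀ u v, Integrable (fun l => ⟪u, T l v⟫_ℂ) μ := fun u v =>
    Integrable.of_bound (hT u v).aestronglyMeasurable (‖u‖ * ‖v‖) (Eventually.of_forall (hbd u v))
  let F : H →ₗ⋆[ℂ] H →ₗ[ℂ] ℂ := LinearMap.mk₂'ₛₗ (starRingEnd ℂ) (RingHom.id ℂ)
    (fun u v => ∫ l, ⟪u, T l v⟫_ℂ ∂μ)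
    (fun u u' v => by simp only [inner_add_left]; exact integral_add (hi u v) (hi u' v))
    (fun c u v => by simp only [inner_smul_left]; exact integral_const_mul _ _)
    (fun u v v' => by
      simp only [map_add, inner_add_right]; exact integral_add (hi u v) (hi u v'))
    (fun c u v => by simp only [map_smul, inner_smul_right]; exact integral_const_mul _ _)
  let F' : H →L⋆[ℂ] H →L[ℂ] ℂ := F.mkContinuous₂ 1 fun u v => by
    rw [one_mul]
    refine (norm_integral_le_of_norm_le_const (Eventually.of_forall (hbd u v))).trans ?_
    simp
  refine ⟨(continuousLinearMapOfBilin F').adjoint, fun u v => ?_⟩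
  rw [ContinuousLinearMap.adjoint_inner_right, continuousLinearMapOfBilin_apply]
  rfl

theorem exists_countable_hilbertBasis [TopologicalSpace.SeparableSpace H] :
    ∃ (s : Set H) (_ : Countable s), Nonempty (HilbertBasis s ℂ H) := by
  obtain ⟨s, b, hb⟩ := exists_hilbertBasis ℂ H
  have h : Orthonormal ℂ ((↑) : s → H) := hb ▸ b.orthonormal
  exact ⟨s, (Orthonormal.countable_of_separable h).to_subtype, ⟨b⟩⟩

/-- The mean of a weakly measurable family of states. -/
theorem exists_state_integral [TopologicalSpace.SeparableSpace H] {Ω : Type*} [MeasurableSpace Ω]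
    (μ : Measure Ω) [IsProbabilityMeasure μ] {τ : Ω → State H}
    (hτ : ∀ u v, Measurable fun l => ⟪u, (τ l).op v⟫_ℂ) :
    ∃ S : State H, ∀ u v, ⟪u, S.op v⟫_ℂ = ∫ l, ⟪u, (τ l).op v⟫_ℂ ∂μ := by
  have hb : ∀ l, ‖(τ l).op‖ ≤ 1 := fun l => by
    simpa [(τ l).trace_eq] using norm_le_re_trace (τ l).mem (τ l).nonneg
  obtain ⟨S, hS⟩ := exists_inner_eq_integral μ hτ hb
  let r : H → Ω → ℝ := fun u l => (⟪u, (τ l).op u⟫_ℂ).re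
  have hr : ∀ u l, ⟪u, (τ l).op u⟫_ℂ = r u l := fun u l =>
    Complex.ext rfl (Complex.nonneg_iff.1 ((τ l).inner_nonneg u)).2.symm
  have hr0 : ∀ u l, 0 ≤ r u l := fun u l => (Complex.nonneg_iff.1 ((τ l).inner_nonneg u)).1
  have hSr : ∀ u, ⟪u, S u⟫_ℂ = ((∫ l, r u l ∂μ : ℝ) : ℂ) := fun u => by
    rw [hS, ← integral_complex_ofReal]
    simp only [hr]
  have hS0 : 0 ≤ S := nonneg_iff_forall_inner.2 fun u => by
    rw [hSr]
    exact_mod_cast integral_nonneg (hr0 u)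
  obtain ⟨s, hs, ⟨b⟩⟩ := exists_countable_hilbertBasis (H := H)
  have hsum : ∀ l, HasSum (fun i => r (b i) l) 1 := fun l => by
    have h := Complex.hasSum_re (hasSum_trace_self (τ l).mem b)
    rwa [(τ l).trace_eq] at h
  have hri : ∀ u, Integrable (r u) μ := fun u =>
    Integrable.of_bound (Complex.measurable_re.comp (hτ u u)).aestronglyMeasurable (‖u‖ * ‖u‖)
      (Eventually.of_forall fun l => by
        refine (Complex.abs_re_le_norm _).trans ((norm_inner_le_norm _ _).trans
          (mul_le_mul_of_nonneg_left ?_ (norm_nonneg _)))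
        exact ((τ l).op.le_of_opNorm_le (hb l) u).trans_eq (one_mul _))
  have hsumm : Summable fun i => ∫ l, ‖r (b i) l‖ ∂μ := by
    -- a finite part of the diagonal sum of a state is at most one
    refine summable_of_sum_le (c := 1) (fun i => integral_nonneg fun l => norm_nonneg _)
      fun t => ?_
    rw [← integral_finsetSum _ fun i _ => (hri (b i)).norm]
    have h1 : ∫ _l, (1 : ℝ) ∂μ = 1 := by simp
    refine (integral_mono (integrable_finsetSum _ fun i _ => (hri (b i)).norm)
      (integrable_const 1) fun l => ?_).trans_eq h1
    simp only [Real.norm_of_nonneg (hr0 _ l)]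
    exact sum_le_hasSum t (fun i _ => hr0 _ l) (hsum l)
  have h := hasSum_integral_of_summable_integral_norm (fun i => hri (b i)) hsumm
  simp only [fun l => (hsum l).tsum_eq] at h
  have h1 : HasSum (fun i => ⟪b i, S (b i)⟫_ℂ) 1 := by
    simp only [hSr]
    simpa using Complex.hasSum_ofReal.2 h
  have hm := mem_traceClass_of_nonneg hS0 b h1.summable
  exact ⟨.ofTrace S hS0 hm ((hasSum_trace_self hm b).unique h1), hS⟩

theorem isCompactlyModelled_deterministicProjections [TopologicalSpace.SeparableSpace H]
    (hσ : ∀ A : H →L[ℂ] H, Measurable fun l => trace (A ∘L (σ l).op)) :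
    IsCompactlyModelled (deterministicProjections G σ) where
  proj _ hQ := hQ.1
  comm _ hQ _ hP := commute_of_deterministic hQ hP
  one_mem := one_mem_deterministicProjections
  compl_mem _ hQ := one_sub_mem_deterministicProjections hQ
  mul_mem _ hQ _ hP := mul_mem_deterministicProjections hQ hP
  model x hx := by
    have hprob := G.distribution_prob (.pure x hx)
    have hm : ∀ u v, Measurable fun l => ⟪u, (σ l).op v⟫_ℂ := fun u v => by
      simpa only [trace_rankOne_comp] using hσ (rankOne ℂ v u)
    obtain ⟨S, hS⟩ := exists_state_integral (G.distribution (.pure x hx)) hm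
    refine ⟨S.op, S.nonneg, isCompactOperator_of_nonneg S.nonneg S.mem, fun h => ?_,
      fun Q hQ => ?_, fun Q hQ v hv hQv => ?_⟩
    · have h1 := S.trace_eq
      rw [h] at h1
      simp [trace] at h1
    · obtain ⟨hQ, B, hB, -, h⟩ := hQ
      have hQs : ∀ a c, ⟪Q a, c⟫_ℂ = ⟪a, Q c⟫_ℂ := fun a c => by
        rw [← ContinuousLinearMap.adjoint_inner_left, hQ.isSelfAdjoint.adjoint_eq]
      ext v
      refine ext_inner_left ℂ fun u => ?_
      simp only [mul_apply_eq_comp]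
      rw [← hQs, hS, hS]
      refine integral_congr_ae ?_
      filter_upwards [h (.pure x hx)] with l hl
      have hσs : ∀ a c, ⟪(σ l).op a, c⟫_ℂ = ⟪a, (σ l).op c⟫_ℂ := fun a c => by
        rw [← ContinuousLinearMap.adjoint_inner_left,
          (IsSelfAdjoint.of_nonneg (σ l).nonneg).adjoint_eq]
      rw [← hσs]
      change ⟪((σ l).op ∘L Q) u, v⟫_ℂ = ⟪u, ((σ l).op ∘L Q) v⟫_ℂ
      by_cases hlB : l ∈ B
      · rw [hl.1 hlB, hσs]
      · simp [hl.2 hlB]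
    · obtain ⟨hQ, B, hB, rfl, h⟩ := hQ
      have h1 := G.trace_eff (.pure x hx) hB
      rw [State.pure_op, trace_rankOne_comp] at h1
      rw [h1, Complex.ofReal_re, hS]
      have hre : ∀ l, ⟪v, (σ l).op v⟫_ℂ = ((⟪v, (σ l).op v⟫_ℂ).re : ℂ) := fun l =>
        Complex.ext rfl (Complex.nonneg_iff.1 ((σ l).inner_nonneg v)).2.symm
      rw [integral_congr_ae (Eventually.of_forall hre), integral_complex_ofReal, Complex.ofReal_re,
        ← integral_indicator_one hB]
      refine integral_mono_of_nonneg
        (Eventually.of_forall fun l => (Complex.nonneg_iff.1 ((σ l).inner_nonneg v)).1)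
        ((integrable_const 1).indicator hB) ?_
      filter_upwards [h (.pure x hx)] with l hl
      have h2 := (Complex.le_def.1 (inner_le_trace (σ l).mem (σ l).nonneg hQ hv hQv)).1
      by_cases hlB : l ∈ B
      · rw [hl.1 hlB, (σ l).trace_eq] at h2
        rwa [Set.indicator_of_mem hlB]
      · rw [hl.2 hlB] at h2
        rw [Set.indicator_of_notMem hlB]
        exact h2.trans_eq (by simp [trace])

theorem IsContextualityNonConfirming.exists_hilbertBasis [TopologicalSpace.SeparableSpace H]
    {𝓜 : Set (POVM.{u, w} H)} (h𝓜 : ∀ P ∈ 𝓜, P.IsPVM) (h : IsContextualityNonConfirming 𝓜) :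
    ∃ (ι : Type) (_ : Countable ι) (b : HilbertBasis ι ℂ H),
      ∀ i, IsJointEigenvector (effects 𝓜) (b i) := by
  obtain ⟨G, σ, hσ, h⟩ := h
  obtain ⟨ι, hι, b, hb⟩ := (isCompactlyModelled_deterministicProjections hσ).exists_hilbertBasis
  refine ⟨ι, hι, b, fun i E hE => hb i E ?_⟩
  obtain ⟨M, hM, X, hX, rfl⟩ := hE
  exact mem_deterministicProjections hσ (h𝓜 M hM X hX) fun ρ => h M hM ρ X hX

end Contextuality
/-! ### The pinching is entanglement breaking -/

section PinchingEB

open InnerProductSpace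

variable {H : Type u} [NormedAddCommGroup H] [InnerProductSpace ℂ H] [CompleteSpace H]

/-- If `A` and `B` are positive with orthogonal ranges, then `A` and `B` are the positive and the
negative part of `A - B`. -/
theorem abs_sub_of_comp_eq_zero {A B : H →L[ℂ] H} (hA : 0 ≤ A) (hB : 0 ≤ B) (h : A * B = 0) :
    CFC.abs (A - B) = A + B := by
  have hA' : star A = A := (IsSelfAdjoint.of_nonneg hA).star_eq
  have hB' : star B = B := (IsSelfAdjoint.of_nonneg hB).star_eq
  have h' : B * A = 0 := by
    have h1 := congrArg star h
    rwa [star_mul, hA', hB', star_zero] at h1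
  refine CFC.sqrt_unique ?_ (add_nonneg hA hB)
  rw [star_sub, hA', hB']
  simp only [mul_add, add_mul, mul_sub, sub_mul, h, h']
  abel

theorem trace_add {A B : H →L[ℂ] H} (hA : A ∈ TraceClass H) (hB : B ∈ TraceClass H) :
    trace (A + B) = trace A + trace B :=
  trace_add_comp hA hB 1

theorem traceNorm_sub_of_comp_eq_zero {A B : H →L[ℂ] H} (hA : 0 ≤ A) (hB : 0 ≤ B)
    (hA' : A ∈ TraceClass H) (hB' : B ∈ TraceClass H) (h : A * B = 0) :
    traceNorm (A - B) = ENNReal.ofReal (trace A + trace B).re := by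
  have hs := Complex.hasSum_re (hasSum_trace_self (add_mem hA' hB') (stdBasis H))
  rw [traceNorm, abs_sub_of_comp_eq_zero hA hB h, ← ENNReal.ofReal_tsum_of_nonneg
    (fun i => (Complex.nonneg_iff.1 (nonneg_iff_forall_inner.1 (add_nonneg hA hB) _)).1)
    hs.summable, hs.tsum_eq, trace_add hA' hB']

section Mixture

variable {ι : Type*} {t : ι → ℝ} {π : ι → State H}

/-- Countable mixtures of states are states. -/
theorem exists_state_hasSum (ht : ∀ i, 0 ≤ t i) (h1 : HasSum t 1) (π : ι → State H) :
    ∃ τ : State H, HasSum (fun i => t i • (π i).op) τ.op := by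
  have hn : ∀ i, ‖(π i).op‖ ≤ 1 := fun i => by
    simpa [(π i).trace_eq] using norm_le_re_trace (π i).mem (π i).nonneg
  have hs : Summable fun i => t i • (π i).op := by
    refine Summable.of_norm_bounded h1.summable fun i => ?_
    rw [norm_smul, Real.norm_of_nonneg (ht i)]
    exact mul_le_of_le_one_right (ht i) (hn i)
  let T : H →L[ℂ] H := ∑' i, t i • (π i).op
  have hin : ∀ x, HasSum (fun i => (t i : ℂ) * ⟪x, (π i).op x⟫_ℂ) ⟪x, T x⟫_ℂ := fun x => by
    refine (hasSum_inner_comp hs.hasSum 1 x x).congr_fun fun i => ?_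
    simp
  have hT : 0 ≤ T := nonneg_iff_forall_inner.2 fun x => (hin x).nonneg fun i =>
    mul_nonneg (by exact_mod_cast ht i) ((π i).inner_nonneg x)
  have htr : HasSum (fun j => ⟪stdBasis H j, T (stdBasis H j)⟫_ℂ) 1 := by
    let r : ι → BasisIndex H → ℝ := fun i j => (⟪stdBasis H j, (π i).op (stdBasis H j)⟫_ℂ).re
    have hr : ∀ i j, ⟪stdBasis H j, (π i).op (stdBasis H j)⟫_ℂ = r i j := fun i j =>
      Complex.ext rfl (Complex.nonneg_iff.1 ((π i).inner_nonneg _)).2.symm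
    let g : ι × BasisIndex H → ℝ := fun p => t p.1 * r p.1 p.2
    have hrow : ∀ i, HasSum (fun j => g (i, j)) (t i) := fun i => by
      have h := (Complex.hasSum_re (π i).hasSum_one).mul_left (t i)
      rwa [Complex.one_re, mul_one] at h
    have hg0 : 0 ≤ g := fun p =>
      mul_nonneg (ht _) (Complex.nonneg_iff.1 ((π p.1).inner_nonneg _)).1
    have hg : Summable g := (summable_prod_of_nonneg hg0).2
      ⟨fun i => (hrow i).summable, by simpa only [(hrow _).tsum_eq] using h1.summable⟩
    have hg1 : HasSum g 1 := (hg.hasSum.prod_fiberwise hrow).unique h1 ▸ hg.hasSum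
    have hgC := Complex.hasSum_ofReal.2 ((Equiv.prodComm (BasisIndex H) ι).hasSum_iff.2 hg1)
    rw [Complex.ofReal_one] at hgC
    refine hgC.prod_fiberwise fun j => (hin (stdBasis H j)).congr_fun fun i => ?_
    rw [hr, ← Complex.ofReal_mul]
    rfl
  exact ⟨⟨T, hT, htr⟩, hs.hasSum⟩

/-- A countable mixture of mutually orthogonal states is the trace-norm limit of its finite
sub-mixtures, renormalised by adding the missing weight to one of the components. -/
theorem exists_mem_convexHull_traceNorm_lt (ht : ∀ i, 0 ≤ t i) (h1 : HasSum t 1)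
    (horth : ∀ i j, i ≠ j → (π i).op * (π j).op = 0) {τ : State H}
    (hτ : HasSum (fun i => t i • (π i).op) τ.op) {ε : ℝ≥0∞} (hε : 0 < ε) :
    ∃ S ∈ convexHull ℝ (Set.range fun i => (π i).op), traceNorm (τ.op - S) < ε := by
  classical
  obtain ⟨r, hr0, hrε⟩ := ENNReal.lt_iff_exists_nnreal_btwn.1 hε
  have hr0' : (0 : ℝ) < r := by exact_mod_cast hr0
  obtain ⟨s, hs⟩ := (h1.eventually_const_lt
    (show 1 - min (r : ℝ) 1 / 2 < 1 by linarith [lt_min hr0' one_pos])).exists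
  have hmin1 := min_le_left (r : ℝ) 1
  have hmin2 := min_le_right (r : ℝ) 1
  set δ : ℝ := 1 - ∑ i ∈ s, t i with hδ
  have hδ0 : 0 ≤ δ := sub_nonneg.2 (sum_le_hasSum s (fun i _ => ht i) h1)
  obtain ⟨k, hk⟩ : s.Nonempty := by
    by_contra hne
    rw [Finset.not_nonempty_iff_eq_empty.1 hne, Finset.sum_empty] at hs
    linarith
  let A : H →L[ℂ] H := τ.op - ∑ i ∈ s, t i • (π i).op
  let B : H →L[ℂ] H := δ • (π k).op
  have hreal : ∀ (a : ℝ) (T : H →L[ℂ] H), a • T = (a : ℂ) • T := fun a T =>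
    (Complex.coe_smul a T).symm
  have hmem : ∀ (a : ℝ) (ρ : State H), a • ρ.op ∈ TraceClass H := fun a ρ => by
    rw [hreal]
    exact Submodule.smul_mem _ _ ρ.mem
  have htr : ∀ (a : ℝ) (ρ : State H), trace (a • ρ.op) = a := fun a ρ => by
    rw [hreal, trace_smul, ρ.trace_eq, mul_one]
  have hpos : ∀ i, 0 ≤ t i • (π i).op := fun i => smul_nonneg (ht i) (π i).nonneg
  have hA0 : 0 ≤ A := sub_nonneg.2 (sum_le_hasSum s (fun i _ => hpos i) hτ)
  have hB0 : 0 ≤ B := smul_nonneg hδ0 (π k).nonneg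
  have hsm : ∑ i ∈ s, t i • (π i).op ∈ TraceClass H := sum_mem fun i _ => hmem _ _
  have hAm : A ∈ TraceClass H := sub_mem τ.mem hsm
  have hAk : A * (π k).op = 0 := by
    have e1 := hτ.mul_right (π k).op
    have e2 : ∀ i, i ≠ k → t i • (π i).op * (π k).op = 0 := fun i hi => by
      rw [smul_mul_assoc, horth i k hi, smul_zero]
    have e3 := e1.unique (hasSum_single k e2)
    rw [sub_mul, e3, Finset.sum_mul, Finset.sum_eq_single_of_mem k hk fun i _ hi => e2 i hi,
      sub_self]
  have hAB : A * B = 0 := by rw [mul_smul_comm, hAk, smul_zero]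
  have hsum_tr : ∀ u : Finset ι, trace (∑ i ∈ u, t i • (π i).op) = ∑ i ∈ u, (t i : ℂ) := fun u => by
    induction u using Finset.induction_on with
    | empty => simp [trace]
    | insert i u hi ih =>
      rw [Finset.sum_insert hi, Finset.sum_insert hi,
        trace_add (hmem _ _) (sum_mem fun i _ => hmem _ _), htr, ih]
  have hA1 : trace A = δ := by
    have h := trace_add hAm hsm
    rw [sub_add_cancel, τ.trace_eq, hsum_tr] at h
    rw [hδ, Complex.ofReal_sub, Complex.ofReal_sum, Complex.ofReal_one, h, add_sub_cancel_right]
  refine ⟨∑ i ∈ s, (t i + if i = k then δ else 0) • (π i).op, ?_, ?_⟩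
  · refine (convex_convexHull ℝ _).sum_mem (fun i _ => ?_) ?_ fun i _ =>
      subset_convexHull ℝ _ ⟨i, rfl⟩
    · have := ht i
      split_ifs <;> linarith
    · rw [Finset.sum_add_distrib, Finset.sum_ite_eq' s k, if_pos hk]
      linarith
  · have hS : τ.op - ∑ i ∈ s, (t i + if i = k then δ else 0) • (π i).op = A - B := by
      simp only [add_smul, Finset.sum_add_distrib, ite_smul, zero_smul, Finset.sum_ite_eq', if_pos hk,
        A, B]
      abel
    rw [hS, traceNorm_sub_of_comp_eq_zero hA0 hB0 hAm (hmem _ _) hAB, hA1, htr,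
      ← Complex.ofReal_add, Complex.ofReal_re]
    refine lt_of_le_of_lt ?_ hrε
    rw [← ENNReal.ofReal_coe_nnreal]
    exact ENNReal.ofReal_le_ofReal (by linarith)

end Mixture

section Product

variable {K : Type v} [NormedAddCommGroup K] [InnerProductSpace ℂ K] [CompleteSpace K]

/-- The product of two states. -/
def State.tensor (α : State K) (β : State H) : State (HTensor K H) :=
  have h : HasSum (fun p : BasisIndex K × BasisIndex H =>
      ⟪prodBasis (stdBasis K) (stdBasis H) p,
        tensorOp α.op β.op (prodBasis (stdBasis K) (stdBasis H) p)⟫_ℂ) 1 := by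
    simp only [prodBasis_apply, tensorOp_htmul, inner_htmul]
    have hs := summable_mul_of_summable_norm α.hasSum_one.summable.norm β.hasSum_one.summable.norm
    simpa using α.hasSum_one.mul β.hasSum_one hs
  have h0 := tensorOp_nonneg α.nonneg β.nonneg
  have hm := mem_traceClass_of_nonneg h0 _ h.summable
  .ofTrace (tensorOp α.op β.op) h0 hm ((hasSum_trace_self hm _).unique h)

theorem State.nontrivial (ρ : State H) : Nontrivial H := by
  by_contra h
  rw [not_nontrivial_iff_subsingleton] at h
  have h1 := ρ.trace_eq
  have h2 : ρ.op = 0 := by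
    ext x
    exact Subsingleton.elim _ _
  rw [h2] at h1
  simp [trace] at h1

theorem nontrivial_left_of_htensor [h : Nontrivial (HTensor K H)] : Nontrivial K := by
  by_contra hK
  rw [not_nontrivial_iff_subsingleton] at hK
  have h1 : (1 : HTensor K H →L[ℂ] HTensor K H) = 0 := clm_ext_htmul fun x y => by
    have hx : htmul x y = 0 := by
      rw [Subsingleton.elim x (0 : K), ← tensorRight_apply, map_zero]
    rw [hx, map_zero, map_zero]
  obtain ⟨ξ, hξ⟩ := exists_ne (0 : HTensor K H)
  exact hξ (DFunLike.congr_fun h1 ξ)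

/-- Pinching the second factor of a state of `K ⊗ H` gives a countable mixture of orthogonal
product states `αᵢ ⊗ |bᵢ⟩⟨bᵢ|`, which is separable. -/
theorem pinchChannel_isEntanglementBreaking {ι : Type*} (b : HilbertBasis ι ℂ H) :
    (pinchChannel b).IsEntanglementBreaking := by
  classical
  refine ⟨pinchₗ b, pinchChannel_isHeisenbergDual b, ?_⟩
  intro K _ _ _ _ ω
  have := ω.nontrivial
  have : Nontrivial K := nontrivial_left_of_htensor (H := H)
  have : Nonempty (State K) := State.nonempty_of_nontrivial
  let ωb : ι → K →L[ℂ] K := fun i => (tensorRight (K := K) (b i)).adjoint ∘L ω.op ∘L tensorRight (b i)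
  have hω0 : ∀ i, 0 ≤ ωb i := fun i => tensorRight_adjoint_comp_nonneg ω.nonneg (b i)
  have hωm : ∀ i, ωb i ∈ TraceClass K := fun i => tensorRight_adjoint_comp_mem ω.mem ω.nonneg (b i)
  choose α hα using fun i => exists_state_smul (hω0 i) (hωm i)
  have htr0 : ∀ i, 0 ≤ trace (ωb i) := fun i =>
    trace_comp_nonneg (hωm i) (hω0 i) (A := 1) zero_le_one
  let t : ι → ℝ := fun i => (trace (ωb i)).re
  have ht : ∀ i, 0 ≤ t i := fun i => (Complex.nonneg_iff.1 (htr0 i)).1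
  have htC : ∀ i, trace (ωb i) = t i := fun i =>
    Complex.ext rfl (Complex.nonneg_iff.1 (htr0 i)).2.symm
  have ht1 : HasSum t 1 := by
    have h := Complex.hasSum_re (hasSum_trace_tensorRight ω.mem ω.nonneg b)
    rwa [ω.trace_eq] at h
  let π : ι → State (HTensor K H) := fun i => (α i).tensor (.pure (b i) (norm_basis b i))
  obtain ⟨τ, hτ⟩ := exists_state_hasSum ht ht1 π
  have horth : ∀ i j, i ≠ j → (π i).op * (π j).op = 0 := fun i j hij => by
    have h1 : rankOne ℂ (b i) (b i) ∘L rankOne ℂ (b j) (b j) = 0 := by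
      ext x
      simp [basis_inner, hij]
    refine (tensorOp_comp _ _ _ _).trans ?_
    rw [State.pure_op, State.pure_op, h1]
    exact clm_ext_htmul fun x y => by
      rw [tensorOp_htmul, zero_apply, zero_apply, ← tensorLeft_apply, map_zero]
  have hτb : ∀ i x x' y, ⟪htmul x (b i), τ.op (htmul x' y)⟫_ℂ =
      ⟪b i, y⟫_ℂ * ⟪htmul x (b i), ω.op (htmul x' (b i))⟫_ℂ := fun i x x' y => by
    have h1 := hasSum_inner_comp hτ 1 (htmul x (b i)) (htmul x' y)
    have h2 : ∀ k, ⟪htmul x (b i), (t k • (π k).op) (htmul x' y)⟫_ℂ =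
        if k = i then ⟪b i, y⟫_ℂ * ⟪x, ωb i x'⟫_ℂ else 0 := fun k => by
      have h3 : (t k • (π k).op) = tensorOp (ωb k) (rankOne ℂ (b k) (b k)) := by
        rw [hα k, htC, ← Complex.coe_smul]
        refine clm_ext_htmul fun x y => ?_
        change (t k : ℂ) • tensorOp (α k).op (rankOne ℂ (b k) (b k)) (htmul x y) = _
        rw [tensorOp_htmul, tensorOp_htmul, smul_apply, htmul_smul_left]
      rw [h3, tensorOp_htmul, inner_htmul, rankOne_apply, inner_smul_right, basis_inner]
      split_ifs with h4 h5 h5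
      · subst h4; ring
      · exact absurd h4.symm h5
      · exact absurd h5.symm h4
      · ring
    have h4 := h1.unique ((hasSum_ite_eq i _).congr_fun h2)
    rw [one_apply_eq_self] at h4
    rw [h4, inner_tensorRight_adjoint_comp]
  refine ⟨τ, fun ε hε => ?_, fun A B => ?_⟩
  · obtain ⟨S, hS, hSε⟩ := exists_mem_convexHull_traceNorm_lt ht ht1 horth hτ hε
    refine ⟨S, convexHull_mono ?_ hS, hSε⟩
    rintro _ ⟨i, rfl⟩
    exact ⟨(α i, .pure (b i) (norm_basis b i)), rfl⟩
  · refine (hasSum_trace_comp τ.mem (prodBasis (stdBasis K) b) _).unique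
      ((hasSum_trace_comp ω.mem (prodBasis (stdBasis K) b) _).congr_fun fun p => ?_)
    rw [prodBasis_apply, tensorOp_htmul, tensorOp_htmul, hτb, pinchₗ_apply, pinch_apply_basis,
      htmul_smul_right, map_smul, inner_smul_right]

theorem isFixedByEBChannel_of_diagonal {ι : Type} {𝓜 : Set (POVM.{u, w} H)}
    {b : HilbertBasis ι ℂ H} (hb : ∀ i, IsJointEigenvector (effects 𝓜) (b i)) :
    IsFixedByEBChannel 𝓜 :=
  ⟨pinchChannel b, pinchₗ b, pinchChannel_isEntanglementBreaking b,
    pinchChannel_isHeisenbergDual b, fun _ hE => pinch_eq_self hb hE⟩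

end Product

end PinchingEB
end QMeas

end

theorem mainTheorem7 {H : Type u} [NormedAddCommGroup H] [InnerProductSpace ℂ H]
    [CompleteSpace H] [TopologicalSpace.SeparableSpace H]
    (𝓜 : Set (QMeas.POVM.{u, w} H)) (h𝓜 : ∀ P ∈ 𝓜, P.IsPVM) :
    List.TFAE
      [QMeas.IsContextualityNonConfirming 𝓜,
        QMeas.IsFixedByEBChannel 𝓜,
        QMeas.IsBroadcastable 𝓜,
        QMeas.HasNormalSingularDecomposition 𝓜] ∧
    (QMeas.IsContextualityNonConfirming 𝓜 →
      (∀ P ∈ 𝓜, P.IsDiscrete) ∧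
      ∀ P ∈ 𝓜, ∀ Q ∈ 𝓜, ∀ (X : Set P.Ω) (Y : Set Q.Ω), MeasurableSet X → MeasurableSet Y →
        Commute (P.eff X) (Q.eff Y)) := by
  have hdiag : (∃ (ι : Type) (_ : Countable ι) (b : HilbertBasis ι ℂ H),
      ∀ i, QMeas.IsJointEigenvector (QMeas.effects 𝓜) (b i)) →
      QMeas.IsContextualityNonConfirming 𝓜 ∧ QMeas.IsFixedByEBChannel 𝓜 ∧
        QMeas.HasNormalSingularDecomposition 𝓜 := fun ⟨_, _, _, hb⟩ =>
    ⟨QMeas.isContextualityNonConfirming_of_diagonal hb, QMeas.isFixedByEBChannel_of_diagonal hb,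
      QMeas.hasNormalSingularDecomposition_of_diagonal hb⟩
  constructor
  · tfae_have 1 → 2 := fun h => (hdiag (h.exists_hilbertBasis h𝓜)).2.1
    tfae_have 2 → 4 := fun h => (hdiag (h.exists_hilbertBasis h𝓜)).2.2
    tfae_have 4 → 3 := fun h => h.isBroadcastable
    tfae_have 3 → 1 := fun h => (hdiag (h.exists_hilbertBasis h𝓜)).1
    tfae_finish
  · intro h
    obtain ⟨ι, _, b, hb⟩ := h.exists_hilbertBasis h𝓜
    exact ⟨fun P hP => QMeas.isDiscrete_of_diagonal hb hP, fun P hP Q hQ X Y hX hY =>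
      QMeas.commute_of_diagonal hb ⟨P, hP, X, hX, rfl⟩ ⟨Q, hQ, Y, hY, rfl⟩⟩
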